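/- **Notation.** For $\alpha<\beta$ and $0<r\le\infty$ let $S(\alpha,\beta,r)=\{x\in\mathbb C: 0<|x|<r,\ \alpha<\arg x<\beta\}$ (sectors are subsets of $\mathbb C^*$: some determination of the argument lies in $]\alpha,\beta[$). For $\mu\in\mathbb R$ let $V(\alpha,\beta,r,\mu)=S(\alpha,\beta,r)\cup\{|x|<\mu\}$ if $\mu>0$ and $V(\alpha,\beta,r,\mu)=\{x\in S(\alpha,\beta,r): |x|>-\mu\}$ if $\mu\le 0$. For $r_0>0$, $\mathcal H(r_0)$ is the space of functions holomorphic and bounded in $D(0,r_0)=\{|x|<r_0\}$. For $V=V(\alpha,\beta,\infty,\mu)$, $\mathcal G(V)$ is the space of functions $g$ holomorphic and bounded in $V$ with a Poincaré asymptotic expansion $g(X)\sim\sum_{m\ge1}g_mX^{-m}$ as $V\ni X\to\infty$, i.e. for each $N\in\mathbb N$ there is $C_N$ with $|X|^N\,|g(X)-\sum_{m=1}^{N-1}g_mX^{-m}|\le C_N$ for all $X\in V$. Throughout, $p\ge1$ is an integer. **Combined Gevrey expansions.** Let $V=V(\alpha,\beta,\infty,\mu)$, $S_2=S(\alpha_2,\beta_2,\eta_0)$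 and $\alpha_1<\beta_1$ with $\alpha\le\alpha_1-\beta_2<\beta_1-\alpha_2\le\beta$. Let $y(x,\eta)$ be holomorphic for $\eta\in S_2$, $x\in V(\alpha_1,\beta_1,r_0,\mu|\eta|)$, and let $a_n\in\mathcal H(r_0)$, $g_n\in\mathcal G(V)$, $g_n(X)\sim\sum_{m\ge1}g_{nm}X^{-m}$. We say that $y$ has $\sum_n(a_n(x)+g_n(x/\eta))\eta^n$ as combined asymptotic expansion, Gevrey of order $\frac1p$ and type $(L_1,L_2)$, if there is a constant $C$ such that for all $n,M,N\in\mathbb N$: $\sup_{|x|<r_0}|a_n(x)|\le CL_1^n\Gamma(\frac np+1)$; $|X|^M\,|g_n(X)-\sum_{m=1}^{M-1}g_{nm}X^{-m}|\le CL_1^nL_2^M\Gamma(\frac{M+n}p+1)$ for all $X\in V$; and $|y(x,\eta)-\sum_{n=0}^{N-1}(a_n(x)+g_n(x/\eta))\eta^n|\le CL_1^N\Gamma(\frac Np+1)|\eta|^N$ for all $\eta\in S_2$ and $x\in V(\alpha_1,\beta_1,r_0,\mu|\eta|)$. **Coherent good coverings.** Let $J,L\ge1$; the indices $j=1,\dots,J$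 and $l=1,\dots,L$ are taken cyclically, with the convention $\alpha^{j+J}=\alpha^j+2\pi$, $\beta^{j+J}=\beta^j+2\pi$ for angles with upper index. The sets $V^j=V(\alpha^j,\beta^j,\infty,\mu)$, $S_l=S(\alpha_l,\beta_l,\eta_0)$, $V_l^j(\eta)=V(\alpha_l^j,\beta_l^j,r_0,\mu|\eta|)$ form a coherent good covering with parameter $\delta$ if - $\bigcup_jV^j=\{X\in\mathbb C: |X|>-\mu\}$, $V^j\cap V^m$ is bounded for $j\notin\{m-1,m,m+1\}$, and $\alpha^{j+1}<\beta^{j}<\alpha^{j+2}$ for all $j$; - $\alpha_l<\beta_l$, $\bigcup_lS_l=\{0<|\eta|<\eta_0\}$, and $S_l\cap S_m=\emptyset$ for $l\notin\{m-1,m,m+1\}$; - $\max_l(\beta_l-\alpha_l)\le\delta<\frac12\min_j(\beta^j-\alpha^{j+1})$; - $\alpha_l^j=\alpha^j+\varphi_l+\delta$ and $\beta_l^j=\beta^j+\varphi_l-\delta$, where $\varphi_l=(\alpha_l+\beta_l)/2$. **Theorem.** Let $p,J,L\ge1$ be integers, $\mu\in\mathbb R$, $r_0,\eta_0>0$, and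 let $V^j,S_l,V_l^j(\eta)$ be a coherent good covering with parameter $\delta$. Let $\tilde r_0>r_0$, $\tilde\mu>\mu$ and $\tilde V_l^j(\eta)=V(\alpha_l^j-2\delta,\beta_l^j+2\delta,\tilde r_0,\tilde\mu|\eta|)$. Suppose that $y_l^j(x,\eta)$ are bounded holomorphic functions, defined for $\eta\in S_l$ and $x\in\tilde V_l^j(\eta)$, and that $A,B,C>0$ are constants such that for all $j,l$ $$|y_{l+1}^j(x,\eta)-y_l^j(x,\eta)|\le C\exp\Big(-\frac A{|\eta|^p}\Big)\quad\text{if }\eta\in S_l\cap S_{l+1},\ x\in\tilde V_l^j(\eta)\cap\tilde V_{l+1}^j(\eta),$$ $$|y_l^{j+1}(x,\eta)-y_l^j(x,\eta)|\le C\exp\Big(-B\Big|\frac x\eta\Big|^p\Big)\quad\text{if }\eta\in S_l,\ x\in\tilde V_l^j(\eta)\cap\tilde V_l^{j+1}(\eta).$$ Put $\tilde A=\min(A,Br_0^p)$. Then there are functions $a_n\in\mathcal H(r_0)$ (independent of $j,l$), functions $g_n^j\in\mathcal G(V^j)$ (independent of $l$), complex numbers $g_{nm}$ (independent of $j,l$)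 and a constant $\tilde C$ such that: 1. for all $j,l$, the restriction of $y_l^j$ to $\{(x,\eta):\eta\in S_l,\ x\in V_l^j(\eta)\}$ has $\sum_n(a_n(x)+g_n^j(x/\eta))\eta^n$ as combined asymptotic expansion, Gevrey of order $\frac1p$ and type $(\tilde A^{-1/p},B^{-1/p})$; 2. for all $j,l$, all $\eta\in S_l$, all $x\in V_l^j(\eta)$ and all integers $N>0$, $$\Big|y_l^j(x,\eta)-\sum_{n=0}^{N-1}\Big(a_n(x)+g_n^j\Big(\frac x\eta\Big)\Big)\eta^n\Big|\le\tilde C\,\tilde A^{-N/p}\,\Gamma\Big(\frac Np+1\Big)|\eta|^N;$$ 3. $g_n^j(X)\sim\sum_{m\ge1}g_{nm}X^{-m}$ as $V^j\ni X\to\infty$ and, for all $j$, all $n,M\in\mathbb N$ and all $X\in V^j$, $$|X|^M\Big|g_n^j(X)-\sum_{m=1}^{M-1}g_{nm}X^{-m}\Big|\le\tilde C\,\tilde A^{-n/p}B^{-M/p}\,\Gamma\Big(\frac{M+n}p+1\Big).$$ (If $\mu\eta_0>r_0$, some $V_l^j(\eta)$ contain points with $|x|\ge r_0$; the $a_n$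 are then understood as functions on $\mathbb C$ whose restriction to $D(0,r_0)$ belongs to $\mathcal H(r_0)$.) -/

import Mathlib

namespace DAC

/-! ### Sectors, quasi-sectors, annuli (as subsets of the complex plane) -/

/-- `x ≠ 0` and some determination of the argument of `x` lies in the open interval `(α, β)`. -/
def HasArgIn (α β : ℝ) (x : ℂ) : Prop :=
  x ≠ 0 ∧ ∃ θ : ℝ, α < θ ∧ θ < β ∧ x = (‖x‖ : ℂ) * Complex.exp (θ * Complex.I)

/-- The sector `S(α, β, r) = {0 < |x| < r, α < arg x < β}`. -/
def sector (α β r : ℝ) : Set ℂ :=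
  {x | ‖x‖ < r ∧ HasArgIn α β x}

/-- The quasi-sector `V(α, β, r, μ)`, with `0 < r ≤ ∞`. If `0 < μ`, it is the union of the sector
`{|x| < r, α < arg x < β}` and of the disc `{|x| < μ}`. If `μ ≤ 0`, it is
`{-μ < |x| < r, α < arg x < β}`. Both cases are covered by the single formula below: the condition
`-μ < |x|` is void if `0 < μ`, and the condition `|x| < μ` is never satisfied if `μ ≤ 0`. -/
def quasiSector (α β : ℝ) (r : EReal) (μ : ℝ) : Set ℂ :=
  {x | (-μ < ‖x‖ ∧ (‖x‖ : EReal) < r ∧ HasArgIn α β x) ∨ ‖x‖ < μ}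

/-- The set `C(σ, ∞) = {x | σ < |x| < ∞}`; it is the whole plane if `σ < 0`. -/
def outerAnnulus (σ : ℝ) : Set ℂ :=
  {x | σ < ‖x‖}

theorem quasiSector_of_pos {α β : ℝ} {r : EReal} {μ : ℝ} (hμ : 0 < μ) :
    quasiSector α β r μ = {x | ((‖x‖ : EReal) < r ∧ HasArgIn α β x) ∨ ‖x‖ < μ} := by
  ext x
  have h : -μ < ‖x‖ := by linarith [norm_nonneg x]
  simp [quasiSector, h]

theorem quasiSector_of_nonpos {α β : ℝ} {r : EReal} {μ : ℝ} (hμ : μ ≤ 0) :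
    quasiSector α β r μ = {x | -μ < ‖x‖ ∧ (‖x‖ : EReal) < r ∧ HasArgIn α β x} := by
  ext x
  have h : ¬ ‖x‖ < μ := by linarith [norm_nonneg x]
  simp [quasiSector, h]

/-! ### Function spaces, combined formal series, combined Gevrey expansions -/

/-- `a` belongs to `H(r₀)`: it is holomorphic and bounded in the disc `|x| < r₀`. -/
def MemH (r₀ : ℝ) (a : ℂ → ℂ) : Prop :=
  DifferentiableOn ℂ a (Metric.ball 0 r₀) ∧ ∃ K : ℝ, ∀ x ∈ Metric.ball (0 : ℂ) r₀, ‖a x‖ ≤ K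

/-- `g(X) ∼ ∑_{m ≥ 1} c m X^{-m}` as `X → ∞` in `V`, in the sense of Poincaré: for every `N` the
difference of `g` and the sum of the terms with `1 ≤ m ≤ N - 1` is `O(|X|^{-N})` on `V`
(written without division, since `V` may contain `0`). -/
def HasExpansionAtInfinity (V : Set ℂ) (g : ℂ → ℂ) (c : ℕ → ℂ) : Prop :=
  ∀ N : ℕ, ∃ K : ℝ, ∀ X ∈ V,
    ‖X‖ ^ N * ‖g X - ∑ m ∈ Finset.Ico 1 N, c m * (X ^ m)⁻¹‖ ≤ K

/-- `g` belongs to `G(V)`: it is holomorphic and bounded in `V` and has an asymptotic expansion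
at infinity without constant term. -/
def MemG (V : Set ℂ) (g : ℂ → ℂ) : Prop :=
  DifferentiableOn ℂ g V ∧ (∃ K : ℝ, ∀ X ∈ V, ‖g X‖ ≤ K) ∧
    ∃ c : ℕ → ℂ, HasExpansionAtInfinity V g c

/-- With the constant `C`, the functions `g n` have compatible Gevrey expansions of order `1/p` and
type `(L₁, L₂)` at infinity, with coefficients `c n m`. -/
def CompatibleGevreyBound (p : ℕ) (L₁ L₂ C : ℝ) (V : Set ℂ) (g : ℕ → ℂ → ℂ)
    (c : ℕ → ℕ → ℂ) : Prop :=
  ∀ n M : ℕ, ∀ X ∈ V,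
    ‖X‖ ^ M * ‖g n X - ∑ m ∈ Finset.Ico 1 M, c n m * (X ^ m)⁻¹‖
      ≤ C * L₁ ^ n * L₂ ^ M * Real.Gamma (((M : ℝ) + n) / p + 1)

/-- The formal combined series `∑ (a n (x) + g n (x/η)) η ^ n`, associated to the disc of radius
`r₀` and to `V`, is Gevrey of order `1/p` and type `(L₁, L₂)`. -/
structure IsGevreyCombinedSeries (p : ℕ) (L₁ L₂ r₀ : ℝ) (V : Set ℂ)
    (a g : ℕ → ℂ → ℂ) : Prop where
  slow_mem : ∀ n, MemH r₀ (a n)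
  fast_mem : ∀ n, MemG V (g n)
  bounds : ∃ (c : ℕ → ℕ → ℂ) (C : ℝ),
    (∀ n, HasExpansionAtInfinity V (g n) (c n)) ∧
    (∀ n, ∀ x ∈ Metric.ball (0 : ℂ) r₀, ‖a n x‖ ≤ C * L₁ ^ n * Real.Gamma ((n : ℝ) / p + 1)) ∧
    CompatibleGevreyBound p L₁ L₂ C V g c

/-- The function `y (x, η)`, holomorphic for `η ∈ S(α₂, β₂, η₀)` and `x ∈ V(α₁, β₁, r₀, μ|η|)`,
has the series `∑ (a n (x) + g n (x/η)) η ^ n`, associated to the disc of radius `r₀` and to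
`V(α, β, ∞, μ)`, as a combined asymptotic expansion, Gevrey of order `1/p` and of
type `(L₁, L₂)`. -/
structure HasGevreyCombinedExpansion (p : ℕ) (L₁ L₂ : ℝ) (α β μ α₂ β₂ η₀ α₁ β₁ r₀ : ℝ)
    (y : ℂ → ℂ → ℂ) (a g : ℕ → ℂ → ℂ) : Prop where
  angle_low : α ≤ α₁ - β₂
  angle_lt : α₁ < β₁
  angle_high : β₁ - α₂ ≤ β
  series : IsGevreyCombinedSeries p L₁ L₂ r₀ (quasiSector α β ⊤ μ) a g
  holomorphic : DifferentiableOn ℂ (fun z : ℂ × ℂ => y z.1 z.2)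
    {z | z.2 ∈ sector α₂ β₂ η₀ ∧ z.1 ∈ quasiSector α₁ β₁ r₀ (μ * ‖z.2‖)}
  remainder : ∃ C : ℝ, ∀ N : ℕ, ∀ η ∈ sector α₂ β₂ η₀, ∀ x ∈ quasiSector α₁ β₁ r₀ (μ * ‖η‖),
    ‖y x η - ∑ n ∈ Finset.range N, (a n x + g n (x / η)) * η ^ n‖
      ≤ C * L₁ ^ N * Real.Gamma ((N : ℝ) / p + 1) * ‖η‖ ^ N

/-! ### Coherent good coverings

The indices `j = 1, …, J` and `l = 1, …, L` are cyclic; they are modelled by `Fin J` and `Fin L`,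
where `j + 1` is the cyclic successor of `j`. -/

/-- `2π` if `j` is the last index, and `0` otherwise. -/
noncomputable def turn {J : ℕ} (j : Fin J) : ℝ :=
  if (j : ℕ) + 1 = J then 2 * Real.pi else 0

/-- The angle `α^{j+1}`, with the convention `α^{J+1} = α^1 + 2π`. -/
noncomputable def nextAngle {J : ℕ} [NeZero J] (α : Fin J → ℝ) (j : Fin J) : ℝ :=
  α (j + 1) + turn j

/-- The quasi-sectors `V^j = V(αV j, βV j, ∞, μ)` form a good covering of `C(-μ, ∞)`. -/
structure IsGoodCoverV {J : ℕ} [NeZero J] (αV βV : Fin J → ℝ) (μ : ℝ) : Prop where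
  iUnion_eq : ⋃ j, quasiSector (αV j) (βV j) ⊤ μ = outerAnnulus (-μ)
  bounded_inter : ∀ j m : Fin J, j ≠ m - 1 → j ≠ m → j ≠ m + 1 →
    Bornology.IsBounded (quasiSector (αV j) (βV j) ⊤ μ ∩ quasiSector (αV m) (βV m) ⊤ μ)
  /-- `α^{j+1} < β^j` -/
  next_lt : ∀ j, nextAngle αV j < βV j
  /-- `β^j < α^{j+2}` -/
  lt_next_next : ∀ j, βV j < nextAngle αV (j + 1) + turn j

/-- The sectors `S_l = S(αS l, βS l, η₀)` form a good covering of the punctured disc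
`0 < |η| < η₀`. -/
structure IsGoodCoverS {L : ℕ} [NeZero L] (αS βS : Fin L → ℝ) (η₀ : ℝ) : Prop where
  angle_lt : ∀ l, αS l < βS l
  iUnion_eq : ⋃ l, sector (αS l) (βS l) η₀ = {η | 0 < ‖η‖ ∧ ‖η‖ < η₀}
  disjoint : ∀ l m : Fin L, l ≠ m - 1 → l ≠ m → l ≠ m + 1 →
    Disjoint (sector (αS l) (βS l) η₀) (sector (αS m) (βS m) η₀)

/-- The angles `αV, βV, αS, βS` and the number `δ` define a coherent good covering
`V^j`, `S_l`, `V_l^j(η)`; the sets `V_l^j(η)` are then given by `coverV` below. -/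
structure IsCoherentGoodCover {J L : ℕ} [NeZero J] [NeZero L] (αV βV : Fin J → ℝ)
    (αS βS : Fin L → ℝ) (μ η₀ δ : ℝ) : Prop where
  goodV : IsGoodCoverV αV βV μ
  goodS : IsGoodCoverS αS βS η₀
  opening_le : ∀ l, βS l - αS l ≤ δ
  lt_overlap : ∀ j, δ < (βV j - nextAngle αV j) / 2

/-- The bisecting direction `φ_l` of the sector `S_l`. -/
noncomputable def bisector {L : ℕ} (αS βS : Fin L → ℝ) (l : Fin L) : ℝ :=
  (αS l + βS l) / 2

/-- The angle `α_l^j = α^j + φ_l + δ`. -/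
noncomputable def lowAngle {J L : ℕ} (αV : Fin J → ℝ) (αS βS : Fin L → ℝ) (δ : ℝ)
    (j : Fin J) (l : Fin L) : ℝ :=
  αV j + bisector αS βS l + δ

/-- The angle `β_l^j = β^j + φ_l - δ`. -/
noncomputable def highAngle {J L : ℕ} (βV : Fin J → ℝ) (αS βS : Fin L → ℝ) (δ : ℝ)
    (j : Fin J) (l : Fin L) : ℝ :=
  βV j + bisector αS βS l - δ

/-- `V_l^j(η) = V(α_l^j, β_l^j, r₀, μ|η|)`. -/
noncomputable def coverV {J L : ℕ} (αV βV : Fin J → ℝ) (αS βS : Fin L → ℝ) (δ r₀ μ : ℝ)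
    (j : Fin J) (l : Fin L) (η : ℂ) : Set ℂ :=
  quasiSector (lowAngle αV αS βS δ j l) (highAngle βV αS βS δ j l) r₀ (μ * ‖η‖)

/-- `Ṽ_l^j(η) = V(α_l^j - 2δ, β_l^j + 2δ, r̃₀, μ̃|η|)`, where `r'` is `r̃₀` and `μ'` is `μ̃`. -/
noncomputable def bigCoverV {J L : ℕ} (αV βV : Fin J → ℝ) (αS βS : Fin L → ℝ) (δ r' μ' : ℝ)
    (j : Fin J) (l : Fin L) (η : ℂ) : Set ℂ :=
  quasiSector (lowAngle αV αS βS δ j l - 2 * δ) (highAngle βV αS βS δ j l + 2 * δ) r'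
    (μ' * ‖η‖)

end DAC

/-!
The functions `y j l` are glued smoothly instead of being represented by Cauchy–Heine integrals. In
the coordinates `X = x / η` and `u = η`, let `χ l` be a partition of unity in `arg u` subordinate to
the sectors `S_l`, let `ψ j` be one in `X` subordinate to the quasi-sectors `V^j`, and let `k₁`,
`k₂` be cutoff functions in `η` and in `x = uX`. For weights `w j` (the functions `ψ j`, their
derivatives, or differences of two partitions) consider

  `F w = k₁(u) k₂(uX) ∑ l, χ l (u) ∑ j, w j (X) y j l (uX, u)`.

When the weights have sum `0` for large `X`, `∂̄_u (F w)` is at most a constant times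

  `exp (-max (Ã / |u|^p) (B |X|^p)) / |u|`, where `Ã = min A (B r₀^p)`:

the derivatives of the `χ l` have sum `0`, so that they only meet the small differences
`y j l - y j m`; the weights only meet the small differences `y i l - y j l`; and on the support of
`∂̄ k₂` one has `|uX| ≥ r₀`, hence `B |X|^p ≥ B r₀^p / |u|^p` (`GluingData.norm_dbar_fibre_le`).

A function `f` of bounded support with such a `∂̄`-derivative has a Gevrey expansion at `0`. The
Cauchy–Pompeiu formula gives `f(η) = -π⁻¹ ∫ ∂̄f(u) / (u - η) dA(u)`, and the expansion of
`1 / (u - η)` in powers of `η` gives the coefficients `gevreyCoeff f n` and the remainder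
(`norm_sub_sum_gevreyCoeff_le`). The type `Ã^(-1/p)` is obtained without loss in the powers of `n`
because the maximum of `t^s exp (-t)` is of order `Γ(s + 1) / √s`: this leaves room for a factor
`t^(1/4)` in the majorant `flatWeight`, which makes the radial integrals converge uniformly and
absorbs the logarithmic singularities of Cauchy transforms.

The functions `y j l` are recovered as follows. The Cauchy–Pompeiu formula in the variable `X`,
applied to `F ψ`, writes it as the Cauchy transform in `X` of `fastDbar = F (∂̄ψ)` plus the Cauchy
transform in `x` of `slowDbar`, the term containing `∂̄ k₂` (`GluingData.fibre_ψ_eq`). Moreover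
`y j l = F ψ + fastDiff j + O(exp (-A / |u|^p))`, where `fastDiff j = F (δ_j - ψ)` has weights of
sum `0`. All three functions `fastDbar`, `slowDbar`, `fastDiff` have exponentially small
`∂̄`-derivatives in `u`. The coefficients of `slowDbar`, transformed in `x`, give `a_n`, and those
of `fastDbar`, transformed in `X`, plus those of `fastDiff j` give `g_n^j`. As `fastDiff j` is
exponentially small in `X`, the expansion of `g_n^j` at infinity consists of the moments of the
coefficients of `fastDbar`, which do not depend on `j` (`GluingData.exists_fastCoeff_expansion`).
All this holds for small `|η|` (`GluingData.exists_norm_y_sub_sum_le`); for `|η|` bounded below the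
remainder estimate is a consequence of the boundedness of `y j l` (`exists_norm_sub_sum_le_of_le`).
-/

namespace DAC

open MeasureTheory Set Filter Topology
open scoped ENNReal Manifold ContDiff

/-! ### Estimates for the Gamma function -/

theorem integral_Ioi_exp_neg (t : ℝ) : ∫ x in Ioi t, Real.exp (-x) = Real.exp (-t) :=
  integral_exp_neg_Ioi t

/-- `Γ (s + 1)` is at least the part of its integral over `(t, ∞)`, where `x ^ s ≥ t ^ s`. -/
theorem rpow_mul_exp_neg_le_Gamma {s t : ℝ} (hs : 0 ≤ s) (ht : 0 ≤ t) :
    t ^ s * Real.exp (-t) ≤ Real.Gamma (s + 1) := by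
  have hint := Real.GammaIntegral_convergent (s := s + 1) (by linarith)
  rw [Real.Gamma_eq_integral (by linarith)]
  have hsub : Ioi t ⊆ Ioi (0 : ℝ) := Ioi_subset_Ioi ht
  calc t ^ s * Real.exp (-t) = ∫ x in Ioi t, t ^ s * Real.exp (-x) := by
        rw [integral_const_mul, integral_Ioi_exp_neg]
    _ ≤ ∫ x in Ioi t, Real.exp (-x) * x ^ (s + 1 - 1) := by
        apply setIntegral_mono_on
        · exact (integrableOn_exp_neg_Ioi t).const_mul _
        · exact hint.mono_set hsub
        · exact measurableSet_Ioi
        · intro x hx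
          rw [mul_comm, add_sub_cancel_right]
          gcongr
          exact (mem_Ioi.1 hx).le
    _ ≤ _ := by
        apply setIntegral_mono_set hint
        · filter_upwards [ae_restrict_mem measurableSet_Ioi] with x hx
          have : (0:ℝ) < x := hx
          positivity
        · exact hsub.eventuallyLE

/-- The Gamma distribution of shape `q` has variance `q`; with the inequality
`|τ - q| ≤ (√q + (τ - q)² / √q) / 2` this bounds the maximum of `t ^ q * exp (-t)`, and gains a
factor `√q` on `rpow_mul_exp_neg_le_Gamma`. -/
theorem rpow_mul_exp_neg_le_sqrt_mul_Gamma {q t : ℝ} (hq : 0 < q) (ht : 0 < t) :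
    t ^ q * Real.exp (-t) ≤ √q * Real.Gamma q := by
  have h0 := Real.GammaIntegral_convergent (s := q) hq
  have h1 := Real.GammaIntegral_convergent (s := q + 1) (by linarith)
  have h2 := Real.GammaIntegral_convergent (s := q + 1 + 1) (by linarith)
  have hsub : Ioi t ⊆ Ioi (0 : ℝ) := Ioi_subset_Ioi ht.le
  have hd : ∀ x ∈ Ioi t, HasDerivAt (fun x => -(x ^ q * Real.exp (-x)))
      (Real.exp (-x) * x ^ (q + 1 - 1) - q * (Real.exp (-x) * x ^ (q - 1))) x := by
    intro x hx
    have hx0 : (0 : ℝ) < x := ht.trans hx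
    have := ((Real.hasDerivAt_rpow_const (p := q) (Or.inl hx0.ne')).mul
      ((hasDerivAt_neg x).exp)).neg
    refine this.congr_deriv ?_
    rw [add_sub_cancel_right]; ring
  have key : ∫ x in Ioi t, (Real.exp (-x) * x ^ (q + 1 - 1) - q * (Real.exp (-x) * x ^ (q - 1)))
      = 0 - -(t ^ q * Real.exp (-t)) := by
    apply integral_Ioi_of_hasDerivAt_of_tendsto (f := fun x => -(x ^ q * Real.exp (-x)))
    · apply ContinuousAt.continuousWithinAt
      have : ContinuousAt (fun x : ℝ => x ^ q) t := Real.continuousAt_rpow_const _ _ (Or.inl ht.ne')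
      fun_prop
    · exact hd
    · exact (h1.mono_set hsub).sub ((h0.mono_set hsub).const_mul q)
    · have := (tendsto_rpow_mul_exp_neg_mul_atTop_nhds_zero q 1 one_pos).neg
      simpa using this
  rw [zero_sub, neg_neg] at key
  have hsq : 0 < √q := Real.sqrt_pos.2 hq
  have hsq2 : √q * √q = q := Real.mul_self_sqrt hq.le
  set F : ℝ → ℝ := fun x => (√q / 2 + q * √q / 2) * (Real.exp (-x) * x ^ (q - 1))
      - √q * (Real.exp (-x) * x ^ (q + 1 - 1))
      + (1 / (2 * √q)) * (Real.exp (-x) * x ^ (q + 1 + 1 - 1)) with hF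
  have hFi : IntegrableOn F (Ioi 0) :=
    ((h0.const_mul _).sub (h1.const_mul _)).add (h2.const_mul _)
  have hFx : ∀ x ∈ Ioi (0 : ℝ), F x = Real.exp (-x) * x ^ (q - 1) *
      ((√q + (x - q) ^ 2 / √q) / 2) := by
    intro x hx
    have hx0 : (0 : ℝ) < x := hx
    have e1 : x ^ (q + 1 - 1) = x ^ (q - 1) * x := by
      rw [show q + 1 - 1 = q - 1 + 1 by ring, Real.rpow_add_one hx0.ne']
    have e2 : x ^ (q + 1 + 1 - 1) = x ^ (q - 1) * x * x := by
      rw [show q + 1 + 1 - 1 = q - 1 + 1 + 1 by ring, Real.rpow_add_one hx0.ne',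
        Real.rpow_add_one hx0.ne']
    simp only [hF, e1, e2]
    field_simp
    have : (√q) ^ 2 = q := by rw [sq, hsq2]
    rw [this]; ring
  calc t ^ q * Real.exp (-t) = _ := key.symm
    _ ≤ ∫ x in Ioi t, F x := by
        apply setIntegral_mono_on
        · exact (h1.mono_set hsub).sub ((h0.mono_set hsub).const_mul q)
        · exact hFi.mono_set hsub
        · exact measurableSet_Ioi
        · intro x hx
          have hx0 : (0 : ℝ) < x := ht.trans hx
          rw [hFx x hx0]
          have e1 : x ^ (q + 1 - 1) = x ^ (q - 1) * x := by
            rw [show q + 1 - 1 = q - 1 + 1 by ring, Real.rpow_add_one hx0.ne']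
          rw [e1]
          have : x - q ≤ (√q + (x - q) ^ 2 / √q) / 2 := by
            rw [le_div_iff₀ two_pos, ← sub_nonneg]
            have : √q + (x - q) ^ 2 / √q - (x - q) * 2 = (√q - (x - q)) ^ 2 / √q := by
              field_simp; ring
            rw [this]; positivity
          have h := mul_le_mul_of_nonneg_left this
            (by positivity : 0 ≤ Real.exp (-x) * x ^ (q - 1))
          linarith
    _ ≤ ∫ x in Ioi 0, F x := by
        apply setIntegral_mono_set hFi
        · filter_upwards [ae_restrict_mem measurableSet_Ioi] with x hx
          have : (0:ℝ) < x := hx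
          rw [hFx x hx]
          simp only [Pi.zero_apply]
          positivity
        · exact hsub.eventuallyLE
    _ = (√q / 2 + q * √q / 2) * Real.Gamma q - √q * Real.Gamma (q + 1)
          + (1 / (2 * √q)) * Real.Gamma (q + 1 + 1) := by
        have h01 : IntegrableOn (fun x : ℝ => (√q / 2 + q * √q / 2) *
            (Real.exp (-x) * x ^ (q - 1)) - √q * (Real.exp (-x) * x ^ (q + 1 - 1))) (Ioi 0) :=
          (h0.const_mul _).sub (h1.const_mul _)
        rw [Real.Gamma_eq_integral hq, Real.Gamma_eq_integral (by linarith : 0 < q + 1),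
          Real.Gamma_eq_integral (by linarith : 0 < q + 1 + 1), hF,
          integral_add h01 (h2.const_mul _),
          integral_sub (h0.const_mul _) (h1.const_mul _), integral_const_mul,
          integral_const_mul, integral_const_mul]
    _ = √q * Real.Gamma q := by
        rw [Real.Gamma_add_one (by linarith : q + 1 ≠ 0), Real.Gamma_add_one hq.ne']
        field_simp
        have : (√q) ^ 2 = q := by rw [sq, hsq2]
        rw [this]; ring

/-- By log-convexity of the Gamma function. -/
theorem Gamma_add_quarter_le {s : ℝ} (hs : 0 ≤ s) :
    Real.Gamma (s + 5 / 4) ≤ (s + 1) ^ (1 / 4 : ℝ) * Real.Gamma (s + 1) := by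
  have h := Real.Gamma_mul_add_mul_le_rpow_Gamma_mul_rpow_Gamma (s := s + 1) (t := s + 1 + 1)
    (a := 3 / 4) (b := 1 / 4) (by linarith) (by linarith) (by norm_num) (by norm_num)
    (by norm_num)
  have hG : 0 < Real.Gamma (s + 1) := Real.Gamma_pos_of_pos (by linarith)
  rw [Real.Gamma_add_one (by linarith : s + 1 ≠ 0),
    Real.mul_rpow (by linarith) hG.le] at h
  calc Real.Gamma (s + 5 / 4) = Real.Gamma (3 / 4 * (s + 1) + 1 / 4 * (s + 1 + 1)) := by
        congr 1; ring
    _ ≤ _ := h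
    _ = (s + 1) ^ (1 / 4 : ℝ) *
        (Real.Gamma (s + 1) ^ (3 / 4 : ℝ) * Real.Gamma (s + 1) ^ (1 / 4 : ℝ)) := by ring
    _ = _ := by rw [← Real.rpow_add hG]; norm_num

/-- An additional factor `t ^ (1 / 4)` costs only a constant, the maximum of `t ^ s * exp (-t)`
being of order `Γ (s + 1) / √s`. -/
theorem rpow_add_quarter_mul_exp_neg_le {s t : ℝ} (hs : 0 ≤ s) (ht : 0 < t) :
    t ^ (s + 1 / 4) * Real.exp (-t) ≤ 2 * Real.Gamma (s + 1) := by
  have hq : 0 < s + 1 / 4 := by linarith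
  have hG : 0 < Real.Gamma (s + 1) := Real.Gamma_pos_of_pos (by linarith)
  refine (rpow_mul_exp_neg_le_sqrt_mul_Gamma hq ht).trans ?_
  have h1 : Real.Gamma (s + 5 / 4) = (s + 1 / 4) * Real.Gamma (s + 1 / 4) := by
    rw [← Real.Gamma_add_one hq.ne']; congr 1; ring
  have h2 := Gamma_add_quarter_le hs
  have hsq : 0 < √(s + 1 / 4) := Real.sqrt_pos.2 hq
  have hsq2 : √(s + 1 / 4) * √(s + 1 / 4) = s + 1 / 4 := Real.mul_self_sqrt hq.le
  have h3 : (s + 1) ^ (1 / 4 : ℝ) ≤ 2 * √(s + 1 / 4) := by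
    calc (s + 1) ^ (1 / 4 : ℝ) ≤ (s + 1) ^ (1 / 2 : ℝ) :=
          Real.rpow_le_rpow_of_exponent_le (by linarith) (by norm_num)
      _ = √(s + 1) := (Real.sqrt_eq_rpow _).symm
      _ ≤ √(2 ^ 2 * (s + 1 / 4)) := Real.sqrt_le_sqrt (by linarith)
      _ = 2 * √(s + 1 / 4) := by
          rw [Real.sqrt_mul (by norm_num), Real.sqrt_sq (by norm_num)]
  rw [← mul_le_mul_iff_right₀ hsq]
  calc √(s + 1 / 4) * (√(s + 1 / 4) * Real.Gamma (s + 1 / 4))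
      = Real.Gamma (s + 5 / 4) := by rw [← mul_assoc, hsq2, h1]
    _ ≤ 2 * √(s + 1 / 4) * Real.Gamma (s + 1) := h2.trans (by gcongr)
    _ = _ := by ring

theorem Gamma_quarter_le {s : ℝ} (hs : 0 ≤ s) :
    Real.Gamma (s + 1 / 4) ≤ 4 * Real.Gamma (s + 1) := by
  have hq : 0 < s + 1 / 4 := by linarith
  have hG : 0 < Real.Gamma (s + 1) := Real.Gamma_pos_of_pos (by linarith)
  have h1 : Real.Gamma (s + 5 / 4) = (s + 1 / 4) * Real.Gamma (s + 1 / 4) := by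
    rw [← Real.Gamma_add_one hq.ne']; congr 1; ring
  have h2 := Gamma_add_quarter_le hs
  have h3 : (s + 1) ^ (1 / 4 : ℝ) ≤ 4 * (s + 1 / 4) := by
    calc (s + 1) ^ (1 / 4 : ℝ) ≤ (s + 1) ^ (1 : ℝ) :=
          Real.rpow_le_rpow_of_exponent_le (by linarith) (by norm_num)
      _ = s + 1 := Real.rpow_one _
      _ ≤ _ := by linarith
  rw [← mul_le_mul_iff_right₀ hq, ← h1]
  calc _ ≤ _ := h2
    _ ≤ 4 * (s + 1 / 4) * Real.Gamma (s + 1) := by gcongr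
    _ = _ := by ring

theorem lintegral_rpow_mul_exp_neg {s : ℝ} (hs : 0 < s) :
    ∫⁻ t in Ioi (0 : ℝ), ENNReal.ofReal (t ^ (s - 1) * Real.exp (-t))
      = ENNReal.ofReal (Real.Gamma s) := by
  rw [Real.Gamma_eq_integral hs, ofReal_integral_eq_lintegral_ofReal
    (Real.GammaIntegral_convergent hs)]
  · simp_rw [mul_comm]
  · filter_upwards [ae_restrict_mem measurableSet_Ioi] with x hx
    have : (0:ℝ) < x := hx
    simp only [Pi.zero_apply]
    positivity

/-! ### Radial integrals and the integral estimates for the Cauchy kernel -/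

/-- Integration of a radial function in polar coordinates. -/
theorem lintegral_comp_norm {q : ℝ → ℝ≥0∞} (hq : Measurable q) :
    ∫⁻ z : ℂ, q ‖z‖ = ENNReal.ofReal (2 * Real.pi) *
      ∫⁻ r in Ioi (0 : ℝ), ENNReal.ofReal r * q r := by
  rw [← Complex.lintegral_comp_polarCoord_symm]
  have h1 : ∀ᵐ x ∂((volume : Measure (ℝ × ℝ)).restrict polarCoord.target),
      ENNReal.ofReal x.1 • q ‖Complex.polarCoord.symm x‖ = ENNReal.ofReal x.1 * q x.1 := by
    filter_upwards [ae_restrict_mem polarCoord.open_target.measurableSet] with x hx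
    rw [Complex.norm_polarCoord_symm, abs_of_pos hx.1, smul_eq_mul]
  rw [lintegral_congr_ae h1, polarCoord_target, Measure.volume_eq_prod, ← Measure.prod_restrict,
    lintegral_prod _ (by fun_prop)]
  simp only [lintegral_const, Measure.restrict_apply MeasurableSet.univ, univ_inter,
    Real.volume_Ioo]
  rw [lintegral_mul_const _ (by fun_prop), mul_comm]
  congr 2
  ring

/-- Invariance, up to the factor `|κ|⁻¹`, of the measure `dt / t` under `t = c * r ^ κ`. -/
theorem lintegral_comp_const_mul_rpow {κ c : ℝ} (hκ : κ ≠ 0) (hc : 0 < c) (q : ℝ → ℝ≥0∞)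
    (hq : Measurable q) :
    ∫⁻ r in Ioi (0 : ℝ), ENNReal.ofReal r⁻¹ * q (c * r ^ κ)
      = ENNReal.ofReal |κ|⁻¹ * ∫⁻ t in Ioi (0 : ℝ), ENNReal.ofReal t⁻¹ * q t := by
  have himg : (fun r : ℝ => c * r ^ κ) '' Ioi 0 = Ioi 0 := by
    ext t
    constructor
    · rintro ⟨r, hr, rfl⟩
      have : (0 : ℝ) < r := hr
      exact mem_Ioi.2 (by positivity)
    · intro ht
      have ht0 : (0 : ℝ) < t := ht
      refine ⟨(t / c) ^ κ⁻¹, mem_Ioi.2 (by positivity), ?_⟩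
      simp only
      rw [← Real.rpow_mul (by positivity), inv_mul_cancel₀ hκ, Real.rpow_one]
      field_simp
  have hinj : InjOn (fun r : ℝ => c * r ^ κ) (Ioi 0) := by
    intro x hx y hy hxy
    have hx0 : (0 : ℝ) < x := hx
    have hy0 : (0 : ℝ) < y := hy
    exact (Real.rpow_left_inj hx0.le hy0.le hκ).1 (mul_left_cancel₀ hc.ne' hxy)
  have hd : ∀ x ∈ Ioi (0 : ℝ), HasDerivWithinAt (fun r : ℝ => c * r ^ κ)
      (c * (κ * x ^ (κ - 1))) (Ioi 0) x := fun x hx =>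
    ((Real.hasDerivAt_rpow_const (Or.inl (ne_of_gt hx))).const_mul c).hasDerivWithinAt
  have := lintegral_image_eq_lintegral_abs_deriv_mul measurableSet_Ioi hd hinj
    (fun t => ENNReal.ofReal t⁻¹ * q t)
  rw [himg] at this
  rw [this, ← lintegral_const_mul _ (by fun_prop)]
  apply setLIntegral_congr_fun measurableSet_Ioi
  intro r hr
  have hr0 : (0 : ℝ) < r := hr
  simp only
  rw [← mul_assoc, ← mul_assoc, ← ENNReal.ofReal_mul (by positivity),
    ← ENNReal.ofReal_mul (by positivity)]
  congr 2
  rw [abs_mul, abs_mul, abs_of_pos hc, abs_of_pos (Real.rpow_pos_of_pos hr0 _),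
    Real.rpow_sub_one hr0.ne']
  have := Real.rpow_pos_of_pos hr0 κ
  have h2 : |κ| ≠ 0 := abs_ne_zero.2 hκ
  field_simp

/-- Integration of a function of `c * ‖z‖ ^ κ` against `‖z‖⁻² dA(z)`, the measure on `ℂ \ {0}`
invariant under dilations. -/
theorem lintegral_norm_inv_sq_mul {κ c : ℝ} (hκ : κ ≠ 0) (hc : 0 < c) {q : ℝ → ℝ≥0∞}
    (hq : Measurable q) :
    ∫⁻ z : ℂ, ENNReal.ofReal ((‖z‖ ^ 2)⁻¹) * q (c * ‖z‖ ^ κ)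
      = ENNReal.ofReal (2 * Real.pi * |κ|⁻¹) *
        ∫⁻ t in Ioi (0 : ℝ), ENNReal.ofReal t⁻¹ * q t := by
  have h := lintegral_comp_norm (q := fun r => ENNReal.ofReal ((r ^ 2)⁻¹) * q (c * r ^ κ))
    (by fun_prop)
  rw [h, ENNReal.ofReal_mul (show (0 : ℝ) ≤ 2 * Real.pi by positivity), mul_assoc,
    ← lintegral_comp_const_mul_rpow hκ hc q hq]
  congr 1
  apply setLIntegral_congr_fun measurableSet_Ioi
  intro r hr
  have hr0 : (0 : ℝ) < r := hr
  simp only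
  rw [← mul_assoc, ← ENNReal.ofReal_mul hr0.le]
  congr 2
  field_simp

theorem lintegral_Ioc_rpow {σ b : ℝ} (hσ : 0 < σ) (hb : 0 ≤ b) :
    ∫⁻ t in Ioc 0 b, ENNReal.ofReal (t ^ (σ - 1)) = ENNReal.ofReal (b ^ σ / σ) := by
  rw [← ofReal_integral_eq_lintegral_ofReal, ← intervalIntegral.integral_of_le hb,
    integral_rpow (Or.inl (by linarith)), sub_add_cancel, Real.zero_rpow hσ.ne', sub_zero]
  · exact (intervalIntegrable_iff_integrableOn_Ioc_of_le hb).1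
      (intervalIntegral.intervalIntegrable_rpow' (by linarith))
  · filter_upwards [ae_restrict_mem measurableSet_Ioc] with x hx
    exact Real.rpow_nonneg hx.1.le _

theorem lintegral_rpow_mul_exp_neg_max_le {σ b : ℝ} (hσ : 0 < σ) (hb : 0 ≤ b) :
    ∫⁻ t in Ioi (0 : ℝ), ENNReal.ofReal (t ^ (σ - 1) * Real.exp (-max t b))
      ≤ ENNReal.ofReal (b ^ σ / σ * Real.exp (-b)) +
        ∫⁻ t in Ioi b, ENNReal.ofReal (t ^ (σ - 1) * Real.exp (-t)) := by
  rw [← Ioc_union_Ioi_eq_Ioi hb]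
  refine (lintegral_union_le _ _ _).trans (add_le_add (le_of_eq ?_) (le_of_eq ?_))
  · rw [ENNReal.ofReal_mul (by positivity), ← lintegral_Ioc_rpow hσ hb,
      ← lintegral_mul_const _ (by fun_prop)]
    apply setLIntegral_congr_fun measurableSet_Ioc
    intro t ht
    simp only
    rw [max_eq_right ht.2, ENNReal.ofReal_mul (Real.rpow_nonneg ht.1.le _)]
  · apply setLIntegral_congr_fun measurableSet_Ioi
    intro t ht
    simp only
    rw [max_eq_left (le_of_lt ht)]

/-- The factor `b ^ y` is moved under the integral: the part `t ≤ b` gives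
`b ^ (x + y + 1 / 4) * exp (-b)`, and `b ^ y ≤ t ^ y` on the part `t ≥ b`. -/
theorem rpow_mul_lintegral_exp_neg_max_le {x y b : ℝ} (hx : 0 ≤ x) (hy : 0 ≤ y) (hb : 0 ≤ b) :
    ENNReal.ofReal (b ^ y) *
      ∫⁻ t in Ioi (0 : ℝ), ENNReal.ofReal (t ^ (x + 1 / 4 - 1) * Real.exp (-max t b))
      ≤ ENNReal.ofReal (12 * Real.Gamma (x + y + 1)) := by
  have hG : 0 < Real.Gamma (x + y + 1) := Real.Gamma_pos_of_pos (by linarith)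
  have h1 : ENNReal.ofReal (b ^ y) * ENNReal.ofReal (b ^ (x + 1 / 4) / (x + 1 / 4) * Real.exp (-b))
      ≤ ENNReal.ofReal (8 * Real.Gamma (x + y + 1)) := by
    rw [← ENNReal.ofReal_mul (by positivity)]
    apply ENNReal.ofReal_le_ofReal
    rcases hb.eq_or_lt with rfl | hb
    · rw [Real.zero_rpow (by linarith : x + 1 / 4 ≠ 0)]; simp; positivity
    · have := rpow_add_quarter_mul_exp_neg_le (s := x + y) (t := b) (by linarith) hb
      calc b ^ y * (b ^ (x + 1 / 4) / (x + 1 / 4) * Real.exp (-b))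
          = (b ^ (x + y + 1 / 4) * Real.exp (-b)) / (x + 1 / 4) := by
            rw [show x + y + 1 / 4 = y + (x + 1 / 4) by ring, Real.rpow_add hb y]; ring
        _ ≤ (2 * Real.Gamma (x + y + 1)) / (1 / 4) := by
            gcongr; linarith
        _ = _ := by ring
  have h2 : ENNReal.ofReal (b ^ y) *
      ∫⁻ t in Ioi b, ENNReal.ofReal (t ^ (x + 1 / 4 - 1) * Real.exp (-t))
      ≤ ENNReal.ofReal (4 * Real.Gamma (x + y + 1)) := by
    rw [← lintegral_const_mul _ (by fun_prop)]
    calc _ ≤ ∫⁻ t in Ioi b, ENNReal.ofReal (t ^ (x + y + 1 / 4 - 1) * Real.exp (-t)) := by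
          apply setLIntegral_mono' measurableSet_Ioi
          intro t ht
          have ht0 : 0 < t := hb.trans_lt ht
          rw [← ENNReal.ofReal_mul (by positivity)]
          apply ENNReal.ofReal_le_ofReal
          rw [show x + y + 1 / 4 - 1 = y + (x + 1 / 4 - 1) by ring, Real.rpow_add ht0 y, mul_assoc]
          gcongr
          exact le_of_lt ht
      _ ≤ ∫⁻ t in Ioi 0, ENNReal.ofReal (t ^ (x + y + 1 / 4 - 1) * Real.exp (-t)) :=
          lintegral_mono_set (Ioi_subset_Ioi hb)
      _ = ENNReal.ofReal (Real.Gamma (x + y + 1 / 4)) :=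
          lintegral_rpow_mul_exp_neg (by linarith)
      _ ≤ _ := ENNReal.ofReal_le_ofReal (Gamma_quarter_le (by linarith))
  calc _ ≤ _ := mul_le_mul_right (lintegral_rpow_mul_exp_neg_max_le (by linarith) hb) _
    _ ≤ ENNReal.ofReal (8 * Real.Gamma (x + y + 1)) +
        ENNReal.ofReal (4 * Real.Gamma (x + y + 1)) := by rw [mul_add]; exact add_le_add h1 h2
    _ = _ := by rw [← ENNReal.ofReal_add (by positivity) (by positivity)]; ring_nf

theorem measurable_lintegral_exp_neg_max (σ : ℝ) :
    Measurable fun b : ℝ => ∫⁻ t in Ioi (0 : ℝ),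
      ENNReal.ofReal (t ^ (σ - 1) * Real.exp (-max t b)) := by
  apply Measurable.lintegral_prod_right'
    (f := fun z : ℝ × ℝ => ENNReal.ofReal (z.2 ^ (σ - 1) * Real.exp (-max z.2 z.1)))
  fun_prop

/-- The double integral `∬ t ^ (σ - 1) * b ^ (y - 1) * exp (-max t b)` is
`(1 / σ + 1 / y) * Γ (σ + y)`; here `σ = x + 1 / 4`. -/
theorem lintegral_rpow_mul_lintegral_exp_neg_max_le {x y : ℝ} (hx : 0 ≤ x) (hy : 0 < y) :
    ∫⁻ b in Ioi (0 : ℝ), ENNReal.ofReal (b ^ (y - 1)) *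
      ∫⁻ t in Ioi (0 : ℝ), ENNReal.ofReal (t ^ (x + 1 / 4 - 1) * Real.exp (-max t b))
      ≤ ENNReal.ofReal ((16 + 4 / y) * Real.Gamma (x + y + 1)) := by
  have hG : 0 < Real.Gamma (x + y + 1) := Real.Gamma_pos_of_pos (by linarith)
  have hG4 := Gamma_quarter_le (s := x + y) (by linarith)
  have hG0 : 0 < Real.Gamma (x + y + 1 / 4) := Real.Gamma_pos_of_pos (by linarith)
  have h1 : ∫⁻ b in Ioi (0 : ℝ), ENNReal.ofReal (b ^ (y - 1)) *
      ENNReal.ofReal (b ^ (x + 1 / 4) / (x + 1 / 4) * Real.exp (-b))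
      ≤ ENNReal.ofReal (16 * Real.Gamma (x + y + 1)) := by
    calc _ ≤ ∫⁻ b in Ioi (0 : ℝ), ENNReal.ofReal 4 *
          ENNReal.ofReal (b ^ (x + y + 1 / 4 - 1) * Real.exp (-b)) := by
          apply setLIntegral_mono' measurableSet_Ioi
          intro b hb
          have hb0 : (0 : ℝ) < b := hb
          rw [← ENNReal.ofReal_mul (by positivity), ← ENNReal.ofReal_mul (by positivity)]
          apply ENNReal.ofReal_le_ofReal
          rw [show x + y + 1 / 4 - 1 = (y - 1) + (x + 1 / 4) by ring, Real.rpow_add hb0 (y - 1)]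
          have : (x + 1 / 4)⁻¹ ≤ 4 := by
            rw [inv_le_comm₀ (by linarith) (by norm_num)]; linarith
          calc _ = (x + 1 / 4)⁻¹ * (b ^ (y - 1) * b ^ (x + 1 / 4) * Real.exp (-b)) := by ring
            _ ≤ _ := by gcongr
      _ = ENNReal.ofReal (4 * Real.Gamma (x + y + 1 / 4)) := by
          rw [lintegral_const_mul _ (by fun_prop), lintegral_rpow_mul_exp_neg (by linarith),
            ENNReal.ofReal_mul (by norm_num)]
      _ ≤ _ := ENNReal.ofReal_le_ofReal (by linarith)
  have h2 : ∫⁻ b in Ioi (0 : ℝ), ENNReal.ofReal (b ^ (y - 1)) *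
      ∫⁻ t in Ioi b, ENNReal.ofReal (t ^ (x + 1 / 4 - 1) * Real.exp (-t))
      ≤ ENNReal.ofReal (4 / y * Real.Gamma (x + y + 1)) := by
    set f : ℝ → ℝ → ℝ≥0∞ := fun b t => indicator {z : ℝ × ℝ | z.1 < z.2}
      (fun z => ENNReal.ofReal (z.1 ^ (y - 1)) *
        ENNReal.ofReal (z.2 ^ (x + 1 / 4 - 1) * Real.exp (-z.2))) (b, t) with hf
    have hfm : Measurable (Function.uncurry f) := by
      apply Measurable.indicator (by fun_prop)
      exact measurableSet_lt measurable_fst measurable_snd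
    calc _ ≤ ∫⁻ b in Ioi (0 : ℝ), ∫⁻ t in Ioi 0, f b t := by
          apply setLIntegral_mono' measurableSet_Ioi
          intro b hb
          rw [← lintegral_const_mul _ (by fun_prop)]
          calc _ = ∫⁻ t in Ioi b, f b t := by
                apply setLIntegral_congr_fun measurableSet_Ioi
                intro t ht
                simp only [hf]
                rw [indicator_of_mem (by simpa using ht)]
            _ ≤ _ := lintegral_mono_set (Ioi_subset_Ioi (le_of_lt hb))
      _ = ∫⁻ t in Ioi (0 : ℝ), ∫⁻ b in Ioi 0, f b t :=
          lintegral_lintegral_swap hfm.aemeasurable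
      _ ≤ ∫⁻ t in Ioi (0 : ℝ), ENNReal.ofReal y⁻¹ *
            ENNReal.ofReal (t ^ (x + y + 1 / 4 - 1) * Real.exp (-t)) := by
          apply setLIntegral_mono' measurableSet_Ioi
          intro t ht
          have ht0 : (0 : ℝ) < t := ht
          calc ∫⁻ b in Ioi 0, f b t ≤ ∫⁻ b in Ioi 0, indicator (Ioc 0 t)
                (fun b => ENNReal.ofReal (b ^ (y - 1)) *
                  ENNReal.ofReal (t ^ (x + 1 / 4 - 1) * Real.exp (-t))) b := by
                apply setLIntegral_mono' measurableSet_Ioi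
                intro b hb
                simp only [hf]
                by_cases h : b < t
                · rw [indicator_of_mem (by simpa using h),
                      indicator_of_mem (show b ∈ Ioc 0 t from ⟨hb, h.le⟩)]
                · rw [indicator_of_notMem (by simpa using h)]; exact zero_le
            _ = ∫⁻ b in Ioc 0 t, ENNReal.ofReal (b ^ (y - 1)) *
                  ENNReal.ofReal (t ^ (x + 1 / 4 - 1) * Real.exp (-t)) := by
                rw [lintegral_indicator measurableSet_Ioc, Measure.restrict_restrict
                  measurableSet_Ioc, inter_eq_left.2 (fun b hb => hb.1)]
            _ = _ := by
                rw [lintegral_mul_const _ (by fun_prop), lintegral_Ioc_rpow hy ht0.le,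
                  ← ENNReal.ofReal_mul (by positivity), ← ENNReal.ofReal_mul (by positivity)]
                congr 1
                rw [show x + y + 1 / 4 - 1 = y + (x + 1 / 4 - 1) by ring, Real.rpow_add ht0 y]
                ring
            _ ≤ _ := le_rfl
      _ = ENNReal.ofReal (y⁻¹ * Real.Gamma (x + y + 1 / 4)) := by
          rw [lintegral_const_mul _ (by fun_prop), lintegral_rpow_mul_exp_neg (by linarith),
            ENNReal.ofReal_mul (by positivity)]
      _ ≤ _ := by
          apply ENNReal.ofReal_le_ofReal
          calc _ ≤ y⁻¹ * (4 * Real.Gamma (x + y + 1)) := by gcongr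
            _ = _ := by ring
  calc _ ≤ ∫⁻ b in Ioi (0 : ℝ), (ENNReal.ofReal (b ^ (y - 1)) *
      ENNReal.ofReal (b ^ (x + 1 / 4) / (x + 1 / 4) * Real.exp (-b)) +
      ENNReal.ofReal (b ^ (y - 1)) *
      ∫⁻ t in Ioi b, ENNReal.ofReal (t ^ (x + 1 / 4 - 1) * Real.exp (-t))) := by
        apply setLIntegral_mono' measurableSet_Ioi
        intro b hb
        rw [← mul_add]
        exact mul_le_mul_right (lintegral_rpow_mul_exp_neg_max_le (by linarith) (le_of_lt hb)) _
    _ ≤ ENNReal.ofReal (16 * Real.Gamma (x + y + 1)) +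
        ENNReal.ofReal (4 / y * Real.Gamma (x + y + 1)) := by
        rw [lintegral_add_left (by fun_prop)]
        exact add_le_add h1 h2
    _ = _ := by
        rw [← ENNReal.ofReal_add (by positivity) (by positivity)]; ring_nf

/-! ### The weight of exponentially flat functions -/

/-- The majorant of the `∂̄`-derivative of the glued functions of `u = η`, at a point `X` with
`b = B * |X| ^ p`. The factor `(A / |u| ^ p) ^ (1 / 4)`, bounded below for bounded `u`, makes all
the exponents of the radial integrals positive, and absorbs the logarithms coming from the
singularity of the Cauchy kernel in the variable `X`. -/
noncomputable def flatWeight (A : ℝ) (p : ℕ) (b : ℝ) (u : ℂ) : ℝ :=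
  ‖u‖⁻¹ * Real.exp (-max (A / ‖u‖ ^ p) b) * (A / ‖u‖ ^ p) ^ (1 / 4 : ℝ)

theorem flatWeight_nonneg {A : ℝ} (hA : 0 < A) (p : ℕ) (b : ℝ) (u : ℂ) :
    0 ≤ flatWeight A p b u := by
  unfold flatWeight; positivity

theorem measurable_flatWeight (A : ℝ) (p : ℕ) (b : ℝ) : Measurable (flatWeight A p b) := by
  unfold flatWeight; fun_prop

theorem rpow_div_eq_inv_pow {A r : ℝ} {p : ℕ} (hA : 0 < A) (hp : 0 < p) (hr : 0 < r) (n : ℕ) :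
    (A / r ^ p) ^ ((n : ℝ) / p) = A ^ ((n : ℝ) / p) * (r ^ n)⁻¹ := by
  have hp' : (p : ℝ) ≠ 0 := by positivity
  rw [Real.div_rpow hA.le (by positivity), ← Real.rpow_natCast r p, ← Real.rpow_mul hr.le,
    mul_div_cancel₀ _ hp', Real.rpow_natCast]
  rfl

theorem mul_rpow_div_eq_pow {B r : ℝ} {p : ℕ} (hB : 0 < B) (hp : 0 < p) (hr : 0 < r) (n : ℕ) :
    (B * r ^ p) ^ ((n : ℝ) / p) = B ^ ((n : ℝ) / p) * r ^ n := by
  have hp' : (p : ℝ) ≠ 0 := by positivity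
  rw [Real.mul_rpow hB.le (by positivity), ← Real.rpow_natCast r p, ← Real.rpow_mul hr.le,
    mul_div_cancel₀ _ hp', Real.rpow_natCast]

theorem lintegral_flatWeight {A b : ℝ} {p : ℕ} (hA : 0 < A) (hp : 0 < p) (n : ℕ) :
    ∫⁻ u : ℂ, ENNReal.ofReal ((‖u‖ ^ (n + 1))⁻¹ * flatWeight A p b u)
      = ENNReal.ofReal (2 * Real.pi * (p : ℝ)⁻¹ * A ^ (-(n : ℝ) / p)) *
        ∫⁻ t in Ioi (0 : ℝ),
          ENNReal.ofReal (t ^ ((n : ℝ) / p + 1 / 4 - 1) * Real.exp (-max t b)) := by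
  have hp' : (0 : ℝ) < p := by positivity
  have h := lintegral_norm_inv_sq_mul (κ := -(p : ℝ)) (c := A) (by simpa using hp.ne') hA
    (q := fun t => ENNReal.ofReal (A ^ (-(n : ℝ) / p) * t ^ ((n : ℝ) / p) * t ^ (1 / 4 : ℝ) *
      Real.exp (-max t b))) (by fun_prop)
  have e1 : ∫⁻ u : ℂ, ENNReal.ofReal ((‖u‖ ^ (n + 1))⁻¹ * flatWeight A p b u)
      = ∫⁻ z : ℂ, ENNReal.ofReal ((‖z‖ ^ 2)⁻¹) * ENNReal.ofReal (A ^ (-(n : ℝ) / p) *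
        (A * ‖z‖ ^ (-(p : ℝ))) ^ ((n : ℝ) / p) * (A * ‖z‖ ^ (-(p : ℝ))) ^ (1 / 4 : ℝ) *
        Real.exp (-max (A * ‖z‖ ^ (-(p : ℝ))) b)) := by
    apply lintegral_congr
    intro u
    rw [← ENNReal.ofReal_mul (by positivity)]
    congr 1
    rcases eq_or_ne u 0 with rfl | hu
    · simp
    have hu' : 0 < ‖u‖ := norm_pos_iff.2 hu
    have e : A * ‖u‖ ^ (-(p : ℝ)) = A / ‖u‖ ^ p := by
      rw [Real.rpow_neg hu'.le, Real.rpow_natCast]; rfl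
    rw [e, rpow_div_eq_inv_pow hA hp hu', flatWeight]
    have e2 : A ^ (-(n : ℝ) / p) * A ^ ((n : ℝ) / p) = 1 := by
      rw [← Real.rpow_add hA, neg_div, neg_add_cancel, Real.rpow_zero]
    have e3 : A ^ (-(n : ℝ) / p) * (A ^ ((n : ℝ) / p) * (‖u‖ ^ n)⁻¹) = (‖u‖ ^ n)⁻¹ := by
      rw [← mul_assoc, e2, one_mul]
    rw [e3, pow_succ]
    field_simp
  rw [e1, h, abs_neg, abs_of_pos hp', ENNReal.ofReal_mul (show 0 ≤ 2 * Real.pi * (p : ℝ)⁻¹ by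
    positivity), mul_assoc (ENNReal.ofReal _) (ENNReal.ofReal _)]
  congr 1
  rw [← lintegral_const_mul _ (by fun_prop)]
  apply setLIntegral_congr_fun measurableSet_Ioi
  intro t ht
  have ht0 : (0 : ℝ) < t := ht
  simp only
  rw [← ENNReal.ofReal_mul (by positivity), ← ENNReal.ofReal_mul (by positivity)]
  congr 1
  rw [Real.rpow_sub_one ht0.ne', Real.rpow_add ht0]
  ring

/-- Moments of the majorant, uniformly in `b`. -/
theorem rpow_mul_lintegral_flatWeight_le {A b : ℝ} {p : ℕ} (hA : 0 < A) (hp : 0 < p)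
    (hb : 0 ≤ b) (n M : ℕ) :
    ENNReal.ofReal (b ^ ((M : ℝ) / p)) *
      ∫⁻ u : ℂ, ENNReal.ofReal ((‖u‖ ^ (n + 1))⁻¹ * flatWeight A p b u)
      ≤ ENNReal.ofReal (100 * A ^ (-(n : ℝ) / p) * Real.Gamma (((M : ℝ) + n) / p + 1)) := by
  have hG : 0 < Real.Gamma (((M : ℝ) + n) / p + 1) := Real.Gamma_pos_of_pos (by positivity)
  have hp1 : (1 : ℝ) ≤ p := by exact_mod_cast hp
  rw [lintegral_flatWeight hA hp]
  have h := rpow_mul_lintegral_exp_neg_max_le (x := (n : ℝ) / p) (y := (M : ℝ) / p)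
    (by positivity) (by positivity) hb
  rw [show (n : ℝ) / p + M / p + 1 = ((M : ℝ) + n) / p + 1 by ring] at h
  calc _ = ENNReal.ofReal (2 * Real.pi * (p : ℝ)⁻¹ * A ^ (-(n : ℝ) / p)) * _ :=
        mul_left_comm _ _ _
    _ ≤ _ := mul_le_mul_right h _
    _ ≤ _ := by
        rw [← ENNReal.ofReal_mul (by positivity)]
        apply ENNReal.ofReal_le_ofReal
        have h1 : (p : ℝ)⁻¹ ≤ 1 := inv_le_one_of_one_le₀ hp1
        have h2 := Real.pi_lt_four
        have : 2 * Real.pi * (p : ℝ)⁻¹ ≤ 2 * 4 * 1 := by gcongr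
        calc _ = (2 * Real.pi * (p : ℝ)⁻¹) * (12 * (A ^ (-(n : ℝ) / p) *
              Real.Gamma (((M : ℝ) + n) / p + 1))) := by ring
          _ ≤ (2 * 4 * 1) * (12 * (A ^ (-(n : ℝ) / p) *
              Real.Gamma (((M : ℝ) + n) / p + 1))) := by gcongr
          _ = 96 * (A ^ (-(n : ℝ) / p) * Real.Gamma (((M : ℝ) + n) / p + 1)) := by ring
          _ ≤ 100 * (A ^ (-(n : ℝ) / p) * Real.Gamma (((M : ℝ) + n) / p + 1)) := by
              gcongr; norm_num
          _ = _ := by ring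

theorem lintegral_flatWeight_le {A b : ℝ} {p : ℕ} (hA : 0 < A) (hp : 0 < p)
    (hb : 0 ≤ b) (n : ℕ) :
    ∫⁻ u : ℂ, ENNReal.ofReal ((‖u‖ ^ (n + 1))⁻¹ * flatWeight A p b u)
      ≤ ENNReal.ofReal (100 * A ^ (-(n : ℝ) / p) * Real.Gamma ((n : ℝ) / p + 1)) := by
  simpa using rpow_mul_lintegral_flatWeight_le hA hp hb n 0

/-- Double moments of the majorant, in both variables. -/
theorem lintegral_lintegral_flatWeight_le {A B : ℝ} {p : ℕ} (hA : 0 < A) (hB : 0 < B)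
    (hp : 0 < p) (n : ℕ) {M : ℕ} (hM : 0 < M) :
    ∫⁻ U : ℂ, ENNReal.ofReal ((‖U‖ ^ 2)⁻¹ * ‖U‖ ^ M) *
      ∫⁻ u : ℂ, ENNReal.ofReal ((‖u‖ ^ (n + 1))⁻¹ * flatWeight A p (B * ‖U‖ ^ p) u)
      ≤ ENNReal.ofReal (2000 * p * B ^ (-(M : ℝ) / p) * A ^ (-(n : ℝ) / p) *
        Real.Gamma (((M : ℝ) + n) / p + 1)) := by
  have hG : 0 < Real.Gamma (((M : ℝ) + n) / p + 1) := Real.Gamma_pos_of_pos (by positivity)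
  have hp1 : (1 : ℝ) ≤ p := by exact_mod_cast hp
  have hM1 : (1 : ℝ) ≤ M := by exact_mod_cast hM
  have hp' : (0 : ℝ) < p := by positivity
  have hM' : (0 : ℝ) < M := by positivity
  set I : ℝ → ℝ≥0∞ := fun b => ∫⁻ t in Ioi (0 : ℝ),
    ENNReal.ofReal (t ^ ((n : ℝ) / p + 1 / 4 - 1) * Real.exp (-max t b)) with hI
  have hIm : Measurable I := measurable_lintegral_exp_neg_max _
  set c : ℝ := 2 * Real.pi * (p : ℝ)⁻¹ * A ^ (-(n : ℝ) / p) with hc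
  have hc0 : 0 ≤ c := by positivity
  have e1 : ∫⁻ U : ℂ, ENNReal.ofReal ((‖U‖ ^ 2)⁻¹ * ‖U‖ ^ M) *
      ∫⁻ u : ℂ, ENNReal.ofReal ((‖u‖ ^ (n + 1))⁻¹ * flatWeight A p (B * ‖U‖ ^ p) u)
      = ∫⁻ U : ℂ, ENNReal.ofReal ((‖U‖ ^ 2)⁻¹) *
        (ENNReal.ofReal (c * B ^ (-(M : ℝ) / p) * (B * ‖U‖ ^ (p : ℝ)) ^ ((M : ℝ) / p)) *
          I (B * ‖U‖ ^ (p : ℝ))) := by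
    apply lintegral_congr
    intro U
    rw [lintegral_flatWeight hA hp, ← mul_assoc, ← mul_assoc, ← ENNReal.ofReal_mul (by positivity),
      ← ENNReal.ofReal_mul (by positivity)]
    rcases eq_or_ne U 0 with rfl | hU
    · simp
    have hU' : 0 < ‖U‖ := norm_pos_iff.2 hU
    rw [Real.rpow_natCast, mul_rpow_div_eq_pow hB hp hU']
    congr 2
    have e2 : B ^ (-(M : ℝ) / p) * (B ^ ((M : ℝ) / p) * ‖U‖ ^ M) = ‖U‖ ^ M := by
      rw [← mul_assoc, ← Real.rpow_add hB, neg_div, neg_add_cancel, Real.rpow_zero, one_mul]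
    rw [mul_assoc c, e2]
    ring
  rw [e1, lintegral_norm_inv_sq_mul (κ := (p : ℝ)) (c := B) hp'.ne' hB
    (q := fun b => ENNReal.ofReal (c * B ^ (-(M : ℝ) / p) * b ^ ((M : ℝ) / p)) * I b)
    (by fun_prop)]
  have e3 : ∫⁻ b in Ioi (0 : ℝ), ENNReal.ofReal b⁻¹ *
      (ENNReal.ofReal (c * B ^ (-(M : ℝ) / p) * b ^ ((M : ℝ) / p)) * I b)
      = ENNReal.ofReal (c * B ^ (-(M : ℝ) / p)) *
        ∫⁻ b in Ioi (0 : ℝ), ENNReal.ofReal (b ^ ((M : ℝ) / p - 1)) * I b := by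
    rw [← lintegral_const_mul _ (by fun_prop)]
    apply setLIntegral_congr_fun measurableSet_Ioi
    intro b hb
    have hb0 : (0 : ℝ) < b := hb
    simp only
    rw [← mul_assoc, ← mul_assoc, ← ENNReal.ofReal_mul (by positivity),
      ← ENNReal.ofReal_mul (by positivity)]
    congr 2
    rw [Real.rpow_sub_one hb0.ne']
    ring
  have h := lintegral_rpow_mul_lintegral_exp_neg_max_le (x := (n : ℝ) / p) (y := (M : ℝ) / p)
    (by positivity) (by positivity)
  rw [show (n : ℝ) / p + M / p + 1 = ((M : ℝ) + n) / p + 1 by ring] at h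
  rw [e3]
  calc _ ≤ ENNReal.ofReal (2 * Real.pi * |(p : ℝ)|⁻¹) *
        (ENNReal.ofReal (c * B ^ (-(M : ℝ) / p)) *
          ENNReal.ofReal ((16 + 4 / ((M : ℝ) / p)) * Real.Gamma (((M : ℝ) + n) / p + 1))) :=
        mul_le_mul_right (mul_le_mul_right h _) _
    _ ≤ _ := by
        rw [← ENNReal.ofReal_mul (by positivity), ← ENNReal.ofReal_mul (by positivity)]
        apply ENNReal.ofReal_le_ofReal
        have h1 : (p : ℝ)⁻¹ ≤ 1 := inv_le_one_of_one_le₀ hp1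
        have h2 := Real.pi_lt_four
        rw [abs_of_pos hp', hc]
        have h3 : 2 * Real.pi * (p : ℝ)⁻¹ ≤ 2 * 4 * 1 := by gcongr
        have h4 : 16 + 4 / ((M : ℝ) / p) ≤ 20 * p := by
          have : 4 / ((M : ℝ) / p) ≤ 4 * p := by
            rw [div_div_eq_mul_div]
            exact div_le_self (by positivity) hM1
          linarith
        have h5 : 0 ≤ A ^ (-(n : ℝ) / p) * B ^ (-(M : ℝ) / p) *
          Real.Gamma (((M : ℝ) + n) / p + 1) := by positivity
        calc _ = (2 * Real.pi * (p : ℝ)⁻¹) * (2 * Real.pi * (p : ℝ)⁻¹) *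
              (16 + 4 / ((M : ℝ) / p)) * (A ^ (-(n : ℝ) / p) * B ^ (-(M : ℝ) / p) *
              Real.Gamma (((M : ℝ) + n) / p + 1)) := by ring
          _ ≤ (2 * 4 * 1) * (2 * 4 * 1) * (20 * p) * (A ^ (-(n : ℝ) / p) * B ^ (-(M : ℝ) / p) *
              Real.Gamma (((M : ℝ) + n) / p + 1)) := by gcongr
          _ = 1280 * (p * (A ^ (-(n : ℝ) / p) * B ^ (-(M : ℝ) / p) *
              Real.Gamma (((M : ℝ) + n) / p + 1))) := by ring
          _ ≤ 2000 * (p * (A ^ (-(n : ℝ) / p) * B ^ (-(M : ℝ) / p) *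
              Real.Gamma (((M : ℝ) + n) / p + 1))) := by gcongr; norm_num
          _ = _ := by ring

/-- In polar coordinates centred at `z`, the Jacobian cancels the singularity. -/
theorem lintegral_ball_inv_norm_sub (z : ℂ) (ρ : ℝ) :
    ∫⁻ u in Metric.ball z ρ, ENNReal.ofReal (‖u - z‖⁻¹) = ENNReal.ofReal (2 * Real.pi * ρ) := by
  rw [← lintegral_indicator Metric.isOpen_ball.measurableSet]
  have h1 : ∀ u : ℂ, (Metric.ball z ρ).indicator (fun u => ENNReal.ofReal (‖u - z‖⁻¹)) u
      = (fun v : ℂ => (Iio ρ).indicator (fun r : ℝ => ENNReal.ofReal r⁻¹) ‖v‖) (u - z) := by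
    intro u
    by_cases h : ‖u - z‖ < ρ
    · rw [indicator_of_mem (by simpa [dist_eq_norm] using h)]
      simp only
      rw [indicator_of_mem (by simpa using h)]
    · rw [indicator_of_notMem (by simpa [dist_eq_norm] using h)]
      simp only
      rw [indicator_of_notMem (by simpa using h)]
  simp_rw [h1]
  rw [lintegral_sub_right_eq_self (fun v : ℂ =>
      (Iio ρ).indicator (fun r : ℝ => ENNReal.ofReal r⁻¹) ‖v‖) z,
    lintegral_comp_norm ((by fun_prop : Measurable fun r : ℝ => ENNReal.ofReal r⁻¹).indicator
      measurableSet_Iio), ENNReal.ofReal_mul (show (0 : ℝ) ≤ 2 * Real.pi by positivity)]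
  congr 1
  have h2 : ∫⁻ r in Ioi (0 : ℝ), ENNReal.ofReal r *
      (Iio ρ).indicator (fun r : ℝ => ENNReal.ofReal r⁻¹) r
      = ∫⁻ r in Ioi (0 : ℝ), (Iio ρ).indicator (fun _ => 1) r := by
    apply setLIntegral_congr_fun measurableSet_Ioi
    intro r hr
    have hr0 : (0 : ℝ) < r := hr
    by_cases h : r < ρ
    · simp only
      rw [indicator_of_mem (by simpa using h), indicator_of_mem (by simpa using h),
        ← ENNReal.ofReal_mul hr0.le, mul_inv_cancel₀ hr0.ne', ENNReal.ofReal_one]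
    · simp only
      rw [indicator_of_notMem (by simpa using h), indicator_of_notMem (by simpa using h),
        mul_zero]
  rw [h2, lintegral_indicator measurableSet_Iio, lintegral_const, one_mul,
    Measure.restrict_apply MeasurableSet.univ, univ_inter,
    Measure.restrict_apply measurableSet_Iio, Iio_inter_Ioi, Real.volume_Ioo, sub_zero]

/-- The Cauchy transform of a radially decreasing weight is largest at the origin, up to a
factor `2`. -/
theorem lintegral_div_norm_sub_le {w : ℝ → ℝ} (hw : AntitoneOn w (Ici 0))
    (hw0 : ∀ r, 0 ≤ r → 0 ≤ w r) (hwm : Measurable w) (X : ℂ) :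
    ∫⁻ U : ℂ, ENNReal.ofReal (w ‖U‖ / ‖U - X‖)
      ≤ 2 * ∫⁻ U : ℂ, ENNReal.ofReal (w ‖U‖ / ‖U‖) := by
  have hpt : ∀ᵐ U : ℂ, ENNReal.ofReal (w ‖U‖ / ‖U - X‖)
      ≤ ENNReal.ofReal (w ‖U‖ / ‖U‖) + (fun V : ℂ => ENNReal.ofReal (w ‖V‖ / ‖V‖)) (U - X) := by
    have h0 : ∀ᵐ U : ℂ, U ≠ 0 := by simp [ae_iff]
    filter_upwards [h0] with U hU
    have hU' : 0 < ‖U‖ := norm_pos_iff.2 hU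
    rcases le_total ‖U‖ ‖U - X‖ with h | h
    · refine le_add_right (ENNReal.ofReal_le_ofReal ?_)
      exact div_le_div_of_nonneg_left (hw0 _ (norm_nonneg _)) hU' h
    · refine le_add_left (ENNReal.ofReal_le_ofReal ?_)
      exact div_le_div_of_nonneg_right (hw (norm_nonneg _) (norm_nonneg _) h) (norm_nonneg _)
  refine (lintegral_mono_ae hpt).trans ?_
  have hm : Measurable fun V : ℂ => ENNReal.ofReal (w ‖V‖ / ‖V‖) := by fun_prop
  rw [lintegral_add_left hm, lintegral_sub_right_eq_self (fun V : ℂ =>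
    ENNReal.ofReal (w ‖V‖ / ‖V‖)) X, two_mul]

/-- The Cauchy transform in `U` of a weight that is exponentially small in `a` and in `U` is of the
order of `exp (-a)`, up to a logarithm of `a`, which is bounded by `a ^ (1 / 4)`. -/
theorem exists_lintegral_exp_neg_max_div_le {B a₀ : ℝ} {p : ℕ} (hB : 0 < B) (hp : 0 < p)
    (ha₀ : 0 < a₀) :
    ∃ C : ℝ, 0 ≤ C ∧ ∀ a, a₀ ≤ a → ∀ X : ℂ,
      ∫⁻ U : ℂ, ENNReal.ofReal (Real.exp (-max a (B * ‖U‖ ^ p)) / (1 + ‖U‖) / ‖U - X‖)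
        ≤ ENNReal.ofReal (C * (Real.exp (-a) * a ^ (1 / 4 : ℝ))) := by
  have hp' : (0 : ℝ) < p := by positivity
  have hp1 : (1 : ℝ) ≤ p := by exact_mod_cast hp
  -- With this `σ`, `(B * s ^ p) ^ σ` is a multiple of `s ^ (1 / 4)`, and
  -- `1 / (1 + s) ≤ s ^ (-3 / 4)`.
  set σ : ℝ := 1 / (4 * p) with hσ
  have hσ0 : 0 < σ := by positivity
  have hσ1 : σ ≤ 1 / 4 := by
    rw [hσ]; apply one_div_le_one_div_of_le (by norm_num); linarith
  refine ⟨2 * (2 * Real.pi * (p : ℝ)⁻¹ * (B ^ (-σ) *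
    (a₀ ^ (σ - 1 / 4) / σ + a₀ ^ (σ - 1 - 1 / 4)))), by positivity, fun a ha X => ?_⟩
  have ha0 : 0 < a := ha₀.trans_le ha
  have h1 := lintegral_div_norm_sub_le (w := fun r => Real.exp (-max a (B * r ^ p)) / (1 + r))
    (by
      intro r hr s hs hrs
      have hr0 : (0 : ℝ) ≤ r := hr
      simp only
      gcongr) (fun r hr => by positivity) (by fun_prop) X
  refine h1.trans ?_
  have h2 : ∫⁻ U : ℂ, ENNReal.ofReal (Real.exp (-max a (B * ‖U‖ ^ p)) / (1 + ‖U‖) / ‖U‖)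
      ≤ ∫⁻ U : ℂ, ENNReal.ofReal ((‖U‖ ^ 2)⁻¹) * ENNReal.ofReal (B ^ (-σ) *
        ((B * ‖U‖ ^ (p : ℝ)) ^ σ * Real.exp (-max (B * ‖U‖ ^ (p : ℝ)) a))) := by
    apply lintegral_mono
    intro U
    simp only
    rw [← ENNReal.ofReal_mul (by positivity)]
    apply ENNReal.ofReal_le_ofReal
    rcases eq_or_ne U 0 with rfl | hU
    · simp
    have hU' : 0 < ‖U‖ := norm_pos_iff.2 hU
    set s := ‖U‖
    rw [Real.rpow_natCast, max_comm, Real.mul_rpow hB.le (by positivity), ← Real.rpow_natCast s p,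
      ← Real.rpow_mul hU'.le, show (p : ℝ) * σ = 1 / 4 by rw [hσ]; field_simp]
    have e1 : B ^ (-σ) * B ^ σ = 1 := by rw [← Real.rpow_add hB]; simp
    have e2 : (1 + s)⁻¹ ≤ s⁻¹ * s ^ (1 / 4 : ℝ) := by
      have e3 : s⁻¹ * s ^ (1 / 4 : ℝ) = (s ^ (3 / 4 : ℝ))⁻¹ := by
        rw [← Real.rpow_neg_one s, ← Real.rpow_add hU', ← Real.rpow_neg hU'.le]; norm_num
      rw [e3]
      apply inv_anti₀ (by positivity)
      rcases le_total s 1 with h | h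
      · have := Real.rpow_le_one hU'.le h (by norm_num : (0 : ℝ) ≤ 3 / 4)
        linarith
      · have := Real.rpow_le_rpow_of_exponent_le h (by norm_num : (3 / 4 : ℝ) ≤ 1)
        rw [Real.rpow_one] at this
        linarith
    set E := Real.exp (-max (B * s ^ (p : ℝ)) a)
    have hE : 0 < E := Real.exp_pos _
    calc E / (1 + s) / s = E * s⁻¹ * (1 + s)⁻¹ := by ring
      _ ≤ E * s⁻¹ * (s⁻¹ * s ^ (1 / 4 : ℝ)) := by gcongr
      _ = (B ^ (-σ) * B ^ σ) * (E * s⁻¹ * (s⁻¹ * s ^ (1 / 4 : ℝ))) := by rw [e1, one_mul]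
      _ = _ := by rw [sq, mul_inv]; ring
  have h3 : ∫⁻ t in Ioi (0 : ℝ), ENNReal.ofReal t⁻¹ * ENNReal.ofReal (B ^ (-σ) *
      (t ^ σ * Real.exp (-max t a))) = ENNReal.ofReal (B ^ (-σ)) *
      ∫⁻ t in Ioi (0 : ℝ), ENNReal.ofReal (t ^ (σ - 1) * Real.exp (-max t a)) := by
    rw [← lintegral_const_mul _ (by fun_prop)]
    apply setLIntegral_congr_fun measurableSet_Ioi
    intro t ht
    have ht0 : (0 : ℝ) < t := ht
    simp only
    rw [← ENNReal.ofReal_mul (by positivity), ← ENNReal.ofReal_mul (by positivity),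
      Real.rpow_sub_one ht0.ne']
    congr 1
    ring
  have h4 : ∫⁻ t in Ioi a, ENNReal.ofReal (t ^ (σ - 1) * Real.exp (-t))
      ≤ ENNReal.ofReal (a ^ (σ - 1) * Real.exp (-a)) := by
    calc _ ≤ ∫⁻ t in Ioi a, ENNReal.ofReal (a ^ (σ - 1) * Real.exp (-t)) := by
          apply setLIntegral_mono' measurableSet_Ioi
          intro t ht
          apply ENNReal.ofReal_le_ofReal
          have := Real.rpow_le_rpow_of_nonpos ha0 (le_of_lt ht) (by linarith : σ - 1 ≤ 0)
          gcongr
      _ = _ := by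
          rw [← integral_Ioi_exp_neg, ← integral_const_mul, ofReal_integral_eq_lintegral_ofReal]
          · exact (integrableOn_exp_neg_Ioi a).const_mul _
          · exact Eventually.of_forall fun t => by simp only [Pi.zero_apply]; positivity
  have h5 : ∫⁻ t in Ioi (0 : ℝ), ENNReal.ofReal (t ^ (σ - 1) * Real.exp (-max t a))
      ≤ ENNReal.ofReal ((a₀ ^ (σ - 1 / 4) / σ + a₀ ^ (σ - 1 - 1 / 4)) *
        (Real.exp (-a) * a ^ (1 / 4 : ℝ))) := by
    refine (lintegral_rpow_mul_exp_neg_max_le hσ0 ha0.le).trans ?_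
    refine (add_le_add le_rfl h4).trans ?_
    rw [← ENNReal.ofReal_add (by positivity) (by positivity)]
    apply ENNReal.ofReal_le_ofReal
    have k1 : a ^ σ ≤ a₀ ^ (σ - 1 / 4) * a ^ (1 / 4 : ℝ) := by
      have := Real.rpow_le_rpow_of_nonpos ha₀ ha (by linarith : σ - 1 / 4 ≤ 0)
      calc a ^ σ = a ^ (σ - 1 / 4) * a ^ (1 / 4 : ℝ) := by rw [← Real.rpow_add ha0]; ring_nf
        _ ≤ _ := by gcongr
    have k2 : a ^ (σ - 1) ≤ a₀ ^ (σ - 1 - 1 / 4) * a ^ (1 / 4 : ℝ) := by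
      have := Real.rpow_le_rpow_of_nonpos ha₀ ha (by linarith : σ - 1 - 1 / 4 ≤ 0)
      calc a ^ (σ - 1) = a ^ (σ - 1 - 1 / 4) * a ^ (1 / 4 : ℝ) := by
            rw [← Real.rpow_add ha0]; ring_nf
        _ ≤ _ := by gcongr
    calc _ ≤ a₀ ^ (σ - 1 / 4) * a ^ (1 / 4 : ℝ) / σ * Real.exp (-a) +
          a₀ ^ (σ - 1 - 1 / 4) * a ^ (1 / 4 : ℝ) * Real.exp (-a) := by gcongr
      _ = _ := by ring
  calc _ ≤ 2 * (ENNReal.ofReal (2 * Real.pi * |(p : ℝ)|⁻¹) * (ENNReal.ofReal (B ^ (-σ)) *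
        ENNReal.ofReal ((a₀ ^ (σ - 1 / 4) / σ + a₀ ^ (σ - 1 - 1 / 4)) *
        (Real.exp (-a) * a ^ (1 / 4 : ℝ))))) := by
        refine mul_le_mul_right (h2.trans ?_) _
        rw [lintegral_norm_inv_sq_mul (κ := (p : ℝ)) hp'.ne' hB (q := fun t =>
          ENNReal.ofReal (B ^ (-σ) * (t ^ σ * Real.exp (-max t a)))) (by fun_prop), h3]
        exact mul_le_mul_right (mul_le_mul_right h5 _) _
    _ = _ := by
        rw [abs_of_pos hp', ← ENNReal.ofReal_mul (by positivity),
          ← ENNReal.ofReal_mul (by positivity), show (2 : ℝ≥0∞) = ENNReal.ofReal 2 by simp,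
          ← ENNReal.ofReal_mul (by positivity)]
        congr 1; ring

theorem inv_pow_mul_flatWeight_le {A : ℝ} {p : ℕ} (hA : 0 < A) (hp : 0 < p) (b : ℝ) (N : ℕ)
    {u : ℂ} (hu : u ≠ 0) : (‖u‖ ^ N)⁻¹ * flatWeight A p b u ≤
      ‖u‖⁻¹ * (2 * (A ^ (-(N : ℝ) / p) * Real.Gamma ((N : ℝ) / p + 1))) := by
  have hu' : 0 < ‖u‖ := norm_pos_iff.2 hu
  set a : ℝ := A / ‖u‖ ^ p with ha
  have ha0 : 0 < a := by positivity
  have k := rpow_add_quarter_mul_exp_neg_le (s := (N : ℝ) / p) (by positivity) ha0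
  rw [Real.rpow_add ha0, rpow_div_eq_inv_pow hA hp hu'] at k
  have e1 : A ^ (-(N : ℝ) / p) * A ^ ((N : ℝ) / p) = 1 := by
    rw [← Real.rpow_add hA, neg_div, neg_add_cancel, Real.rpow_zero]
  have hE : Real.exp (-max a b) ≤ Real.exp (-a) := by
    rw [Real.exp_le_exp, neg_le_neg_iff]; exact le_max_left _ _
  unfold flatWeight
  calc _ = ‖u‖⁻¹ * ((‖u‖ ^ N)⁻¹ * a ^ (1 / 4 : ℝ) * Real.exp (-max a b)) := by ring
    _ ≤ ‖u‖⁻¹ * ((‖u‖ ^ N)⁻¹ * a ^ (1 / 4 : ℝ) * Real.exp (-a)) := by gcongr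
    _ = ‖u‖⁻¹ * ((A ^ (-(N : ℝ) / p) * A ^ ((N : ℝ) / p)) *
        ((‖u‖ ^ N)⁻¹ * a ^ (1 / 4 : ℝ) * Real.exp (-a))) := by rw [e1, one_mul]
    _ = ‖u‖⁻¹ * (A ^ (-(N : ℝ) / p) *
        (A ^ ((N : ℝ) / p) * (‖u‖ ^ N)⁻¹ * a ^ (1 / 4 : ℝ) * Real.exp (-a))) := by ring
    _ ≤ ‖u‖⁻¹ * (A ^ (-(N : ℝ) / p) * (2 * Real.Gamma ((N : ℝ) / p + 1))) := by gcongr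
    _ = _ := by ring

/-- The Cauchy transform of the majorant. Near `η` the maximum of `|u| ^ (-N)` times the weight is
used, where the factor `(A / |u| ^ p) ^ (1 / 4)` costs nothing by
`rpow_add_quarter_mul_exp_neg_le`; elsewhere the kernel is at most `3 / |u|`. -/
theorem lintegral_flatWeight_div_norm_sub_le {A b : ℝ} {p : ℕ} (hA : 0 < A) (hp : 0 < p)
    (hb : 0 ≤ b) (N : ℕ) {η : ℂ} (hη : η ≠ 0) :
    ∫⁻ u : ℂ, ENNReal.ofReal ((‖u‖ ^ N)⁻¹ * flatWeight A p b u / ‖u - η‖)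
      ≤ ENNReal.ofReal (400 * A ^ (-(N : ℝ) / p) * Real.Gamma ((N : ℝ) / p + 1)) := by
  have hη' : 0 < ‖η‖ := norm_pos_iff.2 hη
  have hG : 0 < Real.Gamma ((N : ℝ) / p + 1) := Real.Gamma_pos_of_pos (by positivity)
  set S : ℝ := A ^ (-(N : ℝ) / p) * Real.Gamma ((N : ℝ) / p + 1) with hS
  have hS0 : 0 < S := by positivity
  have hsup : ∀ u : ℂ, u ≠ 0 → (‖u‖ ^ N)⁻¹ * flatWeight A p b u ≤ ‖u‖⁻¹ * (2 * S) :=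
    fun u hu => inv_pow_mul_flatWeight_le hA hp b N hu
  have hpt : ∀ u : ℂ, ENNReal.ofReal ((‖u‖ ^ N)⁻¹ * flatWeight A p b u / ‖u - η‖)
      ≤ (Metric.ball η (‖η‖ / 2)).indicator
          (fun u => ENNReal.ofReal (4 * S / ‖η‖) * ENNReal.ofReal (‖u - η‖⁻¹)) u
        + ENNReal.ofReal 3 * ENNReal.ofReal ((‖u‖ ^ (N + 1))⁻¹ * flatWeight A p b u) := by
    intro u
    have hw := flatWeight_nonneg hA p b u
    by_cases h : ‖u - η‖ < ‖η‖ / 2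
    · refine le_add_right ?_
      rw [indicator_of_mem (by simpa [dist_eq_norm] using h),
        ← ENNReal.ofReal_mul (by positivity)]
      apply ENNReal.ofReal_le_ofReal
      have h1 : ‖η‖ / 2 ≤ ‖u‖ := by
        have := norm_sub_norm_le η u
        rw [norm_sub_rev] at this
        linarith
      have hu : u ≠ 0 := norm_pos_iff.1 (by linarith)
      rw [div_eq_mul_inv]
      gcongr
      refine (hsup u hu).trans ?_
      have : ‖u‖⁻¹ ≤ (‖η‖ / 2)⁻¹ := inv_anti₀ (by positivity) h1
      calc _ ≤ (‖η‖ / 2)⁻¹ * (2 * S) := by gcongr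
        _ = _ := by field_simp; norm_num
    · refine le_add_left ?_
      rw [← ENNReal.ofReal_mul (by norm_num)]
      apply ENNReal.ofReal_le_ofReal
      rcases eq_or_ne u 0 with rfl | hu
      · simp [flatWeight]
      have hu' : 0 < ‖u‖ := norm_pos_iff.2 hu
      have h1 : ‖u‖ ≤ 3 * ‖u - η‖ := by
        have := norm_sub_norm_le u η
        linarith
      have h2 : ‖u - η‖⁻¹ ≤ 3 * ‖u‖⁻¹ := by
        have : 0 < ‖u - η‖ := by linarith
        rw [← div_eq_mul_inv, inv_eq_one_div, div_le_div_iff₀ this hu']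
        linarith
      calc _ = (‖u‖ ^ N)⁻¹ * flatWeight A p b u * ‖u - η‖⁻¹ := rfl
        _ ≤ (‖u‖ ^ N)⁻¹ * flatWeight A p b u * (3 * ‖u‖⁻¹) := by gcongr
        _ = _ := by rw [pow_succ, mul_inv]; ring
  have hm := measurable_flatWeight A p b
  calc _ ≤ _ := lintegral_mono hpt
    _ = ENNReal.ofReal (4 * S / ‖η‖) * ENNReal.ofReal (2 * Real.pi * (‖η‖ / 2)) +
        ENNReal.ofReal 3 *
          ∫⁻ u : ℂ, ENNReal.ofReal ((‖u‖ ^ (N + 1))⁻¹ * flatWeight A p b u) := by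
        rw [lintegral_add_right _ (by fun_prop), lintegral_const_mul _ (by fun_prop),
          lintegral_indicator Metric.isOpen_ball.measurableSet,
          lintegral_const_mul _ (by fun_prop), lintegral_ball_inv_norm_sub]
    _ ≤ ENNReal.ofReal (4 * S / ‖η‖) * ENNReal.ofReal (2 * Real.pi * (‖η‖ / 2)) +
        ENNReal.ofReal 3 * ENNReal.ofReal (100 * A ^ (-(N : ℝ) / p) *
          Real.Gamma ((N : ℝ) / p + 1)) := by
        gcongr; exact lintegral_flatWeight_le hA hp hb N
    _ ≤ _ := by
        rw [← ENNReal.ofReal_mul (by positivity), ← ENNReal.ofReal_mul (by norm_num),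
          ← ENNReal.ofReal_add (by positivity) (by positivity)]
        apply ENNReal.ofReal_le_ofReal
        have h1 : 4 * S / ‖η‖ * (2 * Real.pi * (‖η‖ / 2)) = 4 * Real.pi * S := by
          field_simp
        have h2 : 4 * Real.pi * S ≤ 100 * S := by
          gcongr; linarith [Real.pi_lt_four]
        rw [h1, mul_assoc 100, mul_assoc 400, ← hS]
        linarith

/-! ### The Cauchy–Pompeiu formula -/

/-- The Wirtinger derivative `∂f/∂z̄`. -/
noncomputable def dbar (f : ℂ → ℂ) (z : ℂ) : ℂ :=
  (fderiv ℝ f z 1 + Complex.I * fderiv ℝ f z Complex.I) / 2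

theorem norm_dbar_le (f : ℂ → ℂ) (z : ℂ) : ‖dbar f z‖ ≤ ‖fderiv ℝ f z‖ := by
  have h1 := (fderiv ℝ f z).le_opNorm 1
  have h2 := (fderiv ℝ f z).le_opNorm Complex.I
  have h3 := norm_add_le (fderiv ℝ f z 1) (Complex.I * fderiv ℝ f z Complex.I)
  rw [norm_mul, Complex.norm_I] at h3
  rw [Complex.norm_I] at h2
  rw [norm_one] at h1
  rw [dbar, norm_div, Complex.norm_ofNat]
  linarith

theorem measurable_dbar (f : ℂ → ℂ) : Measurable (dbar f) := by
  have h1 := measurable_fderiv_apply_const ℝ f (1 : ℂ)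
  have h2 := measurable_fderiv_apply_const ℝ f Complex.I
  unfold dbar
  fun_prop

theorem dbar_congr {f g : ℂ → ℂ} {z : ℂ} (h : f =ᶠ[𝓝 z] g) : dbar f z = dbar g z := by
  unfold dbar; rw [h.fderiv_eq]

theorem dbar_const (c z : ℂ) : dbar (fun _ => c) z = 0 := by
  simp [dbar]

theorem dbar_sum {ι : Type*} (s : Finset ι) {f : ι → ℂ → ℂ} {z : ℂ}
    (h : ∀ i ∈ s, DifferentiableAt ℝ (f i) z) :
    dbar (fun w => ∑ i ∈ s, f i w) z = ∑ i ∈ s, dbar (f i) z := by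
  unfold dbar
  rw [fderiv_fun_sum h]
  simp only [_root_.sum_apply, Finset.mul_sum, ← Finset.sum_add_distrib,
    Finset.sum_div]

theorem dbar_mul {f g : ℂ → ℂ} {z : ℂ} (hf : DifferentiableAt ℝ f z)
    (hg : DifferentiableAt ℝ g z) :
    dbar (fun w => f w * g w) z = dbar f z * g z + f z * dbar g z := by
  unfold dbar
  rw [fderiv_fun_mul hf hg]
  simp only [_root_.add_apply, _root_.smul_apply, smul_eq_mul]
  ring

theorem dbar_eq_zero {f : ℂ → ℂ} {z : ℂ} (hf : DifferentiableAt ℂ f z) : dbar f z = 0 := by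
  unfold dbar
  rw [hf.fderiv_restrictScalars ℝ]
  simp only [ContinuousLinearMap.coe_restrictScalars']
  have : fderiv ℂ f z Complex.I = Complex.I * fderiv ℂ f z 1 := by
    rw [← smul_eq_mul, ← map_smul]; simp
  rw [this, ← mul_assoc, Complex.I_mul_I]
  ring

theorem continuous_dbar {f : ℂ → ℂ} (hf : ContDiff ℝ 1 f) : Continuous (dbar f) := by
  have := hf.continuous_fderiv one_ne_zero
  unfold dbar
  fun_prop

/-- The Cauchy–Pompeiu formula at the origin. In polar coordinates the integrand is half the sum of
a radial derivative, with integral `-f 0` along each ray, and of a multiple of an angular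
derivative, with integral `0` along each circle. -/
theorem cauchyPompeiu_polar {f : ℂ → ℂ} (hf : ContDiff ℝ 1 f) (hc : HasCompactSupport f) :
    ∫ w : ℂ, dbar f w / w = -Real.pi * f 0 := by
  obtain ⟨R, hR⟩ := (hc.isCompact.isBounded).subset_closedBall 0
  have hf0 : ∀ w : ℂ, R < ‖w‖ → f w = 0 := fun w hw => by
    by_contra h
    have := hR (subset_tsupport f h)
    rw [mem_closedBall_zero_iff] at this
    linarith
  have hf1 : ∀ w : ℂ, R < ‖w‖ → fderiv ℝ f w = 0 := fun w hw => by
    by_contra h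
    have := hR (tsupport_fderiv_subset ℝ (subset_tsupport _ h))
    rw [mem_closedBall_zero_iff] at this
    linarith
  set e : ℝ → ℂ := fun θ => Complex.exp (θ * Complex.I) with he
  have hen : ∀ θ, ‖e θ‖ = 1 := fun θ => Complex.norm_exp_ofReal_mul_I θ
  have hec : Continuous e := by fun_prop
  have hfc := hf.continuous_fderiv one_ne_zero
  have hfd : Differentiable ℝ f := hf.differentiable one_ne_zero
  set Fr : ℝ × ℝ → ℂ := fun q => fderiv ℝ f (q.1 * e q.2) (e q.2) with hFr
  set Ft : ℝ × ℝ → ℂ := fun q => fderiv ℝ f (q.1 * e q.2) (Complex.I * e q.2) with hFt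
  have hFrc : Continuous Fr := by fun_prop
  have hFtc : Continuous Ft := by fun_prop
  have hsupp : ∀ q ∈ polarCoord.target \ (Icc 0 R ×ˢ Icc (-Real.pi) Real.pi),
      fderiv ℝ f (q.1 * e q.2) = 0 := by
    rintro ⟨r, θ⟩ ⟨h1, h2⟩
    rw [polarCoord_target] at h1
    obtain ⟨h1a, h1b⟩ := h1
    have hr0 : (0 : ℝ) < r := h1a
    apply hf1
    simp only [norm_mul, hen, mul_one, Complex.norm_real, Real.norm_eq_abs]
    rw [abs_of_pos hr0]
    by_contra h
    exact h2 ⟨⟨hr0.le, not_lt.1 h⟩, ⟨h1b.1.le, h1b.2.le⟩⟩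
  have hK : IsCompact (Icc 0 R ×ˢ Icc (-Real.pi) Real.pi) := isCompact_Icc.prod isCompact_Icc
  have hFri : IntegrableOn Fr polarCoord.target :=
    (hFrc.continuousOn.integrableOn_compact hK).of_forall_sdiff_eq_zero
      polarCoord.open_target.measurableSet fun q hq => by simp only [hFr]; rw [hsupp q hq]; rfl
  have hFti : IntegrableOn Ft polarCoord.target :=
    (hFtc.continuousOn.integrableOn_compact hK).of_forall_sdiff_eq_zero
      polarCoord.open_target.measurableSet fun q hq => by simp only [hFt]; rw [hsupp q hq]; rfl
  have hint : ∫ w : ℂ, dbar f w / w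
      = ∫ q in polarCoord.target, (Fr q + Complex.I * Ft q) / 2 := by
    rw [← Complex.integral_comp_polarCoord_symm]
    apply setIntegral_congr_fun polarCoord.open_target.measurableSet
    rintro ⟨r, θ⟩ hq
    have hr0 : (0 : ℝ) < r := by
      rw [polarCoord_target] at hq; exact hq.1
    have hre : (Complex.polarCoord.symm (r, θ) : ℂ) = r * e θ := by
      rw [Complex.polarCoord_symm_apply, he]
      simp only
      rw [Complex.exp_mul_I]; push_cast; rfl
    simp only [hre, hFr, hFt, dbar]
    set D := fderiv ℝ f (r * e θ)
    have hlin : ∀ v : ℂ, D v = v.re * D 1 + v.im * D Complex.I := by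
      intro v
      have hv : v = v.re • (1 : ℂ) + v.im • Complex.I := by
        simp
      conv_lhs => rw [hv]
      rw [map_add, map_smul, map_smul]
      simp
    have hee : e θ = Real.cos θ + Real.sin θ * Complex.I := by
      rw [he]; simp only; rw [Complex.exp_mul_I]; push_cast; rfl
    have hre1 : (e θ).re = Real.cos θ := by
      rw [he]; exact Complex.exp_ofReal_mul_I_re θ
    have him1 : (e θ).im = Real.sin θ := by
      rw [he]; exact Complex.exp_ofReal_mul_I_im θ
    rw [hlin (e θ), hlin (Complex.I * e θ), Complex.I_mul_re, Complex.I_mul_im, hre1, him1]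
    have hr0' : (r : ℂ) ≠ 0 := by exact_mod_cast hr0.ne'
    have he0 : e θ ≠ 0 := Complex.exp_ne_zero _
    have hcs : (Real.cos θ : ℂ) ^ 2 + (Real.sin θ : ℂ) ^ 2 = 1 := by
      exact_mod_cast Real.cos_sq_add_sin_sq θ
    rw [Complex.real_smul, div_div, mul_div_assoc',
      div_eq_div_iff (mul_ne_zero two_ne_zero (mul_ne_zero hr0' he0)) two_ne_zero, hee]
    push_cast at hcs ⊢
    linear_combination (-2 * r * (D 1 + Complex.I * D Complex.I) * hcs +
      2 * r * D 1 * Complex.sin θ ^ 2 * Complex.I_sq +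
      2 * r * Complex.I * D Complex.I * Complex.sin θ ^ 2 * Complex.I_sq +
      (-2 * r * Complex.I * D Complex.I * Complex.sin θ ^ 2 -
        2 * r * D Complex.I * Complex.sin θ * Complex.cos θ) * Complex.I_sq)
  have hr : ∫ q in polarCoord.target, Fr q = -(2 * Real.pi) * f 0 := by
    rw [polarCoord_target] at hFri ⊢
    rw [IntegrableOn, Measure.volume_eq_prod, ← Measure.prod_restrict] at hFri
    rw [Measure.volume_eq_prod, ← Measure.prod_restrict, integral_prod_symm _ hFri]
    have hin : ∀ θ : ℝ, ∫ r in Ioi (0 : ℝ), Fr (r, θ) = 0 - f 0 := by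
      intro θ
      have h := integral_Ioi_of_hasDerivAt_of_tendsto (f := fun r : ℝ => f (r * e θ))
        (f' := fun r => Fr (r, θ)) (a := 0) (m := 0)
      rw [h]
      · simp
      · have := hf.continuous
        exact Continuous.continuousWithinAt (by fun_prop)
      · intro r _
        have h1 : HasDerivAt (fun r : ℝ => (r : ℂ) * e θ) (e θ) r := by
          simpa using (Complex.ofRealCLM.hasDerivAt (x := r)).mul_const (e θ)
        exact (hfd (r * e θ)).hasFDerivAt.comp_hasDerivAt r h1
      · refine ((hFrc.comp (by fun_prop : Continuous fun r : ℝ => (r, θ))).continuousOn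
          |>.integrableOn_compact (isCompact_Icc (a := 0) (b := R))).of_forall_sdiff_eq_zero
          measurableSet_Ioi ?_
        intro r hr
        have hr0 : (0 : ℝ) < r := hr.1
        have hrR : R < r := by
          by_contra h
          exact hr.2 ⟨hr0.le, not_lt.1 h⟩
        simp only [hFr, Function.comp]
        rw [hf1 _ (by simpa [hen, abs_of_pos hr0] using hrR)]
        rfl
      · apply tendsto_const_nhds.congr'
        filter_upwards [eventually_gt_atTop R, eventually_gt_atTop 0] with r hr hr0
        rw [hf0 _ (by simpa [hen, abs_of_pos hr0] using hr)]
    simp only [hin]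
    rw [integral_const, measureReal_restrict_apply MeasurableSet.univ, univ_inter,
      Real.volume_real_Ioo_of_le (by linarith [Real.pi_pos]), zero_sub, Complex.real_smul]
    push_cast
    ring
  have ht : ∫ q in polarCoord.target, Ft q = 0 := by
    rw [polarCoord_target, Measure.volume_eq_prod] at hFti ⊢
    rw [setIntegral_prod _ hFti]
    apply setIntegral_eq_zero_of_forall_eq_zero
    intro r hr
    have hr0 : (0 : ℝ) < r := hr
    have hr0' : (r : ℂ) ≠ 0 := by exact_mod_cast hr0.ne'
    have hder : ∀ θ : ℝ, HasDerivAt (fun θ : ℝ => f (r * e θ)) (r * Ft (r, θ)) θ := by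
      intro θ
      have h1 : HasDerivAt (fun θ : ℝ => (r : ℂ) * e θ) (r • (Complex.I * e θ)) θ := by
        have h2 : HasDerivAt (fun θ : ℝ => (θ : ℂ) * Complex.I) Complex.I θ := by
          simpa using (Complex.ofRealCLM.hasDerivAt (x := θ)).mul_const Complex.I
        have h3 := (h2.cexp).const_mul (r : ℂ)
        refine h3.congr_deriv ?_
        rw [Complex.real_smul, he]; ring
      have h4 := (hfd (r * e θ)).hasFDerivAt.comp_hasDerivAt θ h1
      refine h4.congr_deriv ?_
      rw [map_smul, Complex.real_smul]
    have hper := intervalIntegral.integral_eq_sub_of_hasDerivAt (a := -Real.pi) (b := Real.pi)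
      (fun θ _ => hder θ) (Continuous.intervalIntegrable (by fun_prop) _ _)
    have hpi : e Real.pi = e (-Real.pi) := by
      simp [he, Complex.exp_neg]
    rw [hpi, sub_self, intervalIntegral.integral_const_mul,
      intervalIntegral.integral_of_le (by linarith [Real.pi_pos]),
      integral_Ioc_eq_integral_Ioo] at hper
    exact (mul_eq_zero.1 hper).resolve_left hr0'
  rw [hint, integral_div, integral_add hFri (hFti.const_mul _), integral_const_mul, hr, ht]
  ring

theorem cauchyPompeiu {f : ℂ → ℂ} (hf : ContDiff ℝ 1 f) (hc : HasCompactSupport f) (z : ℂ) :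
    f z = -(Real.pi : ℂ)⁻¹ * ∫ u : ℂ, dbar f u / (u - z) := by
  have h := cauchyPompeiu_polar (f := fun w => f (z + w)) (by fun_prop)
    (hc.comp_homeomorph (Homeomorph.addLeft z))
  have e : ∀ w, dbar (fun w => f (z + w)) w / w = (fun u => dbar f u / (u - z)) (z + w) := by
    intro w
    simp only [dbar, fderiv_comp_add_left, add_sub_cancel_left]
  simp_rw [e] at h
  rw [integral_add_left_eq_self (fun u => dbar f u / (u - z)) z, add_zero] at h
  have hpi : (Real.pi : ℂ) ≠ 0 := by exact_mod_cast Real.pi_ne_zero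
  rw [h]
  field_simp

/-- A `C¹` function equal to `1` on the disc of radius `r₁` and to `0` outside the disc of
radius `r₂`. -/
theorem exists_cutoff {r₁ r₂ : ℝ} (h1 : 0 < r₁) (h2 : r₁ < r₂) :
    ∃ k : ℂ → ℂ, ContDiff ℝ 1 k ∧ (∀ u, ‖u‖ ≤ r₁ → k u = 1) ∧ (∀ u, r₂ ≤ ‖u‖ → k u = 0) ∧
      (∀ u, ‖k u‖ ≤ 1) ∧ (∀ u, ‖1 - k u‖ ≤ 1) ∧
      (∀ u, ‖u‖ < r₁ → fderiv ℝ k u = 0) ∧ (∀ u, r₂ < ‖u‖ → fderiv ℝ k u = 0) ∧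
      ∃ C, 0 ≤ C ∧ ∀ u, ‖fderiv ℝ k u‖ ≤ C := by
  let θ : ContDiffBump (0 : ℂ) := ⟨r₁, r₂, h1, h2⟩
  have hθ : ContDiff ℝ 1 (fun u => (θ u : ℂ)) := Complex.ofRealCLM.contDiff.comp θ.contDiff
  have hone : ∀ u : ℂ, ‖u‖ ≤ r₁ → (θ u : ℂ) = 1 := fun u hu => by
    rw [θ.one_of_mem_closedBall (by simpa using hu)]; simp
  have hzero : ∀ u : ℂ, r₂ ≤ ‖u‖ → (θ u : ℂ) = 0 := fun u hu => by
    rw [θ.zero_of_le_dist (by simpa using hu)]; simp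
  refine ⟨fun u => (θ u : ℂ), hθ, hone, hzero, fun u => ?_, fun u => ?_, fun u hu => ?_,
    fun u hu => ?_, ?_⟩
  · rw [Complex.norm_real, Real.norm_eq_abs, abs_of_nonneg θ.nonneg]
    exact θ.le_one
  · rw [← Complex.ofReal_one, ← Complex.ofReal_sub, Complex.norm_real, Real.norm_eq_abs,
      abs_of_nonneg (by linarith [θ.le_one (x := u)])]
    linarith [θ.nonneg (x := u)]
  · have : (fun u => (θ u : ℂ)) =ᶠ[𝓝 u] fun _ => 1 := by
      filter_upwards [(isOpen_lt continuous_norm continuous_const).mem_nhds hu] with v hv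
      exact hone v (le_of_lt hv)
    rw [this.fderiv_eq]; simp
  · have : (fun u => (θ u : ℂ)) =ᶠ[𝓝 u] fun _ => 0 := by
      filter_upwards [(isOpen_lt continuous_const continuous_norm).mem_nhds hu] with v hv
      exact hzero v (le_of_lt hv)
    rw [this.fderiv_eq]; simp
  · have hcs : HasCompactSupport (fun u => (θ u : ℂ)) :=
      θ.hasCompactSupport.comp_left (g := fun x : ℝ => (x : ℂ)) (by simp)
    obtain ⟨C, hC⟩ := (hθ.continuous_fderiv one_ne_zero).bounded_above_of_compact_support
      (hcs.fderiv (𝕜 := ℝ))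
    exact ⟨C, (norm_nonneg _).trans (hC 0), hC⟩

theorem norm_fderiv_comp_const_mul_le {k : ℂ → ℂ} {c u : ℂ} (hk : DifferentiableAt ℝ k (c * u)) :
    ‖fderiv ℝ (fun v => k (c * v)) u‖ ≤ ‖c‖ * ‖fderiv ℝ k (c * u)‖ := by
  have h1 : HasFDerivAt (fun v : ℂ => c * v) (ContinuousLinearMap.mul ℝ ℂ c) u :=
    (ContinuousLinearMap.mul ℝ ℂ c).hasFDerivAt
  have h2 := (hk.hasFDerivAt.comp u h1).fderiv
  have h3 : fderiv ℝ (fun v => k (c * v)) u =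
      (fderiv ℝ k (c * u)).comp (ContinuousLinearMap.mul ℝ ℂ c) := h2
  rw [h3, mul_comm ‖c‖]
  refine (ContinuousLinearMap.opNorm_comp_le _ _).trans
    (mul_le_mul_of_nonneg_left ?_ (norm_nonneg _))
  exact ContinuousLinearMap.opNorm_mul_apply_le ℝ ℂ c

theorem integrableOn_inv_norm_sub (z : ℂ) (R : ℝ) :
    IntegrableOn (fun u : ℂ => ‖u - z‖⁻¹) (Metric.closedBall 0 R) := by
  have h : IntegrableOn (fun u : ℂ => ‖u - z‖⁻¹) (Metric.ball z (R + ‖z‖ + 1)) := by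
    refine ⟨(by fun_prop : Measurable fun u : ℂ => ‖u - z‖⁻¹).aestronglyMeasurable, ?_⟩
    rw [hasFiniteIntegral_iff_ofReal (Eventually.of_forall fun u => by positivity),
      lintegral_ball_inv_norm_sub]
    exact ENNReal.ofReal_lt_top
  apply h.mono_set
  intro u hu
  rw [mem_closedBall_zero_iff] at hu
  rw [Metric.mem_ball, dist_eq_norm]
  linarith [norm_sub_le u z]

theorem hasCompactSupport_of_norm {f : ℂ → ℂ} {R : ℝ} (h : ∀ u, R < ‖u‖ → f u = 0) :
    HasCompactSupport f := by
  apply HasCompactSupport.intro (isCompact_closedBall (0 : ℂ) R)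
  intro u hu
  apply h
  simpa using hu

theorem dbar_eq_zero_of_norm {f : ℂ → ℂ} {R : ℝ} (h : ∀ u, R < ‖u‖ → f u = 0) {u : ℂ}
    (hu : R < ‖u‖) : dbar f u = 0 := by
  have : f =ᶠ[𝓝 u] fun _ => 0 := by
    filter_upwards [(isOpen_lt continuous_const continuous_norm).mem_nhds hu] with v hv
    exact h v hv
  rw [dbar_congr this, dbar_const]

theorem dbar_eq_zero_of_fderiv_eq_zero {f : ℂ → ℂ} {u : ℂ} (h : fderiv ℝ f u = 0) :
    dbar f u = 0 := by simp [dbar, h]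

/-- The Cauchy–Pompeiu formula for a function which may be singular at the origin: the singularity
is removed by a cutoff at scale `ε`, whose derivative is `O (1 / |u|)` uniformly in `ε`. -/
theorem cauchyPompeiu_punctured {f : ℂ → ℂ} {K K' R : ℝ}
    (hf : ∀ u, u ≠ 0 → ContDiffAt ℝ 1 f u) (hb : ∀ u, ‖f u‖ ≤ K)
    (hs : ∀ u, R < ‖u‖ → f u = 0) (hd : ∀ u, u ≠ 0 → ‖dbar f u‖ ≤ K') {z : ℂ} (hz : z ≠ 0) :
    f z = -(Real.pi : ℂ)⁻¹ * ∫ u : ℂ, dbar f u / (u - z) := by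
  obtain ⟨k, hk, hk1, hk0, -, hkn, -, hkd0, C, hC0, hC⟩ := exists_cutoff one_pos one_lt_two
  have hK0 : 0 ≤ K := (norm_nonneg _).trans (hb 0)
  have hK'0 : 0 ≤ K' := (norm_nonneg _).trans (hd z hz)
  have hz' : 0 < ‖z‖ := norm_pos_iff.2 hz
  -- the cutoff at scale `1 / (n + 1)`
  set cut : ℕ → ℂ → ℂ := fun n u => 1 - k ((n + 1 : ℂ) * u) with hcut
  have hn : ∀ n : ℕ, ‖(n + 1 : ℂ)‖ = n + 1 := fun n => by
    rw [← Nat.cast_succ, Complex.norm_natCast]; push_cast; rfl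
  have hcutc : ∀ n, ContDiff ℝ 1 (cut n) := fun n => by
    have : ContDiff ℝ 1 fun u : ℂ => (n + 1 : ℂ) * u := contDiff_const.mul contDiff_id
    exact contDiff_const.sub (hk.comp this)
  have hcut0 : ∀ n, cut n =ᶠ[𝓝 0] fun _ => 0 := fun n => by
    have : ∀ᶠ u : ℂ in 𝓝 0, ‖(n + 1 : ℂ) * u‖ < 1 := by
      apply (isOpen_lt (by fun_prop) continuous_const).mem_nhds
      simp
    filter_upwards [this] with u hu
    simp only [hcut]
    rw [hk1 _ hu.le, sub_self]
  have hcutev : ∀ u : ℂ, u ≠ 0 → ∀ᶠ n in atTop, cut n =ᶠ[𝓝 u] fun _ => 1 := by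
    intro u hu
    have hu' : 0 < ‖u‖ := norm_pos_iff.2 hu
    filter_upwards [eventually_gt_atTop ⌈2 / ‖u‖⌉₊] with n hn'
    have h1 : 2 / ‖u‖ < n + 1 := by
      have := Nat.lt_of_ceil_lt hn'
      linarith
    have h2 : 2 < ‖(n + 1 : ℂ) * u‖ := by
      rw [norm_mul, hn]; rwa [div_lt_iff₀ hu'] at h1
    filter_upwards [(isOpen_lt (continuous_const (y := (2 : ℝ)))
      (by fun_prop : Continuous fun v : ℂ => ‖(n + 1 : ℂ) * v‖)).mem_nhds h2] with v hv
    simp only [hcut]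
    rw [hk0 _ (le_of_lt hv), sub_zero]
  have hcutd : ∀ n u, u ≠ 0 → ‖dbar (cut n) u‖ ≤ 2 * C * ‖u‖⁻¹ := by
    intro n u hu
    have hu' : 0 < ‖u‖ := norm_pos_iff.2 hu
    refine (norm_dbar_le _ _).trans ?_
    have e1 : fderiv ℝ (cut n) u = -fderiv ℝ (fun v => k ((n + 1 : ℂ) * v)) u := by
      simp only [hcut, fderiv_const_sub]
    rw [e1, norm_neg]
    refine (norm_fderiv_comp_const_mul_le (hk.differentiable one_ne_zero _)).trans ?_
    rcases le_or_gt ‖(n + 1 : ℂ) * u‖ 2 with h | h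
    · rw [norm_mul, ← le_div_iff₀ hu'] at h
      calc _ ≤ 2 / ‖u‖ * C := by gcongr; exact hC _
        _ = _ := by ring
    · rw [hkd0 _ h, norm_zero, mul_zero]; positivity
  set F : ℕ → ℂ → ℂ := fun n u => cut n u * f u with hF
  have hFc : ∀ n, ContDiff ℝ 1 (F n) := by
    intro n
    rw [contDiff_iff_contDiffAt]
    intro u
    rcases eq_or_ne u 0 with rfl | hu
    · have : F n =ᶠ[𝓝 0] fun _ => 0 := by
        filter_upwards [hcut0 n] with v hv
        simp only [hF]; rw [hv, zero_mul]
      exact contDiffAt_const.congr_of_eventuallyEq this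
    · exact (hcutc n).contDiffAt.mul (hf u hu)
  have hFs : ∀ n u, R < ‖u‖ → F n u = 0 := fun n u hu => by
    simp only [hF]; rw [hs u hu, mul_zero]
  have hFd : ∀ n u, u ≠ 0 → ‖dbar (F n) u‖ ≤ 2 * C * K * ‖u‖⁻¹ + K' := by
    intro n u hu
    have e := dbar_mul (((hcutc n).differentiable one_ne_zero) u)
      ((hf u hu).differentiableAt one_ne_zero)
    simp only [hF]
    rw [e]
    refine (norm_add_le _ _).trans ?_
    rw [norm_mul, norm_mul]
    have h1 : ‖dbar (cut n) u‖ * ‖f u‖ ≤ 2 * C * ‖u‖⁻¹ * K := by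
      gcongr
      · exact hcutd n u hu
      · exact hb u
    have h2 : ‖cut n u‖ * ‖dbar f u‖ ≤ 1 * K' := by
      gcongr
      · exact hkn _
      · exact hd u hu
    linarith
  have hae : ∀ᵐ u : ℂ, u ≠ 0 := by simp [ae_iff]
  -- an integrable majorant of the integrands
  set G : ℂ → ℝ := (Metric.closedBall (0 : ℂ) R).indicator
    (fun u => (2 * C * K / ‖z‖ + 0) * ‖u - 0‖⁻¹ + (2 * C * K / ‖z‖ + K') * ‖u - z‖⁻¹) with hG
  have hGi : Integrable G := by
    rw [hG, integrable_indicator_iff Metric.isClosed_closedBall.measurableSet]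
    exact ((integrableOn_inv_norm_sub 0 R).const_mul _).add
      ((integrableOn_inv_norm_sub z R).const_mul _)
  have hlim : Tendsto (fun n => ∫ u : ℂ, dbar (F n) u / (u - z)) atTop
      (𝓝 (∫ u : ℂ, dbar f u / (u - z))) := by
    apply tendsto_integral_of_dominated_convergence G
    · intro n
      have := measurable_dbar (F n)
      exact (by fun_prop : Measurable fun u => dbar (F n) u / (u - z)).aestronglyMeasurable
    · exact hGi
    · intro n
      filter_upwards [hae] with u hu
      rcases le_or_gt ‖u‖ R with h | h
      · rw [hG, indicator_of_mem (by simpa using h), norm_div]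
        have hu' : 0 < ‖u‖ := norm_pos_iff.2 hu
        have h1 := hFd n u hu
        rcases eq_or_ne u z with rfl | huz
        · simp only [sub_self, norm_zero, div_zero]; positivity
        have h2 : 0 < ‖u - z‖ := norm_pos_iff.2 (sub_ne_zero.2 huz)
        have h3 : ‖u‖⁻¹ * ‖u - z‖⁻¹ ≤ ‖z‖⁻¹ * (‖u‖⁻¹ + ‖u - z‖⁻¹) := by
          have h4 : ‖z‖ ≤ ‖u - z‖ + ‖u‖ := by
            have := norm_sub_le u (u - z)
            rw [sub_sub_cancel] at this
            linarith
          have h5 : ‖u‖⁻¹ + ‖u - z‖⁻¹ = (‖u - z‖ + ‖u‖) * (‖u‖⁻¹ * ‖u - z‖⁻¹) := by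
            field_simp
          rw [h5, ← mul_assoc]
          apply le_mul_of_one_le_left (by positivity)
          rw [inv_mul_eq_div, one_le_div hz']
          exact h4
        rw [div_eq_mul_inv]
        calc _ ≤ (2 * C * K * ‖u‖⁻¹ + K') * ‖u - z‖⁻¹ := by gcongr
          _ = 2 * C * K * (‖u‖⁻¹ * ‖u - z‖⁻¹) + K' * ‖u - z‖⁻¹ := by ring
          _ ≤ 2 * C * K * (‖z‖⁻¹ * (‖u‖⁻¹ + ‖u - z‖⁻¹)) + K' * ‖u - z‖⁻¹ := by gcongr
          _ = _ := by rw [sub_zero]; ring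
      · rw [dbar_eq_zero_of_norm (hFs n) h, hG, indicator_of_notMem (by simpa using h)]
        simp
    · filter_upwards [hae] with u hu
      apply tendsto_const_nhds.congr'
      filter_upwards [hcutev u hu] with n hn'
      have : F n =ᶠ[𝓝 u] f := by
        filter_upwards [hn'] with v hv
        simp only [hF]; rw [hv, one_mul]
      rw [dbar_congr this]
  have hlim2 : Tendsto (fun n => F n z) atTop (𝓝 (f z)) := by
    apply tendsto_const_nhds.congr'
    filter_upwards [hcutev z hz] with n hn'
    simp only [hF]
    rw [hn'.self_of_nhds, one_mul]
  refine tendsto_nhds_unique hlim2 ?_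
  simp_rw [fun n => cauchyPompeiu (hFc n) (hasCompactSupport_of_norm (hFs n)) z]
  exact hlim.const_mul _

/-! ### Gevrey expansions of functions with exponentially flat `∂̄`-derivative -/

/-- A bounded function with bounded support, `C¹` outside the origin, whose `∂̄`-derivative is
exponentially flat at the origin, with majorant `c * flatWeight A p b`. -/
structure IsFlatGlued (p : ℕ) (A b c : ℝ) (f : ℂ → ℂ) : Prop where
  contDiffAt : ∀ u, u ≠ 0 → ContDiffAt ℝ 1 f u
  bounded : ∃ K : ℝ, ∀ u, ‖f u‖ ≤ K
  support : ∃ R : ℝ, ∀ u, R < ‖u‖ → f u = 0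
  dbar_le : ∀ u, u ≠ 0 → ‖dbar f u‖ ≤ c * flatWeight A p b u

/-- The `n`-th coefficient of the asymptotic expansion at the origin, read off from the
Cauchy–Pompeiu formula by expanding the Cauchy kernel. -/
noncomputable def gevreyCoeff (f : ℂ → ℂ) (n : ℕ) : ℂ :=
  -(Real.pi : ℂ)⁻¹ * ∫ u : ℂ, dbar f u * (u ^ (n + 1))⁻¹

theorem ae_ne (z : ℂ) : ∀ᵐ u : ℂ, u ≠ z := by simp [ae_iff]

theorem norm_inv_pi_le : ‖-(Real.pi : ℂ)⁻¹‖ ≤ 1 := by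
  rw [norm_neg, norm_inv, Complex.norm_real, Real.norm_eq_abs, abs_of_pos Real.pi_pos]
  exact inv_le_one_of_one_le₀ (by linarith [Real.pi_gt_three])

theorem enorm_inv_pi_mul_le (w : ℂ) : ‖-(Real.pi : ℂ)⁻¹ * w‖ₑ ≤ ‖w‖ₑ := by
  rw [enorm_mul]
  apply mul_le_of_le_one_left'
  rw [← ofReal_norm]
  exact ENNReal.ofReal_le_one.2 norm_inv_pi_le

section FlatGlued

variable {p : ℕ} {A b c : ℝ} {f : ℂ → ℂ}

theorem lintegral_enorm_dbar_mul_le (hc : 0 ≤ c) (h : IsFlatGlued p A b c f)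
    (n : ℕ) : ∫⁻ u : ℂ, ‖dbar f u * (u ^ (n + 1))⁻¹‖ₑ ≤
      ENNReal.ofReal c * ∫⁻ u : ℂ, ENNReal.ofReal ((‖u‖ ^ (n + 1))⁻¹ * flatWeight A p b u) := by
  have hm := measurable_flatWeight A p b
  rw [← lintegral_const_mul _ (by fun_prop)]
  apply lintegral_mono_ae
  filter_upwards [ae_ne 0] with u hu
  rw [← ENNReal.ofReal_mul hc, ← ofReal_norm]
  apply ENNReal.ofReal_le_ofReal
  rw [norm_mul, norm_inv, norm_pow, mul_comm, mul_left_comm]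
  gcongr
  exact h.dbar_le u hu

theorem lintegral_enorm_dbar_div_le (hc : 0 ≤ c) (h : IsFlatGlued p A b c f)
    (N : ℕ) (η : ℂ) : ∫⁻ u : ℂ, ‖dbar f u * (u ^ N)⁻¹ / (u - η)‖ₑ ≤
      ENNReal.ofReal c *
        ∫⁻ u : ℂ, ENNReal.ofReal ((‖u‖ ^ N)⁻¹ * flatWeight A p b u / ‖u - η‖) := by
  have hm := measurable_flatWeight A p b
  rw [← lintegral_const_mul _ (by fun_prop)]
  apply lintegral_mono_ae
  filter_upwards [ae_ne 0] with u hu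
  rw [← ENNReal.ofReal_mul hc, ← ofReal_norm]
  apply ENNReal.ofReal_le_ofReal
  rw [norm_div, norm_mul, norm_inv, norm_pow]
  calc _ ≤ c * flatWeight A p b u * (‖u‖ ^ N)⁻¹ / ‖u - η‖ := by
        gcongr; exact h.dbar_le u hu
    _ = _ := by ring

theorem integrable_dbar_mul (hA : 0 < A) (hp : 0 < p) (hb : 0 ≤ b) (hc : 0 ≤ c)
    (h : IsFlatGlued p A b c f) (n : ℕ) :
    Integrable fun u : ℂ => dbar f u * (u ^ (n + 1))⁻¹ := by
  have hm := measurable_dbar f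
  refine ⟨(by fun_prop : Measurable _).aestronglyMeasurable, ?_⟩
  refine (lintegral_enorm_dbar_mul_le hc h n).trans_lt ?_
  exact ENNReal.mul_lt_top ENNReal.ofReal_lt_top
    ((lintegral_flatWeight_le hA hp hb n).trans_lt ENNReal.ofReal_lt_top)

theorem integrable_dbar_div (hA : 0 < A) (hp : 0 < p) (hb : 0 ≤ b) (hc : 0 ≤ c)
    (h : IsFlatGlued p A b c f) (N : ℕ) {η : ℂ} (hη : η ≠ 0) :
    Integrable fun u : ℂ => dbar f u * (u ^ N)⁻¹ / (u - η) := by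
  have hm := measurable_dbar f
  refine ⟨(by fun_prop : Measurable _).aestronglyMeasurable, ?_⟩
  refine (lintegral_enorm_dbar_div_le hc h N η).trans_lt ?_
  exact ENNReal.mul_lt_top ENNReal.ofReal_lt_top
    ((lintegral_flatWeight_div_norm_sub_le hA hp hb N hη).trans_lt ENNReal.ofReal_lt_top)

/-- The remainder of the asymptotic expansion, for every `η ≠ 0`. -/
theorem sub_sum_gevreyCoeff (hA : 0 < A) (hp : 0 < p) (hb : 0 ≤ b) (hc : 0 ≤ c)
    (h : IsFlatGlued p A b c f) (N : ℕ) {η : ℂ} (hη : η ≠ 0) :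
    f η - ∑ n ∈ Finset.range N, gevreyCoeff f n * η ^ n
      = -(Real.pi : ℂ)⁻¹ * (∫ u : ℂ, dbar f u * (u ^ N)⁻¹ / (u - η)) * η ^ N := by
  induction N with
  | zero =>
    obtain ⟨K, hK⟩ := h.bounded
    obtain ⟨R, hR⟩ := h.support
    have hd : ∀ u, u ≠ 0 → ‖dbar f u‖ ≤
        c * (2 * (A ^ (-((1 : ℕ) : ℝ) / p) * Real.Gamma (((1 : ℕ) : ℝ) / p + 1))) := by
      intro u hu
      have hu' : 0 < ‖u‖ := norm_pos_iff.2 hu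
      refine (h.dbar_le u hu).trans (mul_le_mul_of_nonneg_left ?_ hc)
      have := inv_pow_mul_flatWeight_le hA hp b 1 hu
      rw [pow_one] at this
      exact le_of_mul_le_mul_left this (by positivity)
    have := cauchyPompeiu_punctured h.contDiffAt hK hR hd hη
    simpa using this
  | succ N ih =>
    rw [Finset.sum_range_succ, ← sub_sub, ih, gevreyCoeff]
    have e : ∫ u : ℂ, dbar f u * (u ^ N)⁻¹ / (u - η)
        = (∫ u : ℂ, dbar f u * (u ^ (N + 1))⁻¹) +
          η * ∫ u : ℂ, dbar f u * (u ^ (N + 1))⁻¹ / (u - η) := by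
      rw [← integral_const_mul, ← integral_add (integrable_dbar_mul hA hp hb hc h N)
        ((integrable_dbar_div hA hp hb hc h (N + 1) hη).const_mul _)]
      apply integral_congr_ae
      filter_upwards [ae_ne 0, ae_ne η] with u hu huη
      have : u - η ≠ 0 := sub_ne_zero.2 huη
      field_simp
      ring
    rw [e]
    ring

theorem enorm_gevreyCoeff_le (hc : 0 ≤ c) (h : IsFlatGlued p A b c f) (n : ℕ) :
    ‖gevreyCoeff f n‖ₑ ≤
      ENNReal.ofReal c * ∫⁻ u : ℂ, ENNReal.ofReal ((‖u‖ ^ (n + 1))⁻¹ * flatWeight A p b u) :=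
  (enorm_inv_pi_mul_le _).trans
    ((enorm_integral_le_lintegral_enorm _).trans (lintegral_enorm_dbar_mul_le hc h n))

theorem enorm_sub_sum_gevreyCoeff_le (hA : 0 < A) (hp : 0 < p) (hb : 0 ≤ b) (hc : 0 ≤ c)
    (h : IsFlatGlued p A b c f) (N : ℕ) {η : ℂ} (hη : η ≠ 0) :
    ‖f η - ∑ n ∈ Finset.range N, gevreyCoeff f n * η ^ n‖ₑ ≤
      ENNReal.ofReal (c * ‖η‖ ^ N) *
        ∫⁻ u : ℂ, ENNReal.ofReal ((‖u‖ ^ N)⁻¹ * flatWeight A p b u / ‖u - η‖) := by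
  rw [sub_sum_gevreyCoeff hA hp hb hc h N hη, enorm_mul, enorm_pow, mul_comm,
    ENNReal.ofReal_mul hc, ENNReal.ofReal_pow (norm_nonneg _), ofReal_norm, mul_comm
    (ENNReal.ofReal c), mul_assoc]
  refine mul_le_mul_right ((enorm_inv_pi_mul_le _).trans
    ((enorm_integral_le_lintegral_enorm _).trans (lintegral_enorm_dbar_div_le hc h N η))) _

/-- The coefficients decay with the parameter `b`: a factor `b ^ (M / p)` has the effect of
replacing `n` by `n + M` in the Gamma function. -/
theorem rpow_mul_norm_gevreyCoeff_le (hA : 0 < A) (hp : 0 < p) (hb : 0 ≤ b) (hc : 0 ≤ c)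
    (h : IsFlatGlued p A b c f) (n M : ℕ) :
    b ^ ((M : ℝ) / p) * ‖gevreyCoeff f n‖ ≤
      c * (100 * A ^ (-(n : ℝ) / p) * Real.Gamma (((M : ℝ) + n) / p + 1)) := by
  have hG : 0 < Real.Gamma (((M : ℝ) + n) / p + 1) := Real.Gamma_pos_of_pos (by positivity)
  rw [← ENNReal.ofReal_le_ofReal_iff (by positivity), ENNReal.ofReal_mul (by positivity),
    ofReal_norm, ENNReal.ofReal_mul hc]
  calc _ ≤ ENNReal.ofReal (b ^ ((M : ℝ) / p)) * (ENNReal.ofReal c *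
        ∫⁻ u : ℂ, ENNReal.ofReal ((‖u‖ ^ (n + 1))⁻¹ * flatWeight A p b u)) :=
        mul_le_mul_right (enorm_gevreyCoeff_le hc h n) _
    _ = ENNReal.ofReal c * (ENNReal.ofReal (b ^ ((M : ℝ) / p)) *
        ∫⁻ u : ℂ, ENNReal.ofReal ((‖u‖ ^ (n + 1))⁻¹ * flatWeight A p b u)) :=
        mul_left_comm _ _ _
    _ ≤ _ := mul_le_mul_right (rpow_mul_lintegral_flatWeight_le hA hp hb n M) _

theorem norm_gevreyCoeff_le (hA : 0 < A) (hp : 0 < p) (hb : 0 ≤ b) (hc : 0 ≤ c)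
    (h : IsFlatGlued p A b c f) (n : ℕ) :
    ‖gevreyCoeff f n‖ ≤ c * (100 * A ^ (-(n : ℝ) / p) * Real.Gamma ((n : ℝ) / p + 1)) := by
  simpa using rpow_mul_norm_gevreyCoeff_le hA hp hb hc h n 0

/-- The Gevrey expansion at the origin of a function with exponentially flat `∂̄`-derivative. -/
theorem norm_sub_sum_gevreyCoeff_le (hA : 0 < A) (hp : 0 < p) (hb : 0 ≤ b) (hc : 0 ≤ c)
    (h : IsFlatGlued p A b c f) (N : ℕ) {η : ℂ} (hη : η ≠ 0) :
    ‖f η - ∑ n ∈ Finset.range N, gevreyCoeff f n * η ^ n‖ ≤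
      c * ‖η‖ ^ N * (400 * A ^ (-(N : ℝ) / p) * Real.Gamma ((N : ℝ) / p + 1)) := by
  have hG : 0 < Real.Gamma ((N : ℝ) / p + 1) := Real.Gamma_pos_of_pos (by positivity)
  rw [← ENNReal.ofReal_le_ofReal_iff (by positivity), ofReal_norm,
    ENNReal.ofReal_mul (by positivity)]
  exact (enorm_sub_sum_gevreyCoeff_le hA hp hb hc h N hη).trans
    (mul_le_mul_right (lintegral_flatWeight_div_norm_sub_le hA hp hb N hη) _)

/-- The coefficients are limits of difference quotients at the origin. -/
theorem tendsto_gevreyCoeff (hA : 0 < A) (hp : 0 < p) (hb : 0 ≤ b) (hc : 0 ≤ c)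
    (h : IsFlatGlued p A b c f) (n : ℕ) {e : ℕ → ℂ} (he : Tendsto e atTop (𝓝 0))
    (he0 : ∀ k, e k ≠ 0) :
    Tendsto (fun k => (f (e k) - ∑ m ∈ Finset.range n, gevreyCoeff f m * e k ^ m) / e k ^ n)
      atTop (𝓝 (gevreyCoeff f n)) := by
  set K := c * (400 * A ^ (-((n + 1 : ℕ) : ℝ) / p) * Real.Gamma (((n + 1 : ℕ) : ℝ) / p + 1))
  rw [tendsto_iff_norm_sub_tendsto_zero]
  refine squeeze_zero (g := fun k => K * ‖e k‖) (fun _ => norm_nonneg _) (fun k => ?_) ?_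
  · have h1 := norm_sub_sum_gevreyCoeff_le hA hp hb hc h (n + 1) (he0 k)
    have h2 : (f (e k) - ∑ m ∈ Finset.range n, gevreyCoeff f m * e k ^ m) / e k ^ n
        - gevreyCoeff f n = (f (e k) - ∑ m ∈ Finset.range (n + 1), gevreyCoeff f m * e k ^ m)
          / e k ^ n := by
      rw [Finset.sum_range_succ]
      have := pow_ne_zero n (he0 k)
      field_simp
      ring
    have h3 : 0 < ‖e k‖ := norm_pos_iff.2 (he0 k)
    rw [h2, norm_div, norm_pow, div_le_iff₀ (by positivity)]
    refine h1.trans (le_of_eq ?_)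
    rw [pow_succ]; ring
  · simpa using (he.norm.const_mul K)

/-- The factor `(A / |u| ^ p) ^ (1 / 4)` of `flatWeight` is bounded below on the support, and may be
added to the majorant. -/
theorem IsFlatGlued.of_bound {R : ℝ} (hA : 0 < A) (hc : 0 ≤ c) (hR : 0 < R)
    (h1 : ∀ u, u ≠ 0 → ContDiffAt ℝ 1 f u) (h2 : ∃ K : ℝ, ∀ u, ‖f u‖ ≤ K)
    (h3 : ∀ u, R < ‖u‖ → f u = 0)
    (h4 : ∀ u, u ≠ 0 → ‖dbar f u‖ ≤ c * (‖u‖⁻¹ * Real.exp (-max (A / ‖u‖ ^ p) b))) :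
    IsFlatGlued p A b (c * (A / R ^ p) ^ (-(1 / 4) : ℝ)) f := by
  refine ⟨h1, h2, ⟨R, h3⟩, fun u hu => ?_⟩
  have hw := flatWeight_nonneg hA p b u
  have hu' : 0 < ‖u‖ := norm_pos_iff.2 hu
  rcases le_or_gt ‖u‖ R with h | h
  · refine (h4 u hu).trans ?_
    rw [mul_assoc, flatWeight]
    refine mul_le_mul_of_nonneg_left ?_ hc
    rw [mul_left_comm]
    refine le_mul_of_one_le_right (by positivity) ?_
    rw [Real.rpow_neg (by positivity), inv_mul_eq_div, one_le_div (by positivity)]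
    gcongr
  · rw [dbar_eq_zero_of_norm h3 h, norm_zero]
    positivity

end FlatGlued

/-! ### Cauchy transforms of families of flat functions -/

/-- A family, depending on `U`, of functions of `u` as in `IsFlatGlued`, with a majorant which is
exponentially small in both variables. -/
structure IsFlatFamily (p : ℕ) (A B c R : ℝ) (H : ℂ → ℂ → ℂ) : Prop where
  contDiffAt : ∀ U u, u ≠ 0 → ContDiffAt ℝ 1 (H U) u
  bounded : ∀ U, ∃ K : ℝ, ∀ u, ‖H U u‖ ≤ K
  support : ∀ U u, R < ‖u‖ → H U u = 0
  dbar_le : ∀ U u, u ≠ 0 → ‖dbar (H U) u‖ ≤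
    c / (1 + ‖U‖) * (‖u‖⁻¹ * Real.exp (-max (A / ‖u‖ ^ p) (B * ‖U‖ ^ p)))
  measurable : ∀ u, u ≠ 0 → Measurable fun U => H U u

/-- The Cauchy transform `X ↦ -π⁻¹ ∫ h(U) / (U - X) dA(U)`, a solution `G` of `∂̄G = h`. -/
noncomputable def cauchyTransform (h : ℂ → ℂ) (X : ℂ) : ℂ :=
  -(Real.pi : ℂ)⁻¹ * ∫ U : ℂ, h U / (U - X)

/-- The `m`-th coefficient of the expansion at infinity of `cauchyTransform h`, for `m ≥ 1`. -/
noncomputable def cauchyMoment (h : ℂ → ℂ) (m : ℕ) : ℂ :=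
  (Real.pi : ℂ)⁻¹ * ∫ U : ℂ, h U * U ^ (m - 1)

/-- The kernel majorizing `∂̄H`, with the support in `u` made explicit. -/
noncomputable def familyKernel (p : ℕ) (A B R : ℝ) (U u : ℂ) : ℝ :=
  (Metric.closedBall (0 : ℂ) R).indicator
    (fun u => ‖u‖⁻¹ * (Real.exp (-max (A / ‖u‖ ^ p) (B * ‖U‖ ^ p)) / (1 + ‖U‖))) u

theorem familyKernel_nonneg (p : ℕ) (A B R : ℝ) (U u : ℂ) : 0 ≤ familyKernel p A B R U u := by
  unfold familyKernel
  apply indicator_nonneg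
  intro u _
  positivity

theorem measurable_familyKernel (p : ℕ) (A B R : ℝ) :
    Measurable fun z : ℂ × ℂ => familyKernel p A B R z.1 z.2 := by
  have : (fun z : ℂ × ℂ => familyKernel p A B R z.1 z.2) =
      (Prod.snd ⁻¹' Metric.closedBall (0 : ℂ) R).indicator (fun z => ‖z.2‖⁻¹ *
        (Real.exp (-max (A / ‖z.2‖ ^ p) (B * ‖z.1‖ ^ p)) / (1 + ‖z.1‖))) := by
    ext z; rfl
  rw [this]
  apply Measurable.indicator (by fun_prop)
  exact measurable_snd Metric.isClosed_closedBall.measurableSet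

/-- By Tonelli, the Cauchy transform in `U` of an integral in `u` is estimated by integrating in `U`
first; by `exists_lintegral_exp_neg_max_div_le` this replaces the kernel by `flatWeight A p 0`. -/
theorem exists_lintegral_familyKernel_le {p : ℕ} {A B R : ℝ} (hA : 0 < A) (hB : 0 < B)
    (hp : 0 < p) (hR : 0 < R) :
    ∃ C : ℝ, 0 ≤ C ∧ ∀ (q : ℂ → ℝ), (∀ u, 0 ≤ q u) → Measurable q → ∀ X : ℂ,
      ∫⁻ U : ℂ, ENNReal.ofReal (‖U - X‖⁻¹) *
          ∫⁻ u : ℂ, ENNReal.ofReal (q u * familyKernel p A B R U u)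
        ≤ ENNReal.ofReal C * ∫⁻ u : ℂ, ENNReal.ofReal (q u * flatWeight A p 0 u) := by
  obtain ⟨C, hC0, hC⟩ := exists_lintegral_exp_neg_max_div_le hB hp
    (show 0 < A / R ^ p by positivity)
  refine ⟨C, hC0, fun q hq hqm X => ?_⟩
  have hkm := measurable_familyKernel p A B R
  set f : ℂ → ℂ → ℝ≥0∞ := fun U u => ENNReal.ofReal (‖U - X‖⁻¹) *
    ENNReal.ofReal (q u * familyKernel p A B R U u) with hf
  have hm : Measurable (Function.uncurry f) := by
    have h1 : Measurable fun z : ℂ × ℂ => ENNReal.ofReal (‖z.1 - X‖⁻¹) := by fun_prop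
    have h2 : Measurable fun z : ℂ × ℂ => q z.2 * familyKernel p A B R z.1 z.2 :=
      (hqm.comp measurable_snd).mul hkm
    exact h1.mul h2.ennreal_ofReal
  have hk1 : ∀ U, Measurable (familyKernel p A B R U) := fun U =>
    Measurable.of_uncurry_left (f := familyKernel p A B R) hkm
  calc _ = ∫⁻ U : ℂ, ∫⁻ u : ℂ, f U u := by
        apply lintegral_congr
        intro U
        exact (lintegral_const_mul _ (hqm.mul (hk1 U)).ennreal_ofReal).symm
    _ = ∫⁻ u : ℂ, ∫⁻ U : ℂ, f U u := lintegral_lintegral_swap hm.aemeasurable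
    _ ≤ ∫⁻ u : ℂ, ENNReal.ofReal C * ENNReal.ofReal (q u * flatWeight A p 0 u) := by
        apply lintegral_mono_ae
        filter_upwards [ae_ne 0] with u hu
        have hu' : 0 < ‖u‖ := norm_pos_iff.2 hu
        by_cases h : ‖u‖ ≤ R
        · have e : ∀ U : ℂ, f U u = ENNReal.ofReal (q u * ‖u‖⁻¹) *
              ENNReal.ofReal (Real.exp (-max (A / ‖u‖ ^ p) (B * ‖U‖ ^ p)) / (1 + ‖U‖)
                / ‖U - X‖) := by
            intro U
            have hq0 := hq u
            simp only [hf]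
            rw [familyKernel, indicator_of_mem (by simpa using h),
              ← ENNReal.ofReal_mul (by positivity), ← ENNReal.ofReal_mul (by positivity)]
            congr 1
            ring
          simp_rw [e]
          rw [lintegral_const_mul _ (by fun_prop)]
          have ha : A / R ^ p ≤ A / ‖u‖ ^ p := by gcongr
          have h1 := mul_le_mul_right (hC (A / ‖u‖ ^ p) ha X) (ENNReal.ofReal (q u * ‖u‖⁻¹))
          refine le_of_le_of_eq h1 ?_
          rw [← ENNReal.ofReal_mul (mul_nonneg (hq u) (by positivity)),
            ← ENNReal.ofReal_mul hC0]
          congr 1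
          rw [flatWeight, max_eq_left (by positivity)]
          ring
        · have e : ∀ U : ℂ, f U u = 0 := by
            intro U
            simp only [hf]
            rw [familyKernel, indicator_of_notMem (by simpa using h)]
            simp
          simp_rw [e]
          simp
    _ = _ := by
        exact lintegral_const_mul _ (hqm.mul (measurable_flatWeight A p 0)).ennreal_ofReal

section Family

variable {p : ℕ} {A B c R : ℝ} {H : ℂ → ℂ → ℂ}

theorem IsFlatFamily.isFlatGlued (hA : 0 < A) (hc : 0 ≤ c) (hR : 0 < R)
    (h : IsFlatFamily p A B c R H) (U : ℂ) :
    IsFlatGlued p A (B * ‖U‖ ^ p) (c / (1 + ‖U‖) * (A / R ^ p) ^ (-(1 / 4) : ℝ)) (H U) :=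
  IsFlatGlued.of_bound hA (by positivity) hR (h.contDiffAt U) (h.bounded U) (h.support U)
    (h.dbar_le U)

theorem IsFlatFamily.norm_dbar_mul_le (hc : 0 ≤ c)
    (h : IsFlatFamily p A B c R H) (U : ℂ) (q : ℂ → ℂ) {u : ℂ} (hu : u ≠ 0) :
    ‖dbar (H U) u * q u‖ₑ ≤ ENNReal.ofReal (c * ‖q u‖ * familyKernel p A B R U u) := by
  rw [← ofReal_norm]
  apply ENNReal.ofReal_le_ofReal
  by_cases hu' : ‖u‖ ≤ R
  · rw [norm_mul, familyKernel, indicator_of_mem (by simpa using hu')]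
    calc _ ≤ _ := mul_le_mul_of_nonneg_right (h.dbar_le U u hu) (norm_nonneg _)
      _ = _ := by ring
  · rw [dbar_eq_zero_of_norm (h.support U) (not_le.1 hu')]
    have := familyKernel_nonneg p A B R U u
    simp only [zero_mul, norm_zero]
    positivity

/-- The coefficients depend measurably on `U`, being limits of measurable functions. -/
theorem IsFlatFamily.measurable_gevreyCoeff (hA : 0 < A) (hB : 0 < B) (hp : 0 < p) (hc : 0 ≤ c)
    (hR : 0 < R) (h : IsFlatFamily p A B c R H) (n : ℕ) :
    Measurable fun U => gevreyCoeff (H U) n := by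
  induction n using Nat.strong_induction_on with
  | _ n ih =>
    set e : ℕ → ℂ := fun k => 1 / ((k : ℂ) + 1) with he
    have he0 : ∀ k, e k ≠ 0 := fun k => by
      simp only [he]; exact one_div_ne_zero (Nat.cast_add_one_ne_zero k)
    have het : Tendsto e atTop (𝓝 0) := tendsto_one_div_add_atTop_nhds_zero_nat
    refine measurable_of_tendsto_metrizable (f := fun k U =>
      (H U (e k) - ∑ m ∈ Finset.range n, gevreyCoeff (H U) m * e k ^ m) / e k ^ n) ?_ ?_
    · intro k
      have h1 := h.measurable (e k) (he0 k)
      have h2 : Measurable fun U => ∑ m ∈ Finset.range n, gevreyCoeff (H U) m * e k ^ m :=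
        Finset.measurable_fun_sum _ fun m hm => (ih m (Finset.mem_range.1 hm)).mul_const _
      exact (h1.sub h2).div_const _
    · rw [tendsto_pi_nhds]
      intro U
      exact tendsto_gevreyCoeff hA hp (by positivity) (by positivity)
        (h.isFlatGlued hA hc hR U) n het he0

/-- The Cauchy transforms of the coefficients and of the remainders converge absolutely, with the
same bounds as the coefficients and the remainders themselves. -/
theorem IsFlatFamily.exists_lintegral_le (hA : 0 < A) (hB : 0 < B) (hp : 0 < p) (hc : 0 ≤ c)
    (hR : 0 < R) (h : IsFlatFamily p A B c R H) : ∃ C : ℝ, 0 ≤ C ∧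
      (∀ n X, ∫⁻ U : ℂ, ‖gevreyCoeff (H U) n / (U - X)‖ₑ ≤
        ENNReal.ofReal (C * (A ^ (-(n : ℝ) / p) * Real.Gamma ((n : ℝ) / p + 1)))) ∧
      ∀ N X η, η ≠ 0 →
        ∫⁻ U : ℂ, ‖(H U η - ∑ n ∈ Finset.range N, gevreyCoeff (H U) n * η ^ n) / (U - X)‖ₑ ≤
        ENNReal.ofReal (C * (A ^ (-(N : ℝ) / p) * Real.Gamma ((N : ℝ) / p + 1) * ‖η‖ ^ N)) := by
  obtain ⟨C, hC0, hC⟩ := exists_lintegral_familyKernel_le (R := R) hA hB hp hR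
  have hG : ∀ n : ℕ, 0 < Real.Gamma ((n : ℝ) / p + 1) := fun n =>
    Real.Gamma_pos_of_pos (by positivity)
  have main : ∀ (q : ℂ → ℂ) (F : ℂ → ℂ) (X : ℂ), Measurable q →
      (∀ U, ‖F U‖ₑ ≤ ∫⁻ u : ℂ, ‖dbar (H U) u * q u‖ₑ) →
      ∫⁻ U : ℂ, ‖F U / (U - X)‖ₑ ≤
        ENNReal.ofReal (C * c) * ∫⁻ u : ℂ, ENNReal.ofReal (‖q u‖ * flatWeight A p 0 u) := by
    intro q F X hq hF
    have hw := measurable_flatWeight A p 0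
    have h1 := hC (fun u => c * ‖q u‖) (fun u => by positivity) (by fun_prop) X
    refine le_trans ?_ (h1.trans (le_of_eq ?_))
    · apply lintegral_mono_ae
      filter_upwards [ae_ne X] with U hU
      have hU' : U - X ≠ 0 := sub_ne_zero.2 hU
      rw [div_eq_inv_mul, enorm_mul, ← ofReal_norm, norm_inv]
      refine mul_le_mul_right ((hF U).trans ?_) _
      apply lintegral_mono_ae
      filter_upwards [ae_ne 0] with u hu
      exact h.norm_dbar_mul_le hc U q hu
    · rw [ENNReal.ofReal_mul hC0, mul_assoc, ← lintegral_const_mul (ENNReal.ofReal c) (by fun_prop)]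
      congr 1
      apply lintegral_congr
      intro u
      rw [← ENNReal.ofReal_mul hc]
      congr 1; ring
  refine ⟨400 * (C * c), by positivity, fun n X => ?_, fun N X η hη => ?_⟩
  · refine (main (fun u => (u ^ (n + 1))⁻¹) _ X (by fun_prop) fun U =>
      (enorm_inv_pi_mul_le _).trans (enorm_integral_le_lintegral_enorm _)).trans ?_
    simp only [norm_inv, norm_pow]
    refine (mul_le_mul_right (lintegral_flatWeight_le hA hp le_rfl n) _).trans ?_
    rw [← ENNReal.ofReal_mul (by positivity)]
    apply ENNReal.ofReal_le_ofReal
    have : 0 ≤ C * c * (A ^ (-(n : ℝ) / p) * Real.Gamma ((n : ℝ) / p + 1)) := by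
      have := hG n; positivity
    linarith
  · refine (main (fun u => (u ^ N)⁻¹ / (u - η) * η ^ N) _ X (by fun_prop) fun U => ?_).trans ?_
    · rw [sub_sum_gevreyCoeff hA hp (by positivity) (by positivity)
        (h.isFlatGlued hA hc hR U) N hη, mul_assoc, ← integral_mul_const]
      refine (enorm_inv_pi_mul_le _).trans ((enorm_integral_le_lintegral_enorm _).trans
        (le_of_eq ?_))
      apply lintegral_congr
      intro u
      congr 1; ring
    · simp only [norm_mul, norm_div, norm_inv, norm_pow]
      have e : ∀ u : ℂ, ENNReal.ofReal ((‖u‖ ^ N)⁻¹ / ‖u - η‖ * ‖η‖ ^ N * flatWeight A p 0 u)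
          = ENNReal.ofReal (‖η‖ ^ N) *
            ENNReal.ofReal ((‖u‖ ^ N)⁻¹ * flatWeight A p 0 u / ‖u - η‖) := by
        intro u
        rw [← ENNReal.ofReal_mul (by positivity)]
        congr 1; ring
      have hw := measurable_flatWeight A p 0
      simp_rw [e]
      rw [lintegral_const_mul _ (by fun_prop)]
      refine (mul_le_mul_right (mul_le_mul_right
        (lintegral_flatWeight_div_norm_sub_le hA hp le_rfl N hη) _) _).trans ?_
      rw [← ENNReal.ofReal_mul (by positivity), ← ENNReal.ofReal_mul (by positivity)]
      apply ENNReal.ofReal_le_ofReal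
      apply le_of_eq; ring

/-- The Cauchy transforms of the family have a Gevrey expansion in `η`, uniformly on `ℂ`. -/
theorem IsFlatFamily.exists_cauchyTransform_le (hA : 0 < A) (hB : 0 < B) (hp : 0 < p)
    (hc : 0 ≤ c) (hR : 0 < R) (h : IsFlatFamily p A B c R H) : ∃ C : ℝ, 0 ≤ C ∧
      (∀ n X, ‖cauchyTransform (fun U => gevreyCoeff (H U) n) X‖ ≤
        C * (A ^ (-(n : ℝ) / p) * Real.Gamma ((n : ℝ) / p + 1))) ∧
      ∀ N X η, η ≠ 0 → ‖cauchyTransform (fun U => H U η) X - ∑ n ∈ Finset.range N,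
        cauchyTransform (fun U => gevreyCoeff (H U) n) X * η ^ n‖ ≤
        C * (A ^ (-(N : ℝ) / p) * Real.Gamma ((N : ℝ) / p + 1) * ‖η‖ ^ N) := by
  obtain ⟨C, hC0, hC1, hC2⟩ := h.exists_lintegral_le hA hB hp hc hR
  have hG : ∀ n : ℕ, 0 < Real.Gamma ((n : ℝ) / p + 1) := fun n =>
    Real.Gamma_pos_of_pos (by positivity)
  have hm := h.measurable_gevreyCoeff hA hB hp hc hR
  refine ⟨C, hC0, fun n X => ?_, fun N X η hη => ?_⟩
  · have := hG n
    rw [← ENNReal.ofReal_le_ofReal_iff (by positivity), ofReal_norm]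
    exact (enorm_inv_pi_mul_le _).trans ((enorm_integral_le_lintegral_enorm _).trans (hC1 n X))
  · have := hG N
    have hi1 : Integrable fun U : ℂ => H U η / (U - X) := by
      have := h.measurable η hη
      refine ⟨(by fun_prop : Measurable _).aestronglyMeasurable, ?_⟩
      have h0 := hC2 0 X η hη
      simp only [Finset.range_zero, Finset.sum_empty, sub_zero] at h0
      exact h0.trans_lt ENNReal.ofReal_lt_top
    have hi2 : ∀ n, Integrable fun U : ℂ => gevreyCoeff (H U) n / (U - X) := fun n => by
      have := hm n
      refine ⟨(by fun_prop : Measurable _).aestronglyMeasurable, ?_⟩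
      exact (hC1 n X).trans_lt ENNReal.ofReal_lt_top
    have e : cauchyTransform (fun U => H U η) X - ∑ n ∈ Finset.range N,
        cauchyTransform (fun U => gevreyCoeff (H U) n) X * η ^ n
        = cauchyTransform (fun U => H U η -
          ∑ n ∈ Finset.range N, gevreyCoeff (H U) n * η ^ n) X := by
      have e1 : ∀ U : ℂ, (H U η - ∑ n ∈ Finset.range N, gevreyCoeff (H U) n * η ^ n) / (U - X)
          = H U η / (U - X) -
            ∑ n ∈ Finset.range N, gevreyCoeff (H U) n / (U - X) * η ^ n := by
        intro U
        rw [sub_div, Finset.sum_div]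
        congr 1
        apply Finset.sum_congr rfl
        intro n _
        ring
      unfold cauchyTransform
      simp_rw [e1]
      rw [integral_sub hi1 (integrable_finsetSum _ fun n _ => (hi2 n).mul_const _),
        integral_finsetSum _ fun n _ => (hi2 n).mul_const _, mul_sub, Finset.mul_sum]
      congr 1
      apply Finset.sum_congr rfl
      intro n _
      rw [integral_mul_const, mul_assoc]
    rw [e, ← ENNReal.ofReal_le_ofReal_iff (by positivity), ofReal_norm]
    exact (enorm_inv_pi_mul_le _).trans ((enorm_integral_le_lintegral_enorm _).trans
      (hC2 N X η hη))

theorem IsFlatFamily.pow_mul_norm_gevreyCoeff_le (hA : 0 < A) (hB : 0 < B) (hp : 0 < p)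
    (hc : 0 ≤ c) (hR : 0 < R) (h : IsFlatFamily p A B c R H) (n M : ℕ) {U : ℂ} (hU : U ≠ 0) :
    ‖U‖ ^ M * ‖gevreyCoeff (H U) n‖ ≤ (1 + ‖U‖)⁻¹ * (c * (A / R ^ p) ^ (-(1 / 4) : ℝ) *
      (100 * (A ^ (-(n : ℝ) / p) * B ^ (-(M : ℝ) / p) *
        Real.Gamma (((M : ℝ) + n) / p + 1)))) := by
  have hU' : 0 < ‖U‖ := norm_pos_iff.2 hU
  have h1 := rpow_mul_norm_gevreyCoeff_le hA hp (by positivity) (by positivity)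
    (h.isFlatGlued hA hc hR U) n M
  rw [mul_rpow_div_eq_pow hB hp hU'] at h1
  have e2 : B ^ (-(M : ℝ) / p) * B ^ ((M : ℝ) / p) = 1 := by
    rw [← Real.rpow_add hB, neg_div, neg_add_cancel, Real.rpow_zero]
  calc _ = B ^ (-(M : ℝ) / p) * (B ^ ((M : ℝ) / p) * ‖U‖ ^ M * ‖gevreyCoeff (H U) n‖) := by
        rw [mul_assoc, ← mul_assoc (B ^ (-(M : ℝ) / p)), e2, one_mul]
    _ ≤ B ^ (-(M : ℝ) / p) * _ := mul_le_mul_of_nonneg_left h1 (by positivity)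
    _ = _ := by ring

/-- The absolute moments of the coefficients, which bound `cauchyMoment`. -/
theorem IsFlatFamily.lintegral_pow_mul_gevreyCoeff_le (hA : 0 < A) (hB : 0 < B) (hp : 0 < p)
    (hc : 0 ≤ c) (hR : 0 < R) (h : IsFlatFamily p A B c R H) (n : ℕ) {M : ℕ} (hM : 0 < M) :
    ∫⁻ U : ℂ, ‖gevreyCoeff (H U) n * U ^ (M - 1)‖ₑ ≤
      ENNReal.ofReal (c * (A / R ^ p) ^ (-(1 / 4) : ℝ) * (2000 * p * B ^ (-(M : ℝ) / p) *
        A ^ (-(n : ℝ) / p) * Real.Gamma (((M : ℝ) + n) / p + 1))) := by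
  have hG : 0 < Real.Gamma (((M : ℝ) + n) / p + 1) := Real.Gamma_pos_of_pos (by positivity)
  set κ := c * (A / R ^ p) ^ (-(1 / 4) : ℝ) with hκ
  have hκ0 : 0 ≤ κ := by positivity
  calc _ ≤ ∫⁻ U : ℂ, ENNReal.ofReal κ * (ENNReal.ofReal ((‖U‖ ^ 2)⁻¹ * ‖U‖ ^ M) *
      ∫⁻ u : ℂ, ENNReal.ofReal ((‖u‖ ^ (n + 1))⁻¹ * flatWeight A p (B * ‖U‖ ^ p) u)) := by
        apply lintegral_mono_ae
        filter_upwards [ae_ne 0] with U hU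
        have hU' : 0 < ‖U‖ := norm_pos_iff.2 hU
        have h1 := enorm_gevreyCoeff_le (by positivity) (h.isFlatGlued hA hc hR U) n
        rw [enorm_mul, mul_comm, ← mul_assoc, ← ENNReal.ofReal_mul hκ0]
        refine (mul_le_mul_right h1 _).trans ?_
        rw [← mul_assoc, ← ofReal_norm, ← ENNReal.ofReal_mul (by positivity), norm_pow]
        refine mul_le_mul_left (ENNReal.ofReal_le_ofReal ?_) _
        have h2 : ‖U‖ ^ (M - 1) = ‖U‖ * ((‖U‖ ^ 2)⁻¹ * ‖U‖ ^ M) := by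
          obtain ⟨k, rfl⟩ : ∃ k, M = k + 1 := ⟨M - 1, by omega⟩
          rw [Nat.add_sub_cancel]
          field_simp
          ring
        have h3 : ‖U‖ / (1 + ‖U‖) ≤ 1 := by
          rw [div_le_one (by positivity)]; linarith
        rw [h2]
        calc _ = ‖U‖ / (1 + ‖U‖) * (κ * ((‖U‖ ^ 2)⁻¹ * ‖U‖ ^ M)) := by rw [hκ]; ring
          _ ≤ 1 * (κ * ((‖U‖ ^ 2)⁻¹ * ‖U‖ ^ M)) := by gcongr
          _ = _ := one_mul _
    _ = ENNReal.ofReal κ * ∫⁻ U : ℂ, ENNReal.ofReal ((‖U‖ ^ 2)⁻¹ * ‖U‖ ^ M) *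
      ∫⁻ u : ℂ, ENNReal.ofReal ((‖u‖ ^ (n + 1))⁻¹ * flatWeight A p (B * ‖U‖ ^ p) u) :=
        lintegral_const_mul' _ _ ENNReal.ofReal_ne_top
    _ ≤ _ := by
        rw [ENNReal.ofReal_mul hκ0]
        exact mul_le_mul_right (lintegral_lintegral_flatWeight_le hA hB hp n hM) _

/-- Near `X` the pointwise bound of the coefficients is used; elsewhere `|X| / |U - X|` is at
most `2`. -/
theorem IsFlatFamily.exists_lintegral_pow_div_le (hA : 0 < A) (hB : 0 < B) (hp : 0 < p)
    (hc : 0 ≤ c) (hR : 0 < R) (h : IsFlatFamily p A B c R H) : ∃ C : ℝ, 0 ≤ C ∧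
      ∀ n M : ℕ, 0 < M → ∀ X : ℂ, X ≠ 0 →
        ∫⁻ U : ℂ, ‖gevreyCoeff (H U) n * U ^ (M - 1) / (U - X) * X‖ₑ ≤
          ENNReal.ofReal (C * (A ^ (-(n : ℝ) / p) * B ^ (-(M : ℝ) / p) *
            Real.Gamma (((M : ℝ) + n) / p + 1))) := by
  set κ := c * (A / R ^ p) ^ (-(1 / 4) : ℝ) with hκ
  have hκ0 : 0 ≤ κ := by positivity
  refine ⟨κ * (400 * Real.pi + 4000 * p), by positivity, fun n M hM X hX => ?_⟩
  have hX' : 0 < ‖X‖ := norm_pos_iff.2 hX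
  set S := A ^ (-(n : ℝ) / p) * B ^ (-(M : ℝ) / p) * Real.Gamma (((M : ℝ) + n) / p + 1) with hS
  have hS0 : 0 < S := by
    have : 0 < Real.Gamma (((M : ℝ) + n) / p + 1) := Real.Gamma_pos_of_pos (by positivity)
    positivity
  have hpt : ∀ᵐ U : ℂ, ‖gevreyCoeff (H U) n * U ^ (M - 1) / (U - X) * X‖ₑ ≤
      (Metric.ball X (‖X‖ / 2)).indicator (fun U => ENNReal.ofReal (400 * κ * S / ‖X‖) *
        ENNReal.ofReal (‖U - X‖⁻¹)) U
      + ENNReal.ofReal 2 * ‖gevreyCoeff (H U) n * U ^ (M - 1)‖ₑ := by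
    filter_upwards [ae_ne 0, ae_ne X] with U hU hUX
    have hU' : 0 < ‖U‖ := norm_pos_iff.2 hU
    have hUX' : 0 < ‖U - X‖ := norm_pos_iff.2 (sub_ne_zero.2 hUX)
    by_cases hd : ‖U - X‖ < ‖X‖ / 2
    · refine le_add_right ?_
      rw [indicator_of_mem (by simpa [dist_eq_norm] using hd),
        ← ENNReal.ofReal_mul (by positivity), ← ofReal_norm]
      apply ENNReal.ofReal_le_ofReal
      have h1 : ‖X‖ / 2 ≤ ‖U‖ := by
        have := norm_sub_norm_le X U
        rw [norm_sub_rev] at this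
        linarith
      have h2 := h.pow_mul_norm_gevreyCoeff_le hA hB hp hc hR n M hU
      rw [← hκ, ← hS] at h2
      have h3 : (1 + ‖U‖)⁻¹ ≤ (‖X‖ / 2)⁻¹ := inv_anti₀ (by positivity) (by linarith)
      have h4 : ‖U‖ ^ M * ‖gevreyCoeff (H U) n‖ ≤ 200 * κ * S / ‖X‖ := by
        refine h2.trans ?_
        calc _ ≤ (‖X‖ / 2)⁻¹ * (κ * (100 * S)) := by gcongr
          _ = _ := by field_simp; ring
      have h5 : ‖U‖ ^ (M - 1) * ‖X‖ ≤ 2 * ‖U‖ ^ M := by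
        obtain ⟨k, rfl⟩ : ∃ k, M = k + 1 := ⟨M - 1, by omega⟩
        rw [Nat.add_sub_cancel, pow_succ]
        have : ‖X‖ ≤ 2 * ‖U‖ := by linarith
        calc _ ≤ ‖U‖ ^ k * (2 * ‖U‖) := by gcongr
          _ = _ := by ring
      rw [norm_mul, norm_div, norm_mul, norm_pow]
      calc _ = (‖U‖ ^ (M - 1) * ‖X‖) * ‖gevreyCoeff (H U) n‖ * ‖U - X‖⁻¹ := by ring
        _ ≤ (2 * ‖U‖ ^ M) * ‖gevreyCoeff (H U) n‖ * ‖U - X‖⁻¹ := by gcongr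
        _ = 2 * (‖U‖ ^ M * ‖gevreyCoeff (H U) n‖) * ‖U - X‖⁻¹ := by ring
        _ ≤ 2 * (200 * κ * S / ‖X‖) * ‖U - X‖⁻¹ := by gcongr
        _ = _ := by ring
    · refine le_add_left ?_
      rw [← ofReal_norm, ← ofReal_norm, ← ENNReal.ofReal_mul (by norm_num)]
      apply ENNReal.ofReal_le_ofReal
      rw [norm_mul, norm_div]
      have h1 : ‖X‖ / ‖U - X‖ ≤ 2 := by
        rw [div_le_iff₀ hUX']; linarith
      calc _ = ‖X‖ / ‖U - X‖ * ‖gevreyCoeff (H U) n * U ^ (M - 1)‖ := by ring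
        _ ≤ _ := by gcongr
  have hm := h.measurable_gevreyCoeff hA hB hp hc hR n
  calc _ ≤ _ := lintegral_mono_ae hpt
    _ = ENNReal.ofReal (400 * κ * S / ‖X‖) * ENNReal.ofReal (2 * Real.pi * (‖X‖ / 2)) +
        ENNReal.ofReal 2 * ∫⁻ U : ℂ, ‖gevreyCoeff (H U) n * U ^ (M - 1)‖ₑ := by
        rw [lintegral_add_right _ (by fun_prop), lintegral_const_mul _ (by fun_prop),
          lintegral_indicator Metric.isOpen_ball.measurableSet,
          lintegral_const_mul _ (by fun_prop), lintegral_ball_inv_norm_sub]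
    _ ≤ ENNReal.ofReal (400 * κ * S / ‖X‖) * ENNReal.ofReal (2 * Real.pi * (‖X‖ / 2)) +
        ENNReal.ofReal 2 * ENNReal.ofReal (κ * (2000 * p * B ^ (-(M : ℝ) / p) *
        A ^ (-(n : ℝ) / p) * Real.Gamma (((M : ℝ) + n) / p + 1))) := by
        gcongr
        exact h.lintegral_pow_mul_gevreyCoeff_le hA hB hp hc hR n hM
    _ = _ := by
        have e1 : κ * (2000 * p * B ^ (-(M : ℝ) / p) * A ^ (-(n : ℝ) / p) *
            Real.Gamma (((M : ℝ) + n) / p + 1)) = κ * (2000 * p * S) := by rw [hS]; ring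
        rw [e1, ← ENNReal.ofReal_mul (by positivity), ← ENNReal.ofReal_mul (by norm_num),
          ← ENNReal.ofReal_add (by positivity) (by positivity)]
        congr 1
        field_simp
        ring

/-- The expansions at infinity of the coefficients of the Cauchy transforms. -/
theorem IsFlatFamily.exists_cauchyMoment_le (hA : 0 < A) (hB : 0 < B) (hp : 0 < p)
    (hc : 0 ≤ c) (hR : 0 < R) (h : IsFlatFamily p A B c R H) : ∃ C : ℝ, 0 ≤ C ∧
      ∀ n M : ℕ, 0 < M → ∀ X : ℂ,
        ‖X‖ ^ M * ‖cauchyTransform (fun U => gevreyCoeff (H U) n) X - ∑ m ∈ Finset.Ico 1 M,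
          cauchyMoment (fun U => gevreyCoeff (H U) n) m * (X ^ m)⁻¹‖ ≤
        C * (A ^ (-(n : ℝ) / p) * B ^ (-(M : ℝ) / p) *
          Real.Gamma (((M : ℝ) + n) / p + 1)) := by
  obtain ⟨C, hC0, hC⟩ := h.exists_lintegral_pow_div_le hA hB hp hc hR
  refine ⟨C, hC0, fun n M hM X => ?_⟩
  have hG : 0 < Real.Gamma (((M : ℝ) + n) / p + 1) := Real.Gamma_pos_of_pos (by positivity)
  rcases eq_or_ne X 0 with rfl | hX
  · rw [norm_zero, zero_pow hM.ne', zero_mul]; positivity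
  have hm := h.measurable_gevreyCoeff hA hB hp hc hR n
  have hi1 : ∀ k : ℕ, Integrable fun U : ℂ => gevreyCoeff (H U) n * U ^ k := fun k => by
    refine ⟨(by fun_prop : Measurable _).aestronglyMeasurable, ?_⟩
    exact (h.lintegral_pow_mul_gevreyCoeff_le hA hB hp hc hR n k.succ_pos).trans_lt
      ENNReal.ofReal_lt_top
  have hi2 : ∀ k : ℕ, Integrable fun U : ℂ => gevreyCoeff (H U) n * U ^ k / (U - X) * X :=
    fun k => by
    refine ⟨(by fun_prop : Measurable _).aestronglyMeasurable, ?_⟩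
    exact (hC n (k + 1) k.succ_pos X hX).trans_lt ENNReal.ofReal_lt_top
  have key : ∀ k : ℕ, cauchyTransform (fun U => gevreyCoeff (H U) n) X -
      ∑ m ∈ Finset.Ico 1 (k + 1), cauchyMoment (fun U => gevreyCoeff (H U) n) m * (X ^ m)⁻¹
      = -(Real.pi : ℂ)⁻¹ * (∫ U : ℂ, gevreyCoeff (H U) n * U ^ k / (U - X) * X) *
        (X ^ (k + 1))⁻¹ := by
    intro k
    induction k with
    | zero =>
      rw [integral_mul_const]
      simp only [cauchyTransform, zero_add, Finset.Ico_self, Finset.sum_empty, sub_zero, pow_zero,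
        mul_one, pow_one]
      field_simp
    | succ k ih =>
      rw [Finset.sum_Ico_succ_top (by omega), ← sub_sub, ih, cauchyMoment, Nat.add_sub_cancel]
      have e : ∫ U : ℂ, gevreyCoeff (H U) n * U ^ (k + 1) / (U - X) * X
          = X * (∫ U : ℂ, gevreyCoeff (H U) n * U ^ k / (U - X) * X) +
            X * ∫ U : ℂ, gevreyCoeff (H U) n * U ^ k := by
        rw [← integral_const_mul, ← integral_const_mul, ← integral_add ((hi2 k).const_mul _)
          ((hi1 k).const_mul _)]
        apply integral_congr_ae
        filter_upwards [ae_ne X] with U hU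
        have : U - X ≠ 0 := sub_ne_zero.2 hU
        field_simp
        ring
      rw [e]
      generalize (∫ U : ℂ, gevreyCoeff (H U) n * U ^ k / (U - X) * X) = I₁
      generalize (∫ U : ℂ, gevreyCoeff (H U) n * U ^ k) = I₂
      field_simp
      ring
  obtain ⟨k, rfl⟩ : ∃ k, M = k + 1 := ⟨M - 1, by omega⟩
  have hX' : 0 < ‖X‖ := norm_pos_iff.2 hX
  have e3 : ‖X‖ ^ (k + 1) * ‖cauchyTransform (fun U => gevreyCoeff (H U) n) X -
      ∑ m ∈ Finset.Ico 1 (k + 1), cauchyMoment (fun U => gevreyCoeff (H U) n) m * (X ^ m)⁻¹‖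
      = ‖-(Real.pi : ℂ)⁻¹ * ∫ U : ℂ, gevreyCoeff (H U) n * U ^ k / (U - X) * X‖ := by
    rw [key k, norm_mul _ ((X ^ (k + 1))⁻¹), norm_inv, norm_pow]
    generalize ‖-(Real.pi : ℂ)⁻¹ * ∫ U : ℂ, gevreyCoeff (H U) n * U ^ k / (U - X) * X‖ = I₁
    field_simp
  rw [e3, ← ENNReal.ofReal_le_ofReal_iff (by positivity), ofReal_norm]
  exact (enorm_inv_pi_mul_le _).trans ((enorm_integral_le_lintegral_enorm _).trans
    (hC n (k + 1) hM X hX))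

end Family

/-! ### Sectors and partitions of unity -/

theorem HasArgIn.mono {α β α' β' : ℝ} {x : ℂ} (h : HasArgIn α β x) (h1 : α' ≤ α) (h2 : β ≤ β') :
    HasArgIn α' β' x := by
  obtain ⟨h0, θ, ha, hb, he⟩ := h
  exact ⟨h0, θ, h1.trans_lt ha, hb.trans_le h2, he⟩

theorem HasArgIn.mul {α β α' β' : ℝ} {x y : ℂ} (hx : HasArgIn α β x) (hy : HasArgIn α' β' y) :
    HasArgIn (α + α') (β + β') (x * y) := by
  obtain ⟨h0, θ, ha, hb, he⟩ := hx
  obtain ⟨h0', θ', ha', hb', he'⟩ := hy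
  refine ⟨mul_ne_zero h0 h0', θ + θ', by linarith, by linarith, ?_⟩
  conv_lhs => rw [he, he']
  rw [norm_mul]
  push_cast
  rw [add_mul, Complex.exp_add]
  ring

theorem HasArgIn.inv {α β : ℝ} {x : ℂ} (hx : HasArgIn α β x) : HasArgIn (-β) (-α) x⁻¹ := by
  obtain ⟨h0, θ, ha, hb, he⟩ := hx
  refine ⟨inv_ne_zero h0, -θ, by linarith, by linarith, ?_⟩
  conv_lhs => rw [he]
  rw [norm_inv, mul_inv, ← Complex.exp_neg]
  push_cast
  rw [neg_mul]

theorem HasArgIn.div {α β α' β' : ℝ} {x y : ℂ} (hx : HasArgIn α β x) (hy : HasArgIn α' β' y) :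
    HasArgIn (α - β') (β - α') (x / y) := by
  rw [div_eq_mul_inv, sub_eq_add_neg, sub_eq_add_neg]
  exact hx.mul hy.inv

theorem HasArgIn.ofReal_mul {α β : ℝ} {x : ℂ} (hx : HasArgIn α β x) {t : ℝ} (ht : 0 < t) :
    HasArgIn α β (t * x) := by
  obtain ⟨h0, θ, ha, hb, he⟩ := hx
  refine ⟨mul_ne_zero (by exact_mod_cast ht.ne') h0, θ, ha, hb, ?_⟩
  conv_lhs => rw [he]
  rw [norm_mul, Complex.norm_real, Real.norm_eq_abs, abs_of_pos ht]
  push_cast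
  ring

theorem HasArgIn.of_ofReal_mul {α β : ℝ} {x : ℂ} {t : ℝ} (ht : 0 < t)
    (hx : HasArgIn α β (t * x)) : HasArgIn α β x := by
  have := hx.ofReal_mul (inv_pos.2 ht)
  rwa [← mul_assoc, ← Complex.ofReal_mul, inv_mul_cancel₀ ht.ne', Complex.ofReal_one,
    one_mul] at this

theorem isOpen_hasArgIn (α β : ℝ) : IsOpen {x | HasArgIn α β x} := by
  rw [isOpen_iff_mem_nhds]
  rintro x ⟨h0, θ, ha, hb, he⟩
  have hc : ContinuousAt (fun y : ℂ => (y / x).arg) x := by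
    have h1 : ContinuousAt Complex.arg (x / x) := by
      rw [div_self h0]; exact Complex.continuousAt_arg Complex.one_mem_slitPlane
    exact ContinuousAt.comp (f := fun y : ℂ => y / x) h1 (by fun_prop)
  have hx : (x / x).arg = 0 := by rw [div_self h0, Complex.arg_one]
  have h1 : ∀ᶠ y in 𝓝 x, α - θ < (y / x).arg :=
    hc.eventually (lt_mem_nhds (by simp only [hx]; linarith))
  have h2 : ∀ᶠ y in 𝓝 x, (y / x).arg < β - θ :=
    hc.eventually (gt_mem_nhds (by simp only [hx]; linarith))
  filter_upwards [h1, h2, isOpen_ne.mem_nhds h0] with y hy1 hy2 hy0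
  refine ⟨hy0, θ + (y / x).arg, by linarith, by linarith, ?_⟩
  have h3 := Complex.norm_mul_exp_arg_mul_I (y / x)
  have h4 : y = (‖y / x‖ * Complex.exp ((y / x).arg * Complex.I)) *
      (‖x‖ * Complex.exp (θ * Complex.I)) := by
    rw [h3, ← he]; field_simp
  have hxn : (‖x‖ : ℂ) ≠ 0 := by exact_mod_cast (norm_pos_iff.2 h0).ne'
  refine h4.trans ?_
  rw [norm_div]
  push_cast
  rw [add_mul, Complex.exp_add]
  field_simp

/-- A partition of unity on `ℂ \ {0}` subordinate to sectors: the homogeneous extension of degree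
`0` of a partition of unity on the unit circle. Hence the derivatives are `O(1 / |u|)`. -/
theorem exists_angular_partition {ι : Type*} [Fintype ι] (α β : ι → ℝ)
    (hcov : ∀ u : ℂ, u ≠ 0 → ∃ i, HasArgIn (α i) (β i) u) :
    ∃ χ : ι → ℂ → ℂ, (∀ i u, u ≠ 0 → ContDiffAt ℝ 1 (χ i) u) ∧ (∀ i u, ‖χ i u‖ ≤ 1) ∧
      (∀ u, u ≠ 0 → ∑ i, χ i u = 1) ∧
      (∀ i u, u ≠ 0 → HasArgIn (α i) (β i) u ∨ χ i =ᶠ[𝓝 u] fun _ => 0) ∧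
      ∃ C, 0 ≤ C ∧ ∀ i u, u ≠ 0 → ‖fderiv ℝ (χ i) u‖ ≤ C / ‖u‖ := by
  obtain ⟨f, hf⟩ := SmoothPartitionOfUnity.exists_isSubordinate 𝓘(ℝ, ℂ)
    (s := Metric.sphere (0 : ℂ) 1) Metric.isClosed_sphere (fun i => {x | HasArgIn (α i) (β i) x})
    (fun i => isOpen_hasArgIn _ _) (by
      intro u hu
      obtain ⟨i, hi⟩ := hcov u (norm_pos_iff.1 (by
        rw [mem_sphere_zero_iff_norm] at hu; rw [hu]; exact one_pos))
      exact mem_iUnion.2 ⟨i, hi⟩)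
  set dir : ℂ → ℂ := fun u => ((‖u‖⁻¹ : ℝ) : ℂ) * u with hdir
  have hdirn : ∀ u, u ≠ 0 → dir u ∈ Metric.sphere (0 : ℂ) 1 := fun u hu => by
    have : ‖u‖ ≠ 0 := norm_ne_zero_iff.2 hu
    rw [mem_sphere_zero_iff_norm]
    simp only [hdir]
    rw [norm_mul, Complex.norm_real, norm_inv, norm_norm, inv_mul_cancel₀ this]
  have hdirc : ∀ u, u ≠ 0 → ContDiffAt ℝ 1 dir u := fun u hu => by
    have h1 : ContDiffAt ℝ 1 (fun u : ℂ => ‖u‖⁻¹) u :=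
      (contDiffAt_norm ℝ hu).inv (norm_ne_zero_iff.2 hu)
    exact (Complex.ofRealCLM.contDiff.contDiffAt.comp u h1).mul contDiffAt_id
  have hdirh : ∀ (t : ℝ) (u : ℂ), 0 < t → dir (t * u) = dir u := fun t u ht => by
    simp only [hdir]
    rw [norm_mul, Complex.norm_real, Real.norm_eq_abs, abs_of_pos ht, mul_inv]
    push_cast
    have : (t : ℂ) ≠ 0 := by exact_mod_cast ht.ne'
    field_simp
  set χ : ι → ℂ → ℂ := fun i u => ((f i (dir u) : ℝ) : ℂ) with hχ
  have hχc : ∀ i u, u ≠ 0 → ContDiffAt ℝ 1 (χ i) u := fun i u hu => by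
    have h1 : ContDiff ℝ ∞ (f i) := (f i).contMDiff.contDiff
    have h2 : ContDiff ℝ 1 (f i) := h1.of_le (by exact_mod_cast le_top)
    exact Complex.ofRealCLM.contDiff.contDiffAt.comp u (h2.contDiffAt.comp u (hdirc u hu))
  refine ⟨χ, hχc, fun i u => ?_, fun u hu => ?_, fun i u hu => ?_, ?_⟩
  · simp only [hχ]
    rw [Complex.norm_real, Real.norm_eq_abs, abs_of_nonneg (f.nonneg i _)]
    exact f.le_one i _
  · simp only [hχ]
    rw [← Complex.ofReal_sum, ← finsum_eq_sum_of_fintype, f.sum_eq_one (hdirn u hu)]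
    simp
  · by_cases h : HasArgIn (α i) (β i) (dir u)
    · left
      exact h.of_ofReal_mul (inv_pos.2 (norm_pos_iff.2 hu))
    · right
      have h1 : dir u ∉ tsupport (f i) := fun hmem => h (hf i hmem)
      have h2 := (notMem_tsupport_iff_eventuallyEq.1 h1)
      filter_upwards [(hdirc u hu).continuousAt.eventually h2] with v hv
      simp only [hχ]
      rw [hv]
      simp
  · have h1 : ∀ i, ∃ C, ∀ u ∈ Metric.sphere (0 : ℂ) 1, ‖fderiv ℝ (χ i) u‖ ≤ C := fun i => by
      apply (isCompact_sphere (0 : ℂ) 1).exists_bound_of_continuousOn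
      intro u hu
      have hu0 : u ≠ 0 := norm_pos_iff.1 (by
        rw [mem_sphere_zero_iff_norm] at hu; rw [hu]; exact one_pos)
      exact ((hχc i u hu0).continuousAt_fderiv one_ne_zero).continuousWithinAt
    choose C hC using h1
    refine ⟨∑ i, |C i|, Finset.sum_nonneg fun i _ => abs_nonneg _, fun i u hu => ?_⟩
    have hu' : 0 < ‖u‖ := norm_pos_iff.2 hu
    have h2 : χ i = fun v => χ i (((‖u‖⁻¹ : ℝ) : ℂ) * v) := by
      ext v
      simp only [hχ]
      rw [hdirh _ _ (inv_pos.2 hu')]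
    have h3 : dir u ≠ 0 := norm_pos_iff.1 (by
      rw [mem_sphere_zero_iff_norm.1 (hdirn u hu)]; exact one_pos)
    rw [h2]
    refine (norm_fderiv_comp_const_mul_le
      ((hχc i _ h3).differentiableAt one_ne_zero)).trans ?_
    rw [Complex.norm_real, norm_inv, norm_norm, inv_mul_eq_div]
    gcongr
    exact (hC i _ (hdirn u hu)).trans ((le_abs_self _).trans
      (Finset.single_le_sum (f := fun i => |C i|) (fun i _ => abs_nonneg _) (Finset.mem_univ i)))

theorem mem_quasiSector_of_hasArgIn {α β μ : ℝ} {U : ℂ} (h : HasArgIn α β U) (h2 : -μ < ‖U‖) :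
    U ∈ quasiSector α β ⊤ μ :=
  Or.inl ⟨h2, EReal.coe_lt_top _, h⟩

/-- A partition of unity on `{|X| > -μ}` subordinate to the quasi-sectors with the larger
parameter `μ'`. It is homogeneous of degree `0` for large `|X|`; near the origin a single
function is equal to `1` if `μ' > 0`, and all functions vanish if `μ' ≤ 0`. -/
theorem exists_quasiSector_partition {ι : Type*} [Fintype ι] [DecidableEq ι] (j₀ : ι)
    (α β : ι → ℝ) {μ μ' : ℝ} (hμ : μ < μ')
    (hcov : ∀ u : ℂ, u ≠ 0 → ∃ i, HasArgIn (α i) (β i) u) :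
    ∃ ψ : ι → ℂ → ℂ, (∀ j, ContDiff ℝ 1 (ψ j)) ∧ (∀ j U, ‖ψ j U‖ ≤ 2) ∧
      (∀ U : ℂ, -μ < ‖U‖ → ∑ j, ψ j U = 1) ∧
      (∀ j U, U ∈ quasiSector (α j) (β j) ⊤ μ' ∨ ψ j =ᶠ[𝓝 U] fun _ => 0) ∧
      ∃ C, 0 ≤ C ∧ ∀ j U, ‖fderiv ℝ (ψ j) U‖ ≤ C / (1 + ‖U‖) := by
  obtain ⟨χ, hχc, hχn, hχs, hχsupp, C, hC0, hχd⟩ := exists_angular_partition α β hcov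
  -- If `μ' > 0` the function with index `j₀` is `1` on a disc of radius less than `μ'`. If `μ' ≤ 0`
  -- then `-μ' < r₁ < r₂ < -μ`, and all functions vanish for `|X| < r₁`.
  obtain ⟨r₁, r₂, e, hr1, hr12, he1, hea, heb, hec⟩ : ∃ (r₁ r₂ : ℝ) (e : ι → ℂ), 0 < r₁ ∧
      r₁ < r₂ ∧ (∀ j, ‖e j‖ ≤ 1) ∧ -μ' < r₁ ∧ (∀ j, e j ≠ 0 → r₂ < μ') ∧
      (∑ j, e j = 1 ∨ r₂ ≤ -μ) := by
    rcases lt_or_ge 0 μ' with h | h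
    · refine ⟨μ' / 3, μ' / 2, fun j => if j = j₀ then 1 else 0, by linarith, by linarith,
        fun j => ?_, by linarith, fun _ _ => by linarith, Or.inl (by simp)⟩
      dsimp only
      split_ifs <;> simp
    · exact ⟨(-2 * μ' - μ) / 3, (-μ' - 2 * μ) / 3, fun _ => 0, by linarith, by linarith, by simp,
        by linarith, by simp, Or.inr (by linarith)⟩
  have hr2 : 0 < r₂ := hr1.trans hr12
  obtain ⟨k, hk, hk1, hk0, hkn, hkn', -, -, -⟩ := exists_cutoff hr1 hr12
  set ψ : ι → ℂ → ℂ := fun j U => (1 - k U) * χ j U + k U * e j with hψ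
  have hψin : ∀ j (U : ℂ), ‖U‖ < r₁ → ψ j =ᶠ[𝓝 U] fun _ => e j := by
    intro j U hU
    filter_upwards [(isOpen_lt continuous_norm continuous_const).mem_nhds hU] with V hV
    simp only [hψ]
    rw [hk1 V (le_of_lt hV)]; ring
  have hψout : ∀ j (U : ℂ), r₂ < ‖U‖ → ψ j =ᶠ[𝓝 U] χ j := by
    intro j U hU
    filter_upwards [(isOpen_lt continuous_const continuous_norm).mem_nhds hU] with V hV
    simp only [hψ]
    rw [hk0 V (le_of_lt hV)]; ring
  have hψc : ∀ j, ContDiff ℝ 1 (ψ j) := by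
    intro j
    rw [contDiff_iff_contDiffAt]
    intro U
    rcases lt_or_ge ‖U‖ r₁ with h | h
    · exact contDiffAt_const.congr_of_eventuallyEq (hψin j U h)
    · have hU : U ≠ 0 := norm_pos_iff.1 (hr1.trans_le h)
      exact ((contDiffAt_const.sub hk.contDiffAt).mul (hχc j U hU)).add
        (hk.contDiffAt.mul contDiffAt_const)
  refine ⟨ψ, hψc, fun j U => ?_, fun U hU => ?_, fun j U => ?_, ?_⟩
  · refine (norm_add_le _ _).trans ?_
    rw [norm_mul, norm_mul]
    have h1 : ‖1 - k U‖ * ‖χ j U‖ ≤ 1 * 1 :=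
      mul_le_mul (hkn' U) (hχn j U) (norm_nonneg _) zero_le_one
    have h2 : ‖k U‖ * ‖e j‖ ≤ 1 * 1 :=
      mul_le_mul (hkn U) (he1 j) (norm_nonneg _) zero_le_one
    linarith
  · simp only [hψ]
    rw [Finset.sum_add_distrib, ← Finset.mul_sum, ← Finset.mul_sum]
    rcases hec with h | h
    · rw [h]
      rcases eq_or_ne U 0 with rfl | hU0
      · rw [hk1 0 (by simpa using hr1.le)]; ring
      · rw [hχs U hU0]; ring
    · have h3 : r₂ ≤ ‖U‖ := h.trans hU.le
      rw [hk0 U h3, hχs U (norm_pos_iff.1 (hr2.trans_le h3))]; ring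
  · rcases lt_or_ge ‖U‖ r₁ with h | h
    · by_cases he0 : e j = 0
      · right
        have := hψin j U h
        rwa [he0] at this
      · left
        exact Or.inr ((h.trans hr12).trans (heb j he0))
    · have hU : U ≠ 0 := norm_pos_iff.1 (hr1.trans_le h)
      rcases hχsupp j U hU with h1 | h1
      · left
        exact mem_quasiSector_of_hasArgIn h1 (hea.trans_le h)
      · by_cases he0 : e j = 0
        · right
          filter_upwards [h1] with V hV
          simp only [hψ]
          rw [hV, he0]; ring
        · rcases le_or_gt ‖U‖ r₂ with h2 | h2
          · left
            exact Or.inr (h2.trans_lt (heb j he0))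
          · right
            exact (hψout j U h2).trans h1
  · have h1 : ∀ j, ∃ K, ∀ U ∈ Metric.closedBall (0 : ℂ) r₂, ‖fderiv ℝ (ψ j) U‖ ≤ K := fun j =>
      (isCompact_closedBall (0 : ℂ) r₂).exists_bound_of_continuousOn
        ((hψc j).continuous_fderiv one_ne_zero).continuousOn
    choose K hK using h1
    refine ⟨(∑ j, |K j|) * (1 + r₂) + C * (1 + 1 / r₂), ?_, fun j U => ?_⟩
    · have : 0 ≤ ∑ j, |K j| := Finset.sum_nonneg fun i _ => abs_nonneg _
      positivity
    have hs0 : 0 ≤ ∑ j, |K j| := Finset.sum_nonneg fun i _ => abs_nonneg _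
    rw [le_div_iff₀ (by positivity)]
    rcases le_or_gt ‖U‖ r₂ with h | h
    · have h2 : ‖fderiv ℝ (ψ j) U‖ ≤ ∑ j, |K j| :=
        (hK j U (by simpa using h)).trans ((le_abs_self _).trans
          (Finset.single_le_sum (f := fun j => |K j|) (fun i _ => abs_nonneg _)
            (Finset.mem_univ j)))
      have h3 : ‖fderiv ℝ (ψ j) U‖ * (1 + ‖U‖) ≤ (∑ j, |K j|) * (1 + r₂) := by gcongr
      have h4 : 0 ≤ C * (1 + 1 / r₂) := by positivity
      linarith
    · rw [(hψout j U h).fderiv_eq]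
      have hU : 0 < ‖U‖ := hr2.trans h
      have h3 : ‖fderiv ℝ (χ j) U‖ * (1 + ‖U‖) ≤ C * (1 + 1 / r₂) := by
        calc _ ≤ C / ‖U‖ * (1 + ‖U‖) := by
              gcongr; exact hχd j U (norm_pos_iff.1 hU)
          _ = C * (1 + 1 / ‖U‖) := by field_simp; ring
          _ ≤ _ := by gcongr
      have h4 : 0 ≤ (∑ j, |K j|) * (1 + r₂) := by positivity
      linarith

/-! ### The functions of a coherent good covering -/

/-- Functions `y i l (x, η)`, holomorphic and bounded by `K` for `η ∈ S l`, `|η| < η₀`, `|x| < r'`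
and `x / η ∈ W i`, such that two of them with the same first index differ by at most
`C exp (-A / |η|^p)`, and two of them with the same second index by at most
`C exp (-B |x / η|^p)` provided that `|x / η| > R₀`. Here `i` and `l` are arbitrary indices: it is
not required that they be neighbours. -/
structure IsOverlapFamily {ι κ : Type*} (p : ℕ) (A B C K η₀ r' R₀ : ℝ) (W : ι → Set ℂ)
    (S : κ → Set ℂ) (y : ι → κ → ℂ → ℂ → ℂ) : Prop where
  isOpen_W : ∀ i, IsOpen (W i)
  isOpen_S : ∀ l, IsOpen (S l)
  ne_zero : ∀ l, ∀ η ∈ S l, η ≠ 0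
  holomorphic : ∀ i l x η, η ∈ S l → ‖η‖ < η₀ → x / η ∈ W i → ‖x‖ < r' →
    DifferentiableAt ℂ (fun z : ℂ × ℂ => y i l z.1 z.2) (x, η)
  bound : ∀ i l x η, η ∈ S l → ‖η‖ < η₀ → x / η ∈ W i → ‖x‖ < r' → ‖y i l x η‖ ≤ K
  slow : ∀ i l m x η, η ∈ S l → η ∈ S m → ‖η‖ < η₀ → x / η ∈ W i → ‖x‖ < r' →
    ‖y i l x η - y i m x η‖ ≤ C * Real.exp (-(A / ‖η‖ ^ p))
  fast : ∀ i j l x η, η ∈ S l → ‖η‖ < η₀ → x / η ∈ W i → x / η ∈ W j → R₀ < ‖x / η‖ →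
    ‖x‖ < r' → ‖y i l x η - y j l x η‖ ≤ C * Real.exp (-(B * ‖x / η‖ ^ p))

theorem isOpen_quasiSector (α β μ : ℝ) : IsOpen (quasiSector α β ⊤ μ) := by
  have : quasiSector α β ⊤ μ = ({x | -μ < ‖x‖} ∩ {x | HasArgIn α β x}) ∪ {x | ‖x‖ < μ} := by
    ext x; simp [quasiSector, EReal.coe_lt_top]
  rw [this]
  exact ((isOpen_lt continuous_const continuous_norm).inter (isOpen_hasArgIn α β)).union
    (isOpen_lt continuous_norm continuous_const)

theorem hasArgIn_of_mem_quasiSector {α β μ : ℝ} {r : EReal} {x : ℂ} (h : x ∈ quasiSector α β r μ)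
    (hx : μ ≤ ‖x‖) : HasArgIn α β x := by
  rcases h with h | h
  · exact h.2.2
  · exact absurd h (not_lt.2 hx)

/-- The domains of the functions of a covering are open in both variables, so that differentiability
on them is differentiability at their points. -/
theorem isOpen_setOf_mem_bigCover (α β αS βS η₀ r' μ' : ℝ) :
    IsOpen {z : ℂ × ℂ | z.2 ∈ sector αS βS η₀ ∧ z.1 ∈ quasiSector α β r' (μ' * ‖z.2‖)} := by
  have h : {z : ℂ × ℂ | z.2 ∈ sector αS βS η₀ ∧ z.1 ∈ quasiSector α β r' (μ' * ‖z.2‖)} =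
      ({z | ‖z.2‖ < η₀} ∩ Prod.snd ⁻¹' {x | HasArgIn αS βS x}) ∩
      (({z | -(μ' * ‖z.2‖) < ‖z.1‖} ∩ {z | ‖z.1‖ < r'} ∩ Prod.fst ⁻¹' {x | HasArgIn α β x}) ∪
        {z | ‖z.1‖ < μ' * ‖z.2‖}) := by
    ext z
    simp [quasiSector, sector, EReal.coe_lt_coe_iff, and_assoc]
  rw [h]
  refine ((isOpen_lt (by fun_prop) (by fun_prop)).inter
    ((isOpen_hasArgIn _ _).preimage continuous_snd)).inter
    (((((isOpen_lt (by fun_prop) (by fun_prop)).inter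
      (isOpen_lt (by fun_prop) (by fun_prop)))).inter
      ((isOpen_hasArgIn _ _).preimage continuous_fst)).union
      (isOpen_lt (by fun_prop) (by fun_prop)))

theorem exists_ofReal_mul_norm_eq {u : ℂ} (hu : u ≠ 0) {r : ℝ} (hr : 0 < r) :
    ∃ t : ℝ, 0 < t ∧ ‖(t : ℂ) * u‖ = r := by
  have h : 0 < ‖u‖ := norm_pos_iff.2 hu
  refine ⟨r / ‖u‖, div_pos hr h, ?_⟩
  rw [norm_mul, Complex.norm_real, Real.norm_eq_abs, abs_of_pos (div_pos hr h)]
  field_simp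

section Cover

variable {J L : ℕ} [NeZero J] [NeZero L] {αV βV : Fin J → ℝ} {αS βS : Fin L → ℝ} {μ η₀ δ : ℝ}

theorem IsGoodCoverV.exists_hasArgIn (h : IsGoodCoverV αV βV μ) {u : ℂ} (hu : u ≠ 0) :
    ∃ j, HasArgIn (αV j) (βV j) u := by
  obtain ⟨t, ht, hn⟩ := exists_ofReal_mul_norm_eq hu (r := |μ| + 1) (by positivity)
  have h1 : (t : ℂ) * u ∈ outerAnnulus (-μ) := by
    change -μ < ‖(t : ℂ) * u‖
    rw [hn]; linarith [neg_abs_le μ]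
  rw [← h.iUnion_eq] at h1
  obtain ⟨j, hj⟩ := mem_iUnion.1 h1
  exact ⟨j, (hasArgIn_of_mem_quasiSector hj (by rw [hn]; linarith [le_abs_self μ])).of_ofReal_mul
    ht⟩

/-- Two quasi-sectors with a common direction have an unbounded intersection, so they are
neighbours. -/
theorem IsGoodCoverV.neighbour (h : IsGoodCoverV αV βV μ) {u : ℂ} {i j : Fin J}
    (hi : HasArgIn (αV i) (βV i) u) (hj : HasArgIn (αV j) (βV j) u) :
    i = j - 1 ∨ i = j ∨ i = j + 1 := by
  by_contra! hne
  obtain ⟨R, hR⟩ := (h.bounded_inter i j hne.1 hne.2.1 hne.2.2).exists_norm_le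
  obtain ⟨t, ht, hn⟩ := exists_ofReal_mul_norm_eq hi.1 (r := |μ| + |R| + 1) (by positivity)
  have h0 : -μ < ‖(t : ℂ) * u‖ := by
    rw [hn]; linarith [neg_abs_le μ, abs_nonneg R]
  have h1 := hR ((t : ℂ) * u) ⟨mem_quasiSector_of_hasArgIn (hi.ofReal_mul ht) h0,
    mem_quasiSector_of_hasArgIn (hj.ofReal_mul ht) h0⟩
  rw [hn] at h1
  linarith [abs_nonneg μ, le_abs_self R]

theorem IsGoodCoverS.exists_hasArgIn (h : IsGoodCoverS αS βS η₀) (hη₀ : 0 < η₀) {u : ℂ}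
    (hu : u ≠ 0) : ∃ l, HasArgIn (αS l) (βS l) u := by
  obtain ⟨t, ht, hn⟩ := exists_ofReal_mul_norm_eq hu (r := η₀ / 2) (by positivity)
  have h1 : (t : ℂ) * u ∈ {η : ℂ | 0 < ‖η‖ ∧ ‖η‖ < η₀} := by
    change 0 < ‖(t : ℂ) * u‖ ∧ ‖(t : ℂ) * u‖ < η₀
    rw [hn]; constructor <;> linarith
  rw [← h.iUnion_eq] at h1
  obtain ⟨l, hl⟩ := mem_iUnion.1 h1
  exact ⟨l, hl.2.of_ofReal_mul ht⟩

theorem IsGoodCoverS.neighbour (h : IsGoodCoverS αS βS η₀) {u : ℂ} {l m : Fin L}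
    (hl : HasArgIn (αS l) (βS l) u) (hm : HasArgIn (αS m) (βS m) u) (hu : ‖u‖ < η₀) :
    l = m - 1 ∨ l = m ∨ l = m + 1 := by
  by_contra! hne
  exact disjoint_left.1 (h.disjoint l m hne.1 hne.2.1 hne.2.2) ⟨hu, hl⟩ ⟨hu, hm⟩

theorem IsCoherentGoodCover.delta_pos (h : IsCoherentGoodCover αV βV αS βS μ η₀ δ) : 0 < δ :=
  (sub_pos.2 (h.goodS.angle_lt 0)).trans_le (h.opening_le 0)

/-- From `α^j < α^{j+1}`, a consequence of `α^j < β^{j-1} < α^{j+1}`, and `α^{j+1} + 2δ < β^j`. -/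
theorem IsCoherentGoodCover.lowAngle_lt (h : IsCoherentGoodCover αV βV αS βS μ η₀ δ)
    (j : Fin J) (l : Fin L) : lowAngle αV αS βS δ j l < highAngle βV αS βS δ j l := by
  have h1 := h.goodV.next_lt (j - 1)
  have h2 := h.goodV.lt_next_next (j - 1)
  have h3 := h.lt_overlap j
  unfold lowAngle highAngle
  rw [sub_add_cancel] at h2
  unfold nextAngle at h1 h2 h3
  rw [sub_add_cancel] at h1
  linarith

theorem IsCoherentGoodCover.low_le (h : IsCoherentGoodCover αV βV αS βS μ η₀ δ)
    (j : Fin J) (l : Fin L) : αV j ≤ lowAngle αV αS βS δ j l - βS l := by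
  have h1 := h.opening_le l
  have h2 := h.goodS.angle_lt l
  unfold lowAngle bisector
  linarith

theorem IsCoherentGoodCover.high_le (h : IsCoherentGoodCover αV βV αS βS μ η₀ δ)
    (j : Fin J) (l : Fin L) : highAngle βV αS βS δ j l - αS l ≤ βV j := by
  have h1 := h.opening_le l
  have h2 := h.goodS.angle_lt l
  unfold highAngle bisector
  linarith

/-- The directions of `x / η` for `x ∈ V_l^j(η)`, `η ∈ S_l` lie between `α_l^j - β_l ≥ α^j` and
`β_l^j - α_l ≤ β^j`. -/
theorem IsCoherentGoodCover.div_mem (h : IsCoherentGoodCover αV βV αS βS μ η₀ δ) {r₀ : ℝ}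
    {j : Fin J} {l : Fin L} {x η : ℂ} (hη : HasArgIn (αS l) (βS l) η)
    (hx : x ∈ coverV αV βV αS βS δ r₀ μ j l η) : x / η ∈ quasiSector (αV j) (βV j) ⊤ μ := by
  have hη0 : 0 < ‖η‖ := norm_pos_iff.2 hη.1
  rcases hx with ⟨h1, -, h3⟩ | h1
  · refine Or.inl ⟨?_, EReal.coe_lt_top _, (h3.div hη).mono (h.low_le j l) (h.high_le j l)⟩
    rw [norm_div, lt_div_iff₀ hη0]; linarith
  · right
    rwa [norm_div, div_lt_iff₀ hη0]

/-- The converse of `div_mem` with the larger sets: the opening of `S_l` is at most `δ`, and the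
angles of `Ṽ_l^j(η)` exceed those of `V_l^j(η)` by `2δ`. -/
theorem IsCoherentGoodCover.mem_bigCoverV (h : IsCoherentGoodCover αV βV αS βS μ η₀ δ)
    {r' μ' : ℝ} {j : Fin J} {l : Fin L} {x η : ℂ} (hη : HasArgIn (αS l) (βS l) η)
    (hx : x / η ∈ quasiSector (αV j) (βV j) ⊤ μ') (hr : ‖x‖ < r') :
    x ∈ bigCoverV αV βV αS βS δ r' μ' j l η := by
  have hη0 : 0 < ‖η‖ := norm_pos_iff.2 hη.1
  have hδ := h.delta_pos
  have h1 := h.opening_le l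
  have h2 := h.goodS.angle_lt l
  rcases hx with ⟨h3, -, h4⟩ | h3
  · refine Or.inl ⟨?_, by exact_mod_cast hr, ?_⟩
    · rw [norm_div, lt_div_iff₀ hη0] at h3; linarith
    · have h5 := h4.mul hη
      rw [div_mul_cancel₀ _ hη.1] at h5
      refine h5.mono ?_ ?_
      · unfold lowAngle bisector; linarith
      · unfold highAngle bisector; linarith
  · right
    rwa [norm_div, div_lt_iff₀ hη0] at h3

theorem IsCoherentGoodCover.coverV_subset (h : IsCoherentGoodCover αV βV αS βS μ η₀ δ)
    {r₀ r' μ' : ℝ} (hr : r₀ < r') (hμ : μ < μ') {j : Fin J} {l : Fin L} {η : ℂ} :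
    coverV αV βV αS βS δ r₀ μ j l η ⊆ bigCoverV αV βV αS βS δ r' μ' j l η := by
  have hδ := h.delta_pos
  have h1 : μ * ‖η‖ ≤ μ' * ‖η‖ := mul_le_mul_of_nonneg_right hμ.le (norm_nonneg _)
  rintro x (⟨h2, h3, h4⟩ | h2)
  · refine Or.inl ⟨by linarith, h3.trans (by exact_mod_cast hr), h4.mono ?_ ?_⟩ <;> linarith
  · exact Or.inr (h2.trans_le h1)

/-- The estimates for neighbouring indices suffice: for `|x / η| > R₀` the quasi-sectors containing
`x / η` are neighbours, as are the sectors containing `η`. -/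
theorem IsCoherentGoodCover.isOverlapFamily (h : IsCoherentGoodCover αV βV αS βS μ η₀ δ)
    {p : ℕ} {r' μ' A B C K : ℝ} (hC : 0 ≤ C) {y : Fin J → Fin L → ℂ → ℂ → ℂ}
    (hol : ∀ j l, DifferentiableOn ℂ (fun z : ℂ × ℂ => y j l z.1 z.2)
      {z | z.2 ∈ sector (αS l) (βS l) η₀ ∧ z.1 ∈ bigCoverV αV βV αS βS δ r' μ' j l z.2})
    (bdd : ∀ j l, ∀ η ∈ sector (αS l) (βS l) η₀,
      ∀ x ∈ bigCoverV αV βV αS βS δ r' μ' j l η, ‖y j l x η‖ ≤ K)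
    (hl : ∀ j l, ∀ η ∈ sector (αS l) (βS l) η₀ ∩ sector (αS (l + 1)) (βS (l + 1)) η₀,
      ∀ x ∈ bigCoverV αV βV αS βS δ r' μ' j l η ∩ bigCoverV αV βV αS βS δ r' μ' j (l + 1) η,
        ‖y j (l + 1) x η - y j l x η‖ ≤ C * Real.exp (-(A / ‖η‖ ^ p)))
    (hj : ∀ j l, ∀ η ∈ sector (αS l) (βS l) η₀,
      ∀ x ∈ bigCoverV αV βV αS βS δ r' μ' j l η ∩ bigCoverV αV βV αS βS δ r' μ' (j + 1) l η,
        ‖y (j + 1) l x η - y j l x η‖ ≤ C * Real.exp (-(B * ‖x / η‖ ^ p)))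
    {R₀ : ℝ} (hR₀ : μ' ≤ R₀) :
    IsOverlapFamily p A B C K η₀ r' R₀ (fun j => quasiSector (αV j) (βV j) ⊤ μ')
      (fun l => {η | HasArgIn (αS l) (βS l) η}) y where
  isOpen_W _ := isOpen_quasiSector _ _ _
  isOpen_S _ := isOpen_hasArgIn _ _
  ne_zero _ _ hη := hη.1
  holomorphic j l x η hη hη₀ hx hr :=
    (hol j l).differentiableAt ((isOpen_setOf_mem_bigCover _ _ _ _ _ _ _).mem_nhds
      ⟨⟨hη₀, hη⟩, h.mem_bigCoverV hη hx hr⟩)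
  bound j l x η hη hη₀ hx hr := bdd j l η ⟨hη₀, hη⟩ x (h.mem_bigCoverV hη hx hr)
  slow j l m x η hη hη' hη₀ hx hr := by
    have h1 := h.mem_bigCoverV hη hx hr
    have h2 := h.mem_bigCoverV hη' hx hr
    rcases h.goodS.neighbour hη hη' hη₀ with rfl | rfl | rfl
    · rw [norm_sub_rev]
      have := hl j (m - 1) η
      rw [sub_add_cancel] at this
      exact this ⟨⟨hη₀, hη⟩, ⟨hη₀, hη'⟩⟩ x ⟨h1, h2⟩
    · rw [sub_self, norm_zero]; positivity
    · exact hl j m η ⟨⟨hη₀, hη'⟩, ⟨hη₀, hη⟩⟩ x ⟨h2, h1⟩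
  fast i j l x η hη hη₀ hx hx' hR hr := by
    have h1 := h.mem_bigCoverV hη hx hr
    have h2 := h.mem_bigCoverV hη hx' hr
    have hle : μ' ≤ ‖x / η‖ := hR₀.trans hR.le
    rcases h.goodV.neighbour (hasArgIn_of_mem_quasiSector hx hle)
      (hasArgIn_of_mem_quasiSector hx' hle) with rfl | rfl | rfl
    · rw [norm_sub_rev]
      have := hj (j - 1) l η ⟨hη₀, hη⟩ x
      rw [sub_add_cancel] at this
      exact this ⟨h1, h2⟩
    · rw [sub_self, norm_zero]; positivity
    · exact hj j l η ⟨hη₀, hη⟩ x ⟨h2, h1⟩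

end Cover

/-! ### Gluing the functions of an overlap family -/

/-- An overlap family together with the partitions of unity `χ`, `ψ` and the cutoff functions `k₁`,
`k₂` used to glue its members. The partition `χ` in the variable `η` is subordinate to the sets
`S l`, the partition `ψ` in the variable `X = x / η` to the sets `W i`; its sum is `1` on the open
set `Ω`. The function `k₁` of `η` has its support in the disc of radius `η₁ < η₀` and
the function `k₂` of `x` in the disc of radius `r₂ < r'`; they are equal to `1` on the discs of
radius `η₂` and `r₁ > r₀`. -/
structure GluingData (ι κ : Type*) [Fintype ι] [Fintype κ] (p : ℕ) (A B r₀ : ℝ) where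
  (W : ι → Set ℂ) (S : κ → Set ℂ) (y : ι → κ → ℂ → ℂ → ℂ) (Ω : Set ℂ)
  (C K η₀ r' R₀ r₁ r₂ η₁ η₂ C₁ C₂ Cχ Cψ : ℝ)
  (k₁ k₂ : ℂ → ℂ) (χ : κ → ℂ → ℂ) (ψ : ι → ℂ → ℂ)
  hp : 0 < p
  hA : 0 < A
  hB : 0 < B
  hC : 0 ≤ C
  hK : 0 ≤ K
  hr₀ : 0 < r₀
  hr₁ : r₀ < r₁
  hr₂ : r₁ < r₂
  hr' : r₂ < r'
  hη₂ : 0 < η₂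
  hη₁ : η₂ < η₁
  hη₀ : η₁ < η₀
  hR₀ : 0 < R₀
  hRη : R₀ * η₁ < r₁
  overlap : IsOverlapFamily p A B C K η₀ r' R₀ W S y
  k₁_contDiff : ContDiff ℝ 1 k₁
  k₁_one : ∀ u, ‖u‖ ≤ η₂ → k₁ u = 1
  k₁_zero : ∀ u, η₁ ≤ ‖u‖ → k₁ u = 0
  k₁_norm : ∀ u, ‖k₁ u‖ ≤ 1
  k₁_fderiv_zero : ∀ u, ‖u‖ < η₂ → fderiv ℝ k₁ u = 0
  k₁_fderiv : ∀ u, ‖fderiv ℝ k₁ u‖ ≤ C₁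
  k₂_contDiff : ContDiff ℝ 1 k₂
  k₂_one : ∀ u, ‖u‖ ≤ r₁ → k₂ u = 1
  k₂_zero : ∀ u, r₂ ≤ ‖u‖ → k₂ u = 0
  k₂_norm : ∀ u, ‖k₂ u‖ ≤ 1
  k₂_fderiv_zero : ∀ u, ‖u‖ < r₁ → fderiv ℝ k₂ u = 0
  k₂_fderiv_zero' : ∀ u, r₂ < ‖u‖ → fderiv ℝ k₂ u = 0
  k₂_fderiv : ∀ u, ‖fderiv ℝ k₂ u‖ ≤ C₂
  χ_contDiffAt : ∀ l u, u ≠ 0 → ContDiffAt ℝ 1 (χ l) u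
  χ_norm : ∀ l u, ‖χ l u‖ ≤ 1
  χ_sum : ∀ u, u ≠ 0 → ∑ l, χ l u = 1
  χ_subordinate : ∀ l u, u ≠ 0 → u ∈ S l ∨ χ l =ᶠ[𝓝 u] fun _ => 0
  χ_fderiv : ∀ l u, u ≠ 0 → ‖fderiv ℝ (χ l) u‖ ≤ Cχ / ‖u‖
  ψ_contDiff : ∀ i, ContDiff ℝ 1 (ψ i)
  ψ_norm : ∀ i U, ‖ψ i U‖ ≤ 2
  isOpen_Ω : IsOpen Ω
  mem_Ω : ∀ U, R₀ < ‖U‖ → U ∈ Ω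
  ψ_sum : ∀ U ∈ Ω, ∑ i, ψ i U = 1
  ψ_subordinate : ∀ i U, U ∈ W i ∨ ψ i =ᶠ[𝓝 U] fun _ => 0
  ψ_fderiv : ∀ i U, ‖fderiv ℝ (ψ i) U‖ ≤ Cψ / (1 + ‖U‖)

/-- A product of a `C¹` function and of a function that is holomorphic near every point where the
first factor does not vanish identically. -/
theorem contDiffAt_mul_of_holomorphic {ζ φ : ℂ → ℂ} {u : ℂ} (hζ : ContDiffAt ℝ 1 ζ u)
    (h : (ζ =ᶠ[𝓝 u] fun _ => 0) ∨ ∀ᶠ v in 𝓝 u, DifferentiableAt ℂ φ v) :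
    ContDiffAt ℝ 1 (fun v => ζ v * φ v) u ∧ dbar (fun v => ζ v * φ v) u = dbar ζ u * φ u := by
  rcases h with h | h
  · have h1 : (fun v => ζ v * φ v) =ᶠ[𝓝 u] fun _ => 0 := by
      filter_upwards [h] with v hv
      rw [hv, zero_mul]
    refine ⟨contDiffAt_const.congr_of_eventuallyEq h1, ?_⟩
    rw [dbar_congr h1, dbar_congr h, dbar_const, zero_mul]
  · have h1 : ContDiffAt ℝ 1 φ u :=
      ((Complex.analyticAt_iff_eventually_differentiableAt.2 h).contDiffAt
        (n := 1)).restrict_scalars ℝ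
    refine ⟨hζ.mul h1, ?_⟩
    rw [dbar_mul (hζ.differentiableAt one_ne_zero) (h1.differentiableAt one_ne_zero),
      dbar_eq_zero h.self_of_nhds, mul_zero, add_zero]

/-- Exponential smallness in `a` may be added at the cost of a constant, as long as `a` is
bounded. -/
theorem exp_neg_le_mul_exp_neg_max {a b a₀ : ℝ} (ha : a ≤ a₀) (ha₀ : 0 ≤ a₀) (hb : 0 ≤ b) :
    Real.exp (-b) ≤ Real.exp a₀ * Real.exp (-max a b) := by
  rw [← Real.exp_add, Real.exp_le_exp]
  rcases max_cases a b with ⟨h, -⟩ | ⟨h, -⟩ <;> rw [h] <;> linarith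

theorem exp_neg_max_eq_min (a b : ℝ) :
    Real.exp (-max a b) = min (Real.exp (-a)) (Real.exp (-b)) := by
  rcases le_total a b with h | h
  · rw [max_eq_right h, min_eq_right (by simpa using h)]
  · rw [max_eq_left h, min_eq_left (by simpa using h)]

theorem dbar_sum_eq_zero {ι : Type*} [Fintype ι] {f : ι → ℂ → ℂ} {u : ℂ}
    (hf : ∀ i, DifferentiableAt ℝ (f i) u) {c : ℂ} (h : ∀ᶠ v in 𝓝 u, ∑ i, f i v = c) :
    ∑ i, dbar (f i) u = 0 := by
  rw [← dbar_sum Finset.univ (fun i _ => hf i), dbar_congr (g := fun _ => c) h, dbar_const]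

namespace GluingData

variable {ι κ : Type*} [Fintype ι] [Fintype κ] {p : ℕ} {A B r₀ : ℝ} (G : GluingData ι κ p A B r₀)

/-- The combination `∑ i, w i * y i l (uU, u)` of the functions of the family in the coordinates
`U = x / u`, `u`, glued by means of the partition `χ` and cut off for large `u` and large `uU`. -/
noncomputable def fibre (w : ι → ℂ) (U u : ℂ) : ℂ :=
  G.k₁ u * G.k₂ (u * U) * ∑ l, G.χ l u * ∑ i, w i * G.y i l (u * U) u

theorem η₁_pos : 0 < G.η₁ := G.hη₂.trans G.hη₁
theorem r₁_pos : 0 < G.r₁ := G.hr₀.trans G.hr₁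
theorem r₂_pos : 0 < G.r₂ := G.r₁_pos.trans G.hr₂
theorem C₁_nonneg : 0 ≤ G.C₁ := (norm_nonneg _).trans (G.k₁_fderiv 0)
theorem C₂_nonneg : 0 ≤ G.C₂ := (norm_nonneg _).trans (G.k₂_fderiv 0)
theorem Cψ_nonneg (i : ι) : 0 ≤ G.Cψ := by
  have := (norm_nonneg _).trans (G.ψ_fderiv i 0)
  simpa using this
theorem exists_mem_S {u : ℂ} (hu : u ≠ 0) : ∃ l, u ∈ G.S l := by
  by_contra! h
  have h1 := G.χ_sum u hu
  rw [Finset.sum_eq_zero fun l _ =>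
    ((G.χ_subordinate l u hu).resolve_left (h l)).self_of_nhds] at h1
  exact zero_ne_one h1
theorem Cχ_nonneg : 0 ≤ G.Cχ := by
  obtain ⟨l, -⟩ := G.exists_mem_S one_ne_zero
  have := (norm_nonneg _).trans (G.χ_fderiv l 1 one_ne_zero)
  simpa using this

theorem min_pos (G : GluingData ι κ p A B r₀) : 0 < min A (B * r₀ ^ p) :=
  lt_min G.hA (mul_pos G.hB (pow_pos G.hr₀ p))

theorem k₁_eventually_zero {u : ℂ} (hu : G.η₁ < ‖u‖) : G.k₁ =ᶠ[𝓝 u] fun _ => 0 := by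
  filter_upwards [(isOpen_lt continuous_const continuous_norm).mem_nhds hu] with v hv
  exact G.k₁_zero v (le_of_lt hv)

theorem k₂_eventually_zero {u : ℂ} (hu : G.r₂ < ‖u‖) : G.k₂ =ᶠ[𝓝 u] fun _ => 0 := by
  filter_upwards [(isOpen_lt continuous_const continuous_norm).mem_nhds hu] with v hv
  exact G.k₂_zero v (le_of_lt hv)

theorem mem_S_of_χ_ne_zero {l : κ} {u : ℂ} (hu : u ≠ 0) (h : G.χ l u ≠ 0) : u ∈ G.S l :=
  (G.χ_subordinate l u hu).resolve_right fun h' => h h'.self_of_nhds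

theorem mem_S_of_dbar_χ_ne_zero {l : κ} {u : ℂ} (hu : u ≠ 0) (h : dbar (G.χ l) u ≠ 0) :
    u ∈ G.S l :=
  (G.χ_subordinate l u hu).resolve_right fun h' => h (by rw [dbar_congr h', dbar_const])

theorem mem_W_of_ψ_ne_zero {i : ι} {U : ℂ} (h : G.ψ i U ≠ 0) : U ∈ G.W i :=
  (G.ψ_subordinate i U).resolve_right fun h' => h h'.self_of_nhds

theorem mem_W_of_dbar_ψ_ne_zero {i : ι} {U : ℂ} (h : dbar (G.ψ i) U ≠ 0) : U ∈ G.W i :=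
  (G.ψ_subordinate i U).resolve_right fun h' => h (by rw [dbar_congr h', dbar_const])

theorem sum_dbar_χ {u : ℂ} (hu : u ≠ 0) : ∑ l, dbar (G.χ l) u = 0 :=
  dbar_sum_eq_zero (fun l => (G.χ_contDiffAt l u hu).differentiableAt one_ne_zero)
    (by filter_upwards [isOpen_ne.mem_nhds hu] with v hv using G.χ_sum v hv)

theorem sum_dbar_ψ {U : ℂ} (hU : U ∈ G.Ω) : ∑ i, dbar (G.ψ i) U = 0 :=
  dbar_sum_eq_zero (fun i => (G.ψ_contDiff i).contDiffAt.differentiableAt one_ne_zero)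
    (by filter_upwards [G.isOpen_Ω.mem_nhds hU] with v hv using G.ψ_sum v hv)

theorem norm_sum_mul_y_le {w : ι → ℂ} {U u : ℂ} (hw : ∀ i, w i ≠ 0 → U ∈ G.W i) {l : κ}
    (hu : u ∈ G.S l) (hη : ‖u‖ < G.η₀) (hr : ‖u * U‖ < G.r') :
    ‖∑ i, w i * G.y i l (u * U) u‖ ≤ G.K * ∑ i, ‖w i‖ := by
  have hu0 := G.overlap.ne_zero l u hu
  rw [Finset.mul_sum]
  refine (norm_sum_le _ _).trans (Finset.sum_le_sum fun i _ => ?_)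
  rw [norm_mul, mul_comm]
  by_cases hi : w i = 0
  · rw [hi, norm_zero, mul_zero, mul_zero]
  · refine mul_le_mul_of_nonneg_right (G.overlap.bound i l _ _ hu hη ?_ hr) (norm_nonneg _)
    rw [mul_div_cancel_left₀ _ hu0]
    exact hw i hi

/-- If the weights `w i` have sum `0` for `|U| > R₀`, then the estimate on the differences of the
functions `y i l` shows that `∑ i, w i * y i l (uU, u)` decays like `exp (-B |U|^p)`. -/
theorem norm_sum_mul_y_le_exp {w : ι → ℂ} {U u : ℂ} (hw : ∀ i, w i ≠ 0 → U ∈ G.W i)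
    (hw0 : G.R₀ < ‖U‖ → ∑ i, w i = 0) {l : κ} (hu : u ∈ G.S l) (hη : ‖u‖ < G.η₀)
    (hr : ‖u * U‖ < G.r') :
    ‖∑ i, w i * G.y i l (u * U) u‖ ≤
      (G.C + G.K * Real.exp (B * G.R₀ ^ p)) * (∑ i, ‖w i‖) * Real.exp (-(B * ‖U‖ ^ p)) := by
  have hu0 := G.overlap.ne_zero l u hu
  have hs : 0 ≤ ∑ i, ‖w i‖ := Finset.sum_nonneg fun i _ => norm_nonneg _
  have hC := G.hC
  have hK := G.hK
  have hB := G.hB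
  have hUdiv : u * U / u = U := mul_div_cancel_left₀ _ hu0
  rcases lt_or_ge G.R₀ ‖U‖ with h | h
  · by_cases h0 : ∀ i, w i = 0
    · simp [h0]
    · push Not at h0
      obtain ⟨i₀, hi₀⟩ := h0
      have h1 : ∑ i, w i * G.y i l (u * U) u =
          ∑ i, w i * (G.y i l (u * U) u - G.y i₀ l (u * U) u) := by
        simp_rw [mul_sub]
        rw [Finset.sum_sub_distrib, ← Finset.sum_mul, hw0 h, zero_mul, sub_zero]
      rw [h1]
      have h2 : ‖∑ i, w i * (G.y i l (u * U) u - G.y i₀ l (u * U) u)‖ ≤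
          ∑ i, ‖w i‖ * (G.C * Real.exp (-(B * ‖U‖ ^ p))) := by
        refine (norm_sum_le _ _).trans (Finset.sum_le_sum fun i _ => ?_)
        rw [norm_mul]
        by_cases hi : w i = 0
        · rw [hi, norm_zero, zero_mul, zero_mul]
        · refine mul_le_mul_of_nonneg_left ?_ (norm_nonneg _)
          have := G.overlap.fast i i₀ l (u * U) u hu hη (by rw [hUdiv]; exact hw i hi)
            (by rw [hUdiv]; exact hw i₀ hi₀) (by rwa [hUdiv]) hr
          rwa [hUdiv] at this
      rw [← Finset.sum_mul] at h2
      refine h2.trans ?_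
      have h3 : 0 ≤ G.K * Real.exp (B * G.R₀ ^ p) * (∑ i, ‖w i‖) * Real.exp (-(B * ‖U‖ ^ p)) := by
        positivity
      nlinarith [h3]
  · refine (G.norm_sum_mul_y_le hw hu hη hr).trans ?_
    have h1 : 1 ≤ Real.exp (B * G.R₀ ^ p) * Real.exp (-(B * ‖U‖ ^ p)) := by
      rw [← Real.exp_add]
      apply Real.one_le_exp
      have : ‖U‖ ^ p ≤ G.R₀ ^ p := pow_le_pow_left₀ (norm_nonneg _) h p
      nlinarith
    calc G.K * ∑ i, ‖w i‖ ≤ G.K * (∑ i, ‖w i‖) *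
          (Real.exp (B * G.R₀ ^ p) * Real.exp (-(B * ‖U‖ ^ p))) :=
        le_mul_of_one_le_right (by positivity) h1
      _ ≤ G.C * (∑ i, ‖w i‖) * Real.exp (-(B * ‖U‖ ^ p)) + G.K * (∑ i, ‖w i‖) *
          (Real.exp (B * G.R₀ ^ p) * Real.exp (-(B * ‖U‖ ^ p))) :=
        le_add_of_nonneg_left (by positivity)
      _ = _ := by ring

theorem norm_sum_mul_y_sub_le {w : ι → ℂ} {U u : ℂ} (hw : ∀ i, w i ≠ 0 → U ∈ G.W i) {l m : κ}
    (hu : u ∈ G.S l) (hu' : u ∈ G.S m) (hη : ‖u‖ < G.η₀) (hr : ‖u * U‖ < G.r') :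
    ‖∑ i, w i * G.y i l (u * U) u - ∑ i, w i * G.y i m (u * U) u‖ ≤
      G.C * (∑ i, ‖w i‖) * Real.exp (-(A / ‖u‖ ^ p)) := by
  have hu0 := G.overlap.ne_zero l u hu
  rw [← Finset.sum_sub_distrib, mul_right_comm, Finset.mul_sum]
  refine (norm_sum_le _ _).trans (Finset.sum_le_sum fun i _ => ?_)
  rw [← mul_sub, norm_mul, mul_comm]
  by_cases hi : w i = 0
  · rw [hi, norm_zero, mul_zero, mul_zero]
  · refine mul_le_mul_of_nonneg_right (G.overlap.slow i l m _ _ hu hu' hη ?_ hr) (norm_nonneg _)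
    rw [mul_div_cancel_left₀ _ hu0]
    exact hw i hi

/-- In the domain of the cutoff functions, the function `y i l (uU, u)` is holomorphic in `u`. -/
theorem eventually_differentiableAt {U u : ℂ} {i : ι} {l : κ} (hU : U ∈ G.W i) (hu : u ∈ G.S l)
    (hη : ‖u‖ < G.η₀) (hr : ‖u * U‖ < G.r') :
    ∀ᶠ v in 𝓝 u, DifferentiableAt ℂ (fun v => G.y i l (v * U) v) v := by
  filter_upwards [(G.overlap.isOpen_S l).mem_nhds hu,
    (isOpen_lt continuous_norm continuous_const).mem_nhds hη,
    (isOpen_lt (f := fun v : ℂ => ‖v * U‖) (by fun_prop) continuous_const).mem_nhds hr]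
    with v h1 h2 h3
  have h4 := G.overlap.holomorphic i l (v * U) v h1 h2
    (by rwa [mul_div_cancel_left₀ _ (G.overlap.ne_zero l v h1)]) h3
  exact h4.comp (f := fun v : ℂ => (v * U, v)) v (by fun_prop)

/-- Only the cutoff functions and the partition `χ` contribute to the `∂̄`-derivative in `u`, since
the functions `y i l (uU, u)` are holomorphic in `u`. -/
theorem contDiffAt_fibre {w : ι → ℂ} {U u : ℂ} (hw : ∀ i, w i ≠ 0 → U ∈ G.W i) (hu : u ≠ 0) :
    ContDiffAt ℝ 1 (G.fibre w U) u ∧ dbar (G.fibre w U) u =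
      dbar (fun v => G.k₁ v * G.k₂ (v * U)) u * (∑ l, G.χ l u * ∑ i, w i * G.y i l (u * U) u) +
      G.k₁ u * G.k₂ (u * U) * (∑ l, dbar (G.χ l) u * ∑ i, w i * G.y i l (u * U) u) := by
  set k : ℂ → ℂ := fun v => G.k₁ v * G.k₂ (v * U) with hk
  have hkc : ContDiff ℝ 1 k :=
    G.k₁_contDiff.mul (G.k₂_contDiff.comp (contDiff_id.mul contDiff_const))
  have h1 : G.fibre w U = fun v => ∑ l, ∑ i, (k v * G.χ l v * w i) * G.y i l (v * U) v := by
    ext v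
    simp only [fibre, Finset.mul_sum, hk]
    refine Finset.sum_congr rfl fun l _ => Finset.sum_congr rfl fun i _ => by ring
  have h2 : ∀ l i, ContDiffAt ℝ 1 (fun v => (k v * G.χ l v * w i) * G.y i l (v * U) v) u ∧
      dbar (fun v => (k v * G.χ l v * w i) * G.y i l (v * U) v) u =
        dbar (fun v => k v * G.χ l v * w i) u * G.y i l (u * U) u := by
    intro l i
    have hζ : ContDiffAt ℝ 1 (fun v => k v * G.χ l v * w i) u :=
      (hkc.contDiffAt.mul (G.χ_contDiffAt l u hu)).mul contDiffAt_const
    refine contDiffAt_mul_of_holomorphic hζ ?_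
    by_cases hi : w i = 0
    · left; simp only [hi, mul_zero]; rfl
    rcases G.χ_subordinate l u hu with hS | hS
    swap
    · left
      filter_upwards [hS] with v hv
      rw [hv]; ring
    rcases lt_or_ge G.η₁ ‖u‖ with h3 | h3
    · left
      filter_upwards [G.k₁_eventually_zero h3] with v hv
      simp only [hk, hv]; ring
    rcases lt_or_ge G.r₂ ‖u * U‖ with h4 | h4
    · left
      have h5 : ContinuousAt (fun v : ℂ => v * U) u := by fun_prop
      filter_upwards [h5.eventually (G.k₂_eventually_zero h4)] with v hv
      simp only [hk, hv]; ring
    · right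
      exact G.eventually_differentiableAt (hw i hi) hS (h3.trans_lt G.hη₀) (h4.trans_lt G.hr')
  refine ⟨?_, ?_⟩
  · rw [h1]
    exact ContDiffAt.sum fun l _ => ContDiffAt.sum fun i _ => (h2 l i).1
  · have h3 : ∀ l i, dbar (fun v => k v * G.χ l v * w i) u =
        (dbar k u * G.χ l u + k u * dbar (G.χ l) u) * w i := by
      intro l i
      have hkd := hkc.contDiffAt.differentiableAt (x := u) one_ne_zero
      have hχd := (G.χ_contDiffAt l u hu).differentiableAt one_ne_zero
      rw [dbar_mul (f := fun v => k v * G.χ l v) (hkd.mul hχd) (differentiableAt_const _),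
        dbar_mul hkd hχd, dbar_const]
      ring
    rw [h1, dbar_sum Finset.univ fun l _ => ((ContDiffAt.sum fun i _ =>
      (h2 l i).1).differentiableAt one_ne_zero), Finset.mul_sum, Finset.mul_sum,
      ← Finset.sum_add_distrib]
    refine Finset.sum_congr rfl fun l _ => ?_
    rw [dbar_sum Finset.univ fun i _ => ((h2 l i).1.differentiableAt one_ne_zero),
      Finset.mul_sum, Finset.mul_sum, Finset.mul_sum, Finset.mul_sum, ← Finset.sum_add_distrib]
    refine Finset.sum_congr rfl fun i _ => ?_
    rw [(h2 l i).2, h3]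
    ring

theorem fibre_eq_zero (w : ι → ℂ) (U : ℂ) {u : ℂ} (hu : G.η₁ ≤ ‖u‖ ∨ G.r₂ ≤ ‖u * U‖) :
    G.fibre w U u = 0 := by
  rcases hu with hu | hu
  · simp [fibre, G.k₁_zero u hu]
  · simp [fibre, G.k₂_zero _ hu]

theorem norm_sum_χ_mul_le {u : ℂ} (hu : u ≠ 0) {f : κ → ℂ} {c : ℝ}
    (hf : ∀ l, u ∈ G.S l → ‖f l‖ ≤ c) : ‖∑ l, G.χ l u * f l‖ ≤ Fintype.card κ * c := by
  obtain ⟨l₀, hl₀⟩ := G.exists_mem_S hu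
  have hc : 0 ≤ c := (norm_nonneg _).trans (hf l₀ hl₀)
  refine (norm_sum_le _ _).trans ((Finset.sum_le_card_nsmul _ _ c fun l _ => ?_).trans ?_)
  · rw [norm_mul]
    by_cases h : G.χ l u = 0
    · rw [h, norm_zero, zero_mul]; exact hc
    · calc _ ≤ 1 * c := mul_le_mul (G.χ_norm l u) (hf l (G.mem_S_of_χ_ne_zero hu h))
            (norm_nonneg _) zero_le_one
        _ = c := one_mul c
  · rw [Finset.card_univ, nsmul_eq_mul]

/-- Since the derivatives of the `χ l` have sum `0`, only the differences of the `f l` matter. -/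
theorem norm_sum_dbar_χ_mul_le {u : ℂ} (hu : u ≠ 0) {f : κ → ℂ} {c : ℝ}
    (hf : ∀ l m, u ∈ G.S l → u ∈ G.S m → ‖f l - f m‖ ≤ c) :
    ‖∑ l, dbar (G.χ l) u * f l‖ ≤ Fintype.card κ * (G.Cχ / ‖u‖ * c) := by
  obtain ⟨l₀, hl₀⟩ := G.exists_mem_S hu
  have hc : 0 ≤ c := (norm_nonneg _).trans (hf l₀ l₀ hl₀ hl₀)
  have h1 : ∑ l, dbar (G.χ l) u * f l = ∑ l, dbar (G.χ l) u * (f l - f l₀) := by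
    simp_rw [mul_sub]
    rw [Finset.sum_sub_distrib, ← Finset.sum_mul, G.sum_dbar_χ hu, zero_mul, sub_zero]
  rw [h1]
  have hCχ := G.Cχ_nonneg
  refine (norm_sum_le _ _).trans
    ((Finset.sum_le_card_nsmul _ _ (G.Cχ / ‖u‖ * c) fun l _ => ?_).trans ?_)
  · rw [norm_mul]
    by_cases h : dbar (G.χ l) u = 0
    · rw [h, norm_zero, zero_mul]; positivity
    · exact mul_le_mul ((norm_dbar_le _ _).trans (G.χ_fderiv l u hu))
        (hf l l₀ (G.mem_S_of_dbar_χ_ne_zero hu h) hl₀) (norm_nonneg _) (by positivity)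
  · rw [Finset.card_univ, nsmul_eq_mul]

theorem norm_fibre_le {w : ι → ℂ} {U u : ℂ} (hw : ∀ i, w i ≠ 0 → U ∈ G.W i) (hu : u ≠ 0) :
    ‖G.fibre w U u‖ ≤ Fintype.card κ * (G.K * ∑ i, ‖w i‖) := by
  have hs : 0 ≤ ∑ i, ‖w i‖ := Finset.sum_nonneg fun i _ => norm_nonneg _
  have hK := G.hK
  rcases le_or_gt G.η₁ ‖u‖ with h | h
  · rw [G.fibre_eq_zero w U (Or.inl h), norm_zero]; positivity
  rcases le_or_gt G.r₂ ‖u * U‖ with h' | h'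
  · rw [G.fibre_eq_zero w U (Or.inr h'), norm_zero]; positivity
  unfold fibre
  rw [norm_mul, norm_mul]
  calc _ ≤ 1 * 1 * (Fintype.card κ * (G.K * ∑ i, ‖w i‖)) := by
        gcongr
        · exact G.k₁_norm u
        · exact G.k₂_norm _
        · exact G.norm_sum_χ_mul_le hu fun l hl => G.norm_sum_mul_y_le hw hl
            (h.trans G.hη₀) (h'.trans G.hr')
    _ = _ := by ring

/-- The exponential decay of the `∂̄`-derivatives of glued functions: `exp (-Ã / |u|^p)` with
`Ã = min A (B r₀^p)`, and `exp (-B |U|^p)` if this is smaller. -/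
noncomputable def decay (_G : GluingData ι κ p A B r₀) (U u : ℂ) : ℝ :=
  Real.exp (-max (min A (B * r₀ ^ p) / ‖u‖ ^ p) (B * ‖U‖ ^ p))

theorem decay_nonneg (U u : ℂ) : 0 ≤ G.decay U u := (Real.exp_pos _).le

/-- For `|u|` bounded below the decay in `η` is merely a constant. -/
theorem exp_neg_le_decay (G : GluingData ι κ p A B r₀) {U u : ℂ} (h : G.η₂ ≤ ‖u‖) :
    Real.exp (-(B * ‖U‖ ^ p)) ≤
      Real.exp (min A (B * r₀ ^ p) / G.η₂ ^ p) * G.decay U u := by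
  have h1 := G.min_pos
  have h2 := G.hη₂
  have h3 := G.hB
  exact exp_neg_le_mul_exp_neg_max (by gcongr) (by positivity) (by positivity)

/-- Where the cutoff in `x` is not constant, `|x| ≥ r₀`, and the decay in `x / η` gives decay
in `η`. -/
theorem exp_neg_eq_decay (G : GluingData ι κ p A B r₀) {U u : ℂ} (hu : u ≠ 0)
    (h : r₀ ≤ ‖u * U‖) : Real.exp (-(B * ‖U‖ ^ p)) = G.decay U u := by
  have hB := G.hB
  have hr := G.hr₀
  have hu' : 0 < ‖u‖ := norm_pos_iff.2 hu
  rw [decay, max_eq_right]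
  rw [div_le_iff₀ (by positivity)]
  refine (min_le_right _ _).trans ?_
  rw [mul_assoc, ← mul_pow, mul_comm ‖U‖, ← norm_mul]
  gcongr

/-- The cutoff in `u` is not constant only for `|u| ≥ η₂`, that in `uU` only for `|uU| ≥ r₁ > r₀`.
In both regions the decay in `U` implies the full decay. -/
theorem norm_dbar_cut_le {U u : ℂ} (hu : u ≠ 0) (h1 : ‖u‖ ≤ G.η₁) (h2 : ‖u * U‖ ≤ G.r₂) :
    ‖dbar (fun v => G.k₁ v * G.k₂ (v * U)) u‖ * Real.exp (-(B * ‖U‖ ^ p)) ≤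
      (G.C₁ * G.η₁ * Real.exp (min A (B * r₀ ^ p) / G.η₂ ^ p) + G.C₂ * G.r₂) *
        (‖u‖⁻¹ * G.decay U u) := by
  have hu' : 0 < ‖u‖ := norm_pos_iff.2 hu
  have hd := G.decay_nonneg U u
  have hC₁ := G.C₁_nonneg
  have hC₂ := G.C₂_nonneg
  have hη := G.η₁_pos
  have hk : (fun v => G.k₂ (v * U)) = fun v => G.k₂ (U * v) := by
    ext v; rw [mul_comm]
  have hd2 : DifferentiableAt ℝ (fun v => G.k₂ (v * U)) u :=
    (G.k₂_contDiff.differentiable one_ne_zero _).comp (f := fun v : ℂ => v * U) u (by fun_prop)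
  rw [dbar_mul (G.k₁_contDiff.differentiable one_ne_zero _) hd2, add_mul]
  have e1 : ‖dbar G.k₁ u * G.k₂ (u * U)‖ * Real.exp (-(B * ‖U‖ ^ p)) ≤
      G.C₁ * G.η₁ * Real.exp (min A (B * r₀ ^ p) / G.η₂ ^ p) * (‖u‖⁻¹ * G.decay U u) := by
    rcases lt_or_ge ‖u‖ G.η₂ with h | h
    · rw [dbar_eq_zero_of_fderiv_eq_zero (G.k₁_fderiv_zero u h), zero_mul, norm_zero, zero_mul]
      positivity
    · have h3 : ‖dbar G.k₁ u * G.k₂ (u * U)‖ ≤ G.C₁ * 1 := by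
        rw [norm_mul]
        exact mul_le_mul ((norm_dbar_le _ _).trans (G.k₁_fderiv u)) (G.k₂_norm _)
          (norm_nonneg _) hC₁
      have h4 : 1 ≤ G.η₁ * ‖u‖⁻¹ := by
        rw [← div_eq_mul_inv, one_le_div hu']; exact h1
      calc _ ≤ (G.C₁ * 1) * (Real.exp (min A (B * r₀ ^ p) / G.η₂ ^ p) * G.decay U u) :=
            mul_le_mul h3 (G.exp_neg_le_decay h) (Real.exp_pos _).le (by positivity)
        _ = (G.C₁ * (Real.exp (min A (B * r₀ ^ p) / G.η₂ ^ p) * G.decay U u)) * 1 := by ring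
        _ ≤ (G.C₁ * (Real.exp (min A (B * r₀ ^ p) / G.η₂ ^ p) * G.decay U u)) *
            (G.η₁ * ‖u‖⁻¹) := mul_le_mul_of_nonneg_left h4 (by positivity)
        _ = _ := by ring
  have e2 : ‖G.k₁ u * dbar (fun v => G.k₂ (v * U)) u‖ * Real.exp (-(B * ‖U‖ ^ p)) ≤
      G.C₂ * G.r₂ * (‖u‖⁻¹ * G.decay U u) := by
    have hr₂ := G.r₂_pos
    have h5 : ‖dbar (fun v => G.k₂ (v * U)) u‖ ≤ ‖U‖ * ‖fderiv ℝ G.k₂ (U * u)‖ := by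
      rw [hk]
      exact (norm_dbar_le _ _).trans
        (norm_fderiv_comp_const_mul_le (G.k₂_contDiff.differentiable one_ne_zero _))
    rcases lt_or_ge ‖u * U‖ G.r₁ with h | h
    · rw [mul_comm] at h
      rw [G.k₂_fderiv_zero _ h, norm_zero, mul_zero] at h5
      rw [norm_le_zero_iff.1 h5, mul_zero, norm_zero, zero_mul]
      positivity
    · rw [G.exp_neg_eq_decay hu (G.hr₁.le.trans h), norm_mul]
      have h6 : ‖U‖ ≤ G.r₂ * ‖u‖⁻¹ := by
        rw [← div_eq_mul_inv, le_div_iff₀ hu', mul_comm, ← norm_mul]; exact h2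
      calc _ ≤ 1 * (G.r₂ * ‖u‖⁻¹ * G.C₂) * G.decay U u := by
            gcongr
            · exact G.k₁_norm u
            · exact h5.trans (mul_le_mul h6 (G.k₂_fderiv _) (norm_nonneg _) (by positivity))
        _ = _ := by ring
  calc _ ≤ (‖dbar G.k₁ u * G.k₂ (u * U)‖ + ‖G.k₁ u * dbar (fun v => G.k₂ (v * U)) u‖) *
        Real.exp (-(B * ‖U‖ ^ p)) := by
        gcongr; exact norm_add_le _ _
    _ ≤ _ := by rw [add_mul]; exact add_le_add e1 e2

/-- The constant of `norm_dbar_fibre_le`. -/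
noncomputable def fibreConst : ℝ :=
  Fintype.card κ * ((G.C₁ * G.η₁ * Real.exp (min A (B * r₀ ^ p) / G.η₂ ^ p) + G.C₂ * G.r₂) *
    (G.C + G.K * Real.exp (B * G.R₀ ^ p)) +
    G.Cχ * (2 * (G.C + G.K * Real.exp (B * G.R₀ ^ p)) + G.C))

theorem fibreConst_nonneg : 0 ≤ G.fibreConst := by
  have h1 := G.C₁_nonneg
  have h2 := G.C₂_nonneg
  have h3 := G.η₁_pos
  have h4 := G.r₂_pos
  have h5 := G.Cχ_nonneg
  have h6 := G.hC
  have h7 := G.hK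
  unfold fibreConst
  positivity

/-- The `∂̄`-derivative of a glued function is exponentially small: the weights have sum `0` for
large `U`, the derivatives of the partition `χ` have sum `0`, and the derivatives of the cutoff
functions live where `|u|` or `|uU|` is bounded below. -/
theorem norm_dbar_fibre_le {w : ι → ℂ} {U u : ℂ} (hw : ∀ i, w i ≠ 0 → U ∈ G.W i)
    (hw0 : G.R₀ < ‖U‖ → ∑ i, w i = 0) (hu : u ≠ 0) :
    ‖dbar (G.fibre w U) u‖ ≤ G.fibreConst * (∑ i, ‖w i‖) * (‖u‖⁻¹ * G.decay U u) := by
  have hs : 0 ≤ ∑ i, ‖w i‖ := Finset.sum_nonneg fun i _ => norm_nonneg _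
  have hu' : 0 < ‖u‖ := norm_pos_iff.2 hu
  have hd := G.decay_nonneg U u
  have hF := G.fibreConst_nonneg
  have hC := G.hC
  have hK := G.hK
  have hCχ := G.Cχ_nonneg
  rcases lt_or_ge G.η₁ ‖u‖ with h | h
  · rw [dbar_eq_zero_of_norm (fun v hv => G.fibre_eq_zero w U (Or.inl (le_of_lt hv))) h, norm_zero]
    positivity
  rcases lt_or_ge G.r₂ ‖u * U‖ with h' | h'
  · have h1 : G.fibre w U =ᶠ[𝓝 u] fun _ => 0 := by
      have h2 : ContinuousAt (fun v : ℂ => ‖v * U‖) u := by fun_prop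
      filter_upwards [h2.eventually (lt_mem_nhds h')] with v hv
      exact G.fibre_eq_zero w U (Or.inr hv.le)
    rw [dbar_congr h1, dbar_const, norm_zero]
    positivity
  rw [(G.contDiffAt_fibre hw hu).2]
  have hη := h.trans_lt G.hη₀
  have hr := h'.trans_lt G.hr'
  set Q := G.C + G.K * Real.exp (B * G.R₀ ^ p) with hQ
  have hQ0 : 0 ≤ Q := by positivity
  set W := ∑ i, ‖w i‖ with hW
  have e1 : ‖∑ l, G.χ l u * ∑ i, w i * G.y i l (u * U) u‖ ≤
      Fintype.card κ * (Q * W * Real.exp (-(B * ‖U‖ ^ p))) :=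
    G.norm_sum_χ_mul_le hu fun l hl => G.norm_sum_mul_y_le_exp hw hw0 hl hη hr
  have e2 : ‖∑ l, dbar (G.χ l) u * ∑ i, w i * G.y i l (u * U) u‖ ≤
      Fintype.card κ * (G.Cχ / ‖u‖ * ((2 * Q + G.C) * W * G.decay U u)) := by
    refine G.norm_sum_dbar_χ_mul_le hu fun l m hl hm => ?_
    have h1 := G.norm_sum_mul_y_sub_le hw hl hm hη hr
    have h2 := (norm_sub_le _ _).trans (add_le_add (G.norm_sum_mul_y_le_exp hw hw0 hl hη hr)
      (G.norm_sum_mul_y_le_exp hw hw0 hm hη hr))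
    rw [← hQ, ← hW] at h2
    rw [← hW] at h1
    rw [decay, exp_neg_max_eq_min]
    rcases min_cases (Real.exp (-(min A (B * r₀ ^ p) / ‖u‖ ^ p))) (Real.exp (-(B * ‖U‖ ^ p)))
      with ⟨h3, -⟩ | ⟨h3, -⟩
    · rw [h3]
      refine h1.trans ?_
      have h4 : Real.exp (-(A / ‖u‖ ^ p)) ≤ Real.exp (-(min A (B * r₀ ^ p) / ‖u‖ ^ p)) := by
        rw [Real.exp_le_exp, neg_le_neg_iff]
        gcongr
        exact min_le_left _ _
      gcongr
      linarith
    · rw [h3]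
      refine h2.trans ?_
      have : 0 ≤ G.C * W * Real.exp (-(B * ‖U‖ ^ p)) := by positivity
      linarith
  have e3 := G.norm_dbar_cut_le hu h h'
  set P := ‖dbar (fun v => G.k₁ v * G.k₂ (v * U)) u‖ with hP
  calc _ ≤ P * (Fintype.card κ * (Q * W * Real.exp (-(B * ‖U‖ ^ p)))) +
        1 * 1 * (Fintype.card κ * (G.Cχ / ‖u‖ * ((2 * Q + G.C) * W * G.decay U u))) := by
        refine (norm_add_le _ _).trans ?_
        rw [norm_mul, norm_mul, norm_mul]
        gcongr
        · exact G.k₁_norm u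
        · exact G.k₂_norm _
    _ = (Fintype.card κ * (Q * W)) * (P * Real.exp (-(B * ‖U‖ ^ p))) +
        Fintype.card κ * (G.Cχ / ‖u‖ * ((2 * Q + G.C) * W * G.decay U u)) := by ring
    _ ≤ (Fintype.card κ * (Q * W)) *
        ((G.C₁ * G.η₁ * Real.exp (min A (B * r₀ ^ p) / G.η₂ ^ p) + G.C₂ * G.r₂) *
        (‖u‖⁻¹ * G.decay U u)) +
        Fintype.card κ * (G.Cχ / ‖u‖ * ((2 * Q + G.C) * W * G.decay U u)) := by gcongr
    _ = _ := by rw [fibreConst, ← hQ]; ring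

theorem exists_norm_fibre_le {w : ι → ℂ} {U : ℂ} (hw : ∀ i, w i ≠ 0 → U ∈ G.W i) :
    ∃ K : ℝ, ∀ u, ‖G.fibre w U u‖ ≤ K := by
  refine ⟨max (Fintype.card κ * (G.K * ∑ i, ‖w i‖)) ‖G.fibre w U 0‖, fun u => ?_⟩
  rcases eq_or_ne u 0 with rfl | hu
  · exact le_max_right _ _
  · exact (G.norm_fibre_le hw hu).trans (le_max_left _ _)

/-! ### The three glued functions -/

/-- The `∂̄`-derivative, with respect to `X`, of the glued function, up to the contribution of the
cutoff in `x = ηX`. -/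
noncomputable def fastDbar (U u : ℂ) : ℂ := G.fibre (fun i => dbar (G.ψ i) U) U u

/-- The difference, in the coordinates `X = x / η`, `η`, of the functions with index `j` (glued
with respect to the index `l`) and the glued function. -/
noncomputable def fastDiff [DecidableEq ι] (j : ι) (X u : ℂ) : ℂ :=
  G.fibre (fun i => (if i = j then 1 else 0) - G.ψ i X) X u

/-- The glued function in the coordinates `x`, `η`, with the cutoff in `η` only. -/
noncomputable def slowGlued (x u : ℂ) : ℂ :=
  G.k₁ u * ∑ l, G.χ l u * ∑ i, G.ψ i (x / u) * G.y i l x u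

theorem sum_norm_dbar_ψ_le (U : ℂ) :
    ∑ i, ‖dbar (G.ψ i) U‖ ≤ Fintype.card ι * G.Cψ / (1 + ‖U‖) := by
  refine (Finset.sum_le_card_nsmul _ _ _ fun i _ =>
    (norm_dbar_le _ _).trans (G.ψ_fderiv i U)).trans ?_
  rw [Finset.card_univ, nsmul_eq_mul, mul_div_assoc]

theorem differentiableAt_y_left {i : ι} {l : κ} {x u : ℂ} (hu : u ∈ G.S l) (hη : ‖u‖ < G.η₀)
    (hx : x / u ∈ G.W i) (hr : ‖x‖ < G.r') : DifferentiableAt ℂ (fun x => G.y i l x u) x :=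
  (G.overlap.holomorphic i l x u hu hη hx hr).comp (f := fun x : ℂ => (x, u)) x (by fun_prop)

/-- A product `ζ U * y i l (uU, u)` is continuous in `U` if the first factor vanishes identically
near the points where the second is not known to be holomorphic. -/
theorem continuous_mul_y {i : ι} {l : κ} {u : ℂ} {ζ : ℂ → ℂ} (hζ : Continuous ζ)
    (hu : u ∈ G.S l) (hη : ‖u‖ < G.η₀)
    (h : ∀ U, U ∉ G.W i ∨ G.r' ≤ ‖u * U‖ → ζ =ᶠ[𝓝 U] fun _ => 0) :
    Continuous fun U => ζ U * G.y i l (u * U) u := by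
  rw [continuous_iff_continuousAt]
  intro U
  by_cases hU : U ∉ G.W i ∨ G.r' ≤ ‖u * U‖
  · have h1 : (fun U => ζ U * G.y i l (u * U) u) =ᶠ[𝓝 U] fun _ => 0 := by
      filter_upwards [h U hU] with V hV
      rw [hV, zero_mul]
    exact continuousAt_const.congr h1.symm
  · push Not at hU
    refine hζ.continuousAt.mul ?_
    have h1 := (G.differentiableAt_y_left (i := i) (x := u * U) hu hη
      (by rw [mul_div_cancel_left₀ _ (G.overlap.ne_zero l u hu)]; exact hU.1) hU.2).continuousAt
    exact ContinuousAt.comp (f := fun U : ℂ => u * U) h1 (by fun_prop)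

theorem continuous_fastDbar {u : ℂ} (hu : u ≠ 0) : Continuous fun U => G.fastDbar U u := by
  unfold fastDbar fibre
  rcases le_or_gt G.η₁ ‖u‖ with h | h
  · simp only [G.k₁_zero u h, zero_mul]; exact continuous_const
  have h1 : (fun U => G.k₁ u * G.k₂ (u * U) * ∑ l, G.χ l u * ∑ i, dbar (G.ψ i) U *
      G.y i l (u * U) u) = fun U => ∑ l, ∑ i, G.k₁ u * G.χ l u *
        ((G.k₂ (u * U) * dbar (G.ψ i) U) * G.y i l (u * U) u) := by
    ext U
    simp only [Finset.mul_sum]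
    refine Finset.sum_congr rfl fun l _ => Finset.sum_congr rfl fun i _ => by ring
  rw [h1]
  refine continuous_finsetSum _ fun l _ => continuous_finsetSum _ fun i _ => ?_
  by_cases hl : G.χ l u = 0
  · simp only [hl, mul_zero, zero_mul]; exact continuous_const
  refine continuous_const.mul (G.continuous_mul_y ?_ (G.mem_S_of_χ_ne_zero hu hl)
    (h.trans G.hη₀) fun U hU => ?_)
  · exact (G.k₂_contDiff.continuous.comp (continuous_const.mul continuous_id)).mul
      (continuous_dbar (G.ψ_contDiff i))
  · rcases hU with hU | hU
    · have h2 := (G.ψ_subordinate i U).resolve_left hU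
      filter_upwards [eventually_eventually_nhds.2 h2] with V hV
      rw [dbar_congr (g := fun _ => 0) hV, dbar_const, mul_zero]
    · have h2 : ContinuousAt (fun V : ℂ => u * V) U := by fun_prop
      filter_upwards [h2.eventually (G.k₂_eventually_zero (G.hr'.trans_le hU))] with V hV
      rw [hV, zero_mul]

/-- The weights `dbar (ψ i) U` have sum `0` for `U ∈ Ω` and are `O(1 / (1 + |U|))`. -/
theorem isFlatFamily_fastDbar : IsFlatFamily p (min A (B * r₀ ^ p)) B
    (G.fibreConst * (Fintype.card ι * G.Cψ)) G.η₁ G.fastDbar where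
  contDiffAt U u hu := (G.contDiffAt_fibre (fun _ => G.mem_W_of_dbar_ψ_ne_zero) hu).1
  bounded U := G.exists_norm_fibre_le fun _ => G.mem_W_of_dbar_ψ_ne_zero
  support U u hu := G.fibre_eq_zero _ _ (Or.inl (le_of_lt hu))
  dbar_le U u hu := by
    refine (G.norm_dbar_fibre_le (fun _ => G.mem_W_of_dbar_ψ_ne_zero)
      (fun hU => G.sum_dbar_ψ (G.mem_Ω U hU)) hu).trans ?_
    have h1 := G.sum_norm_dbar_ψ_le U
    have h2 := G.fibreConst_nonneg
    have h3 := G.decay_nonneg U u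
    calc _ ≤ G.fibreConst * (Fintype.card ι * G.Cψ / (1 + ‖U‖)) * (‖u‖⁻¹ * G.decay U u) := by
          gcongr
      _ = _ := by rw [decay]; ring
  measurable u hu := (G.continuous_fastDbar hu).measurable

/-- The weights `δ_{ij} - ψ i X` have sum `0`. -/
theorem isFlatGlued_fastDiff [DecidableEq ι] {j : ι} {X : ℂ} (hX : X ∈ G.W j) (hΩ : X ∈ G.Ω) :
    IsFlatGlued p (min A (B * r₀ ^ p)) (B * ‖X‖ ^ p)
      (G.fibreConst * (1 + Fintype.card ι * 2) *
        (min A (B * r₀ ^ p) / G.η₁ ^ p) ^ (-(1 / 4) : ℝ)) (G.fastDiff j X) := by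
  have hF := G.fibreConst_nonneg
  have hw : ∀ i, (if i = j then 1 else 0) - G.ψ i X ≠ 0 → X ∈ G.W i := by
    intro i hi
    by_cases hij : i = j
    · rwa [hij]
    · rw [if_neg hij, zero_sub, neg_ne_zero] at hi
      exact G.mem_W_of_ψ_ne_zero hi
  refine IsFlatGlued.of_bound G.min_pos (by positivity) G.η₁_pos
    (fun u hu => (G.contDiffAt_fibre hw hu).1) (G.exists_norm_fibre_le hw)
    (fun u hu => G.fibre_eq_zero _ _ (Or.inl (le_of_lt hu))) fun u hu => ?_
  have hw0 : ∑ i, ((if i = j then 1 else 0) - G.ψ i X) = 0 := by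
    rw [Finset.sum_sub_distrib, G.ψ_sum X hΩ]; simp
  refine (G.norm_dbar_fibre_le hw (fun _ => hw0) hu).trans ?_
  have h3 := G.decay_nonneg X u
  have h4 : ∑ i, ‖(if i = j then 1 else 0) - G.ψ i X‖ ≤ 1 + Fintype.card ι * 2 := by
    calc _ ≤ ∑ i, (‖(if i = j then 1 else 0 : ℂ)‖ + 2) :=
          Finset.sum_le_sum fun i _ => (norm_sub_le _ _).trans (by gcongr; exact G.ψ_norm i X)
      _ = _ := by
          rw [Finset.sum_add_distrib]
          simp [apply_ite norm]
  calc _ ≤ G.fibreConst * (1 + Fintype.card ι * 2) * (‖u‖⁻¹ * G.decay X u) := by gcongr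
    _ = _ := by rw [decay]

end GluingData

/-! ### The contribution of the cutoff in the slow variable -/

theorem norm_fderiv_comp_div_le {ψ : ℂ → ℂ} {x u : ℂ} (hu : u ≠ 0)
    (hψ : DifferentiableAt ℝ ψ (x / u)) :
    ‖fderiv ℝ (fun v => ψ (x / v)) u‖ ≤ ‖fderiv ℝ ψ (x / u)‖ * (‖x‖ / ‖u‖ ^ 2) := by
  have h1 : HasDerivAt (fun v : ℂ => x / v) (-x / u ^ 2) u := by
    have := (hasDerivAt_inv hu).const_mul x
    simpa [div_eq_mul_inv] using this
  have h2 := h1.hasFDerivAt.restrictScalars ℝ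
  have h3 := hψ.hasFDerivAt.comp u h2
  have h4 : fderiv ℝ (fun v => ψ (x / v)) u = _ := h3.fderiv
  rw [h4]
  refine (ContinuousLinearMap.opNorm_comp_le _ _).trans ?_
  gcongr
  refine ContinuousLinearMap.opNorm_le_bound _ (by positivity) fun v => ?_
  simp only [ContinuousLinearMap.coe_restrictScalars', ContinuousLinearMap.toSpanSingleton_apply,
    smul_eq_mul, norm_mul, norm_div, norm_neg, norm_pow]
  rw [mul_comm]

theorem dbar_comp_const_mul {k : ℂ → ℂ} {c u : ℂ} (hk : DifferentiableAt ℝ k (c * u)) :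
    dbar (fun v => k (c * v)) u = (starRingEnd ℂ) c * dbar k (c * u) := by
  have h1 : HasFDerivAt (fun v : ℂ => c * v) (ContinuousLinearMap.mul ℝ ℂ c) u :=
    (ContinuousLinearMap.mul ℝ ℂ c).hasFDerivAt
  have h2 := hk.hasFDerivAt.comp u h1
  have h3 : fderiv ℝ (fun v => k (c * v)) u = _ := h2.fderiv
  unfold dbar
  rw [h3]
  simp only [ContinuousLinearMap.comp_apply, ContinuousLinearMap.mul_apply', mul_one]
  set D := fderiv ℝ k (c * u)
  have e1 : c = c.re • (1 : ℂ) + c.im • Complex.I := by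
    apply Complex.ext <;> simp
  have e2 : c * Complex.I = c.re • Complex.I + (-c.im) • (1 : ℂ) := by
    apply Complex.ext <;> simp
  have e3 : (starRingEnd ℂ) c = c.re - c.im * Complex.I := by
    apply Complex.ext <;> simp
  have e4 : D c = c.re * D 1 + c.im * D Complex.I := by
    conv_lhs => rw [e1, map_add, map_smul, map_smul]
    simp only [Complex.real_smul]
  rw [e2, e3, e4, map_add, map_smul, map_smul]
  simp only [Complex.real_smul, Complex.ofReal_neg]
  linear_combination ((c.im : ℂ) / 2 * D Complex.I) * Complex.I_mul_I

theorem integral_comp_const_mul {c : ℂ} (hc : c ≠ 0) (f : ℂ → ℂ) :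
    ∫ u : ℂ, f (c * u) = (((‖c‖ ^ 2)⁻¹ : ℝ) : ℂ) * ∫ u : ℂ, f u := by
  have h1 : LinearMap.det (LinearMap.mulLeft ℝ c) = ‖c‖ ^ 2 := by
    have := Algebra.norm_complex_apply c
    rw [Algebra.norm_apply, Complex.normSq_eq_norm_sq] at this
    exact this
  have hd : LinearMap.det (LinearMap.mulLeft ℝ c) ≠ 0 := by
    rw [h1]; exact pow_ne_zero 2 (norm_ne_zero_iff.2 hc)
  have h2 := Measure.map_linearMap_addHaar_eq_smul_addHaar (volume : Measure ℂ) hd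
  rw [h1, abs_of_nonneg (by positivity)] at h2
  have h3 : MeasurableEmbedding (fun u : ℂ => c * u) :=
    (Homeomorph.mulLeft₀ c hc).measurableEmbedding
  have h4 : Measure.map (fun u : ℂ => c * u) volume =
      ENNReal.ofReal (‖c‖ ^ 2)⁻¹ • volume := h2
  rw [← h3.integral_map (μ := volume) f, h4, integral_smul_measure,
    ENNReal.toReal_ofReal (by positivity), Complex.real_smul]

theorem integrable_div_sub {h : ℂ → ℂ} (hc : Continuous h) {R : ℝ}
    (hs : ∀ u, R < ‖u‖ → h u = 0) (z : ℂ) : Integrable fun u => h u / (u - z) := by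
  obtain ⟨K, hK⟩ := (hasCompactSupport_of_norm hs).exists_bound_of_continuous hc
  have h1 : IntegrableOn (fun u => h u / (u - z)) (Metric.closedBall 0 R) := by
    refine Integrable.mono' ((integrableOn_inv_norm_sub z R).const_mul K)
      (hc.measurable.div (measurable_id.sub_const z)).aestronglyMeasurable
      (ae_of_all _ fun u => ?_)
    rw [norm_div, div_eq_mul_inv]
    gcongr
    exact hK u
  refine h1.integrable_of_forall_notMem_eq_zero fun u hu => ?_
  rw [hs u (by simpa using hu), zero_div]

namespace GluingData

variable {ι κ : Type*} [Fintype ι] [Fintype κ] {p : ℕ} {A B r₀ : ℝ} (G : GluingData ι κ p A B r₀)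

/-- The contribution of the cutoff in `x` to the `∂̄`-derivative of the glued function. -/
noncomputable def slowDbar (x u : ℂ) : ℂ := dbar G.k₂ x * G.slowGlued x u

theorem slowDbar_eq_zero {x u : ℂ} (h : G.η₁ ≤ ‖u‖ ∨ ‖x‖ < G.r₁ ∨ G.r₂ < ‖x‖) :
    G.slowDbar x u = 0 := by
  rcases h with h | h | h
  · simp [slowDbar, slowGlued, G.k₁_zero u h]
  · rw [slowDbar, dbar_eq_zero_of_fderiv_eq_zero (G.k₂_fderiv_zero x h), zero_mul]
  · rw [slowDbar, dbar_eq_zero_of_fderiv_eq_zero (G.k₂_fderiv_zero' x h), zero_mul]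

theorem contDiffAt_ψ_div (i : ι) (x : ℂ) {u : ℂ} (hu : u ≠ 0) :
    ContDiffAt ℝ 1 (fun v => G.ψ i (x / v)) u :=
  (G.ψ_contDiff i).contDiffAt.comp u
    ((contDiffAt_const (c := x)).mul (contDiffAt_inv ℝ hu) : ContDiffAt ℝ 1 (fun v => x * v⁻¹) u)

/-- In the coordinates `x`, `u` the partition `ψ` depends on `u` too, through `x / u`, and
contributes to the `∂̄`-derivative. -/
theorem contDiffAt_slowGlued {x u : ℂ} (hu : u ≠ 0) (hx : ‖x‖ ≤ G.r₂) :
    ContDiffAt ℝ 1 (G.slowGlued x) u ∧ dbar (G.slowGlued x) u =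
      dbar G.k₁ u * (∑ l, G.χ l u * ∑ i, G.ψ i (x / u) * G.y i l x u) +
      G.k₁ u * ((∑ l, dbar (G.χ l) u * ∑ i, G.ψ i (x / u) * G.y i l x u) +
        ∑ l, G.χ l u * ∑ i, dbar (fun v => G.ψ i (x / v)) u * G.y i l x u) := by
  have h1 : G.slowGlued x = fun v => ∑ l, ∑ i, (G.k₁ v * G.χ l v * G.ψ i (x / v)) *
      G.y i l x v := by
    ext v
    simp only [slowGlued, Finset.mul_sum]
    refine Finset.sum_congr rfl fun l _ => Finset.sum_congr rfl fun i _ => by ring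
  have h2 : ∀ l i, ContDiffAt ℝ 1 (fun v => (G.k₁ v * G.χ l v * G.ψ i (x / v)) * G.y i l x v) u ∧
      dbar (fun v => (G.k₁ v * G.χ l v * G.ψ i (x / v)) * G.y i l x v) u =
        dbar (fun v => G.k₁ v * G.χ l v * G.ψ i (x / v)) u * G.y i l x u := by
    intro l i
    have hζ : ContDiffAt ℝ 1 (fun v => G.k₁ v * G.χ l v * G.ψ i (x / v)) u :=
      (G.k₁_contDiff.contDiffAt.mul (G.χ_contDiffAt l u hu)).mul (G.contDiffAt_ψ_div i x hu)
    refine contDiffAt_mul_of_holomorphic hζ ?_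
    have hdiv : ContinuousAt (fun v : ℂ => x / v) u := continuousAt_const.div continuousAt_id hu
    rcases G.χ_subordinate l u hu with hS | hS
    swap
    · left
      filter_upwards [hS] with v hv
      rw [hv]; ring
    rcases lt_or_ge G.η₁ ‖u‖ with h3 | h3
    · left
      filter_upwards [G.k₁_eventually_zero h3] with v hv
      rw [hv]; ring
    rcases G.ψ_subordinate i (x / u) with hW | hW
    swap
    · left
      filter_upwards [hdiv.eventually hW] with v hv
      rw [hv]; ring
    right
    filter_upwards [(G.overlap.isOpen_S l).mem_nhds hS,
      (isOpen_lt continuous_norm continuous_const).mem_nhds (h3.trans_lt G.hη₀),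
      hdiv.eventually ((G.overlap.isOpen_W i).mem_nhds hW)] with v h4 h5 h6
    exact (G.overlap.holomorphic i l x v h4 h5 h6 (hx.trans_lt G.hr')).comp
      (f := fun v : ℂ => (x, v)) v (by fun_prop)
  refine ⟨?_, ?_⟩
  · rw [h1]
    exact ContDiffAt.sum fun l _ => ContDiffAt.sum fun i _ => (h2 l i).1
  · have h3 : ∀ l i, dbar (fun v => G.k₁ v * G.χ l v * G.ψ i (x / v)) u =
        (dbar G.k₁ u * G.χ l u + G.k₁ u * dbar (G.χ l) u) * G.ψ i (x / u) +
        G.k₁ u * G.χ l u * dbar (fun v => G.ψ i (x / v)) u := by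
      intro l i
      have hkd := G.k₁_contDiff.contDiffAt.differentiableAt (x := u) one_ne_zero
      have hχd := (G.χ_contDiffAt l u hu).differentiableAt one_ne_zero
      rw [dbar_mul (f := fun v => G.k₁ v * G.χ l v) (hkd.mul hχd)
        ((G.contDiffAt_ψ_div i x hu).differentiableAt one_ne_zero), dbar_mul hkd hχd]
    rw [h1, dbar_sum Finset.univ fun l _ => ((ContDiffAt.sum fun i _ =>
      (h2 l i).1).differentiableAt one_ne_zero), ← Finset.sum_add_distrib, Finset.mul_sum,
      Finset.mul_sum, ← Finset.sum_add_distrib]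
    refine Finset.sum_congr rfl fun l _ => ?_
    rw [dbar_sum Finset.univ fun i _ => ((h2 l i).1.differentiableAt one_ne_zero)]
    simp only [Finset.mul_sum]
    rw [← Finset.sum_add_distrib, Finset.mul_sum, ← Finset.sum_add_distrib]
    refine Finset.sum_congr rfl fun i _ => ?_
    rw [(h2 l i).2, h3]
    ring

/-- A bound for the `∂̄`-derivative of `slowGlued x`. For `r₁ ≤ |x| ≤ r₂` the quotient `x / η` is
large, hence the derivatives of the functions `ψ i (x / η)` have sum `0` and multiply differences
which are exponentially small in `1 / |η|`. -/
theorem exists_norm_dbar_slowGlued_le : ∃ c, 0 ≤ c ∧ ∀ x u : ℂ, u ≠ 0 → ‖u‖ ≤ G.η₁ →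
    G.r₁ ≤ ‖x‖ → ‖x‖ ≤ G.r₂ → ‖dbar (G.slowGlued x) u‖ ≤
      c * (‖u‖⁻¹ * Real.exp (-(min A (B * r₀ ^ p) / ‖u‖ ^ p))) := by
  set Q := G.C + G.K * Real.exp (B * G.R₀ ^ p) with hQ
  have hC := G.hC
  have hK := G.hK
  have hCχ := G.Cχ_nonneg
  have hC₁ := G.C₁_nonneg
  have hη₁ := G.η₁_pos
  have hη₂ := G.hη₂
  have hmin := G.min_pos
  have hQ0 : 0 ≤ Q := by positivity
  set a := min A (B * r₀ ^ p) with ha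
  have hCψ : 0 ≤ Fintype.card ι * G.Cψ := by
    have h := (Finset.sum_nonneg fun i _ => norm_nonneg _).trans (G.sum_norm_dbar_ψ_le 0)
    rwa [norm_zero, add_zero, div_one] at h
  refine ⟨G.C₁ * (Fintype.card κ * (G.K * (Fintype.card ι * 2))) *
      (G.η₁ * Real.exp (a / G.η₂ ^ p)) +
    (Fintype.card κ * (G.Cχ * (G.C * (Fintype.card ι * 2))) +
      Fintype.card κ * (Q * (Fintype.card ι * G.Cψ))), by positivity, fun x u hu hu1 hx1 hx2 => ?_⟩
  have hu' : 0 < ‖u‖ := norm_pos_iff.2 hu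
  have hη := hu1.trans_lt G.hη₀
  have hux : u * (x / u) = x := by field_simp
  have hr : ‖u * (x / u)‖ < G.r' := by rw [hux]; exact hx2.trans_lt G.hr'
  set e := Real.exp (-(a / ‖u‖ ^ p)) with he
  -- The condition `R₀ * η₁ < r₁` makes `x / u` large where `k₂` is not constant.
  have hU : G.R₀ < ‖x / u‖ := by
    rw [norm_div, lt_div_iff₀ hu']
    calc G.R₀ * ‖u‖ ≤ G.R₀ * G.η₁ := mul_le_mul_of_nonneg_left hu1 G.hR₀.le
      _ < G.r₁ := G.hRη
      _ ≤ ‖x‖ := hx1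
  have hψW : ∀ i, G.ψ i (x / u) ≠ 0 → x / u ∈ G.W i := fun i => G.mem_W_of_ψ_ne_zero
  have hψs : ∑ i, ‖G.ψ i (x / u)‖ ≤ Fintype.card ι * 2 := by
    refine (Finset.sum_le_card_nsmul _ _ _ fun i _ => G.ψ_norm i (x / u)).trans ?_
    rw [Finset.card_univ, nsmul_eq_mul]
  have e1 : ‖∑ l, G.χ l u * ∑ i, G.ψ i (x / u) * G.y i l x u‖ ≤
      Fintype.card κ * (G.K * (Fintype.card ι * 2)) := by
    refine G.norm_sum_χ_mul_le hu fun l hl => ?_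
    have := G.norm_sum_mul_y_le hψW hl hη hr
    rw [hux] at this
    exact this.trans (mul_le_mul_of_nonneg_left hψs hK)
  have e1' : ‖dbar G.k₁ u‖ ≤ G.C₁ * (G.η₁ * Real.exp (a / G.η₂ ^ p)) * (‖u‖⁻¹ * e) := by
    rcases lt_or_ge ‖u‖ G.η₂ with h | h
    · rw [dbar_eq_zero_of_fderiv_eq_zero (G.k₁_fderiv_zero u h), norm_zero]; positivity
    · have h2 : 1 ≤ G.η₁ * ‖u‖⁻¹ := by
        rw [← div_eq_mul_inv, one_le_div hu']; exact hu1
      have h3 : 1 ≤ Real.exp (a / G.η₂ ^ p) * e := by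
        rw [he, ← Real.exp_add]
        apply Real.one_le_exp
        have : a / ‖u‖ ^ p ≤ a / G.η₂ ^ p := by gcongr
        linarith
      calc _ ≤ G.C₁ * (1 * 1) := by
            rw [one_mul, mul_one]; exact (norm_dbar_le _ _).trans (G.k₁_fderiv u)
        _ ≤ G.C₁ * ((G.η₁ * ‖u‖⁻¹) * (Real.exp (a / G.η₂ ^ p) * e)) :=
            mul_le_mul_of_nonneg_left (mul_le_mul h2 h3 zero_le_one (by positivity)) hC₁
        _ = _ := by ring
  have e2 : ‖∑ l, dbar (G.χ l) u * ∑ i, G.ψ i (x / u) * G.y i l x u‖ ≤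
      Fintype.card κ * (G.Cχ / ‖u‖ * (G.C * (Fintype.card ι * 2) * e)) := by
    refine G.norm_sum_dbar_χ_mul_le hu fun l m hl hm => ?_
    have := G.norm_sum_mul_y_sub_le hψW hl hm hη hr
    rw [hux] at this
    refine this.trans ?_
    have h4 : Real.exp (-(A / ‖u‖ ^ p)) ≤ e := by
      rw [he, Real.exp_le_exp, neg_le_neg_iff]
      gcongr
      exact min_le_left _ _
    gcongr
  have hdψ : ∀ i, ‖dbar (fun v => G.ψ i (x / v)) u‖ ≤ G.Cψ / ‖u‖ := by
    intro i
    have hCi := G.Cψ_nonneg i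
    refine (norm_dbar_le _ _).trans ((norm_fderiv_comp_div_le hu
      ((G.ψ_contDiff i).differentiable one_ne_zero _)).trans ?_)
    have h5 := G.ψ_fderiv i (x / u)
    calc _ ≤ G.Cψ / (1 + ‖x / u‖) * (‖x / u‖ / ‖u‖) := by
          refine mul_le_mul h5 (le_of_eq ?_) (by positivity) (by positivity)
          rw [norm_div]; field_simp
      _ = G.Cψ / ‖u‖ * (‖x / u‖ / (1 + ‖x / u‖)) := by ring
      _ ≤ G.Cψ / ‖u‖ * 1 := by
          refine mul_le_mul_of_nonneg_left ?_ (by positivity)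
          rw [div_le_one (by positivity)]
          linarith
      _ = _ := mul_one _
  have hdiv : ContinuousAt (fun v : ℂ => x / v) u := continuousAt_const.div continuousAt_id hu
  have hdψ0 : ∑ i, dbar (fun v => G.ψ i (x / v)) u = 0 := by
    refine dbar_sum_eq_zero (fun i => (G.contDiffAt_ψ_div i x hu).differentiableAt one_ne_zero)
      (c := 1) ?_
    filter_upwards [hdiv.eventually (G.isOpen_Ω.mem_nhds (G.mem_Ω _ hU))] with v hv
    exact G.ψ_sum _ hv
  have e3 : ‖∑ l, G.χ l u * ∑ i, dbar (fun v => G.ψ i (x / v)) u * G.y i l x u‖ ≤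
      Fintype.card κ * (Q * (Fintype.card ι * (G.Cψ / ‖u‖)) * e) := by
    refine G.norm_sum_χ_mul_le hu fun l hl => ?_
    have h6 : ∀ i, dbar (fun v => G.ψ i (x / v)) u ≠ 0 → x / u ∈ G.W i := by
      intro i hi
      refine (G.ψ_subordinate i (x / u)).resolve_right fun h => hi ?_
      rw [dbar_congr (g := fun _ => 0) (hdiv.eventually h), dbar_const]
    have := G.norm_sum_mul_y_le_exp h6 (fun _ => hdψ0) hl hη hr
    rw [hux] at this
    refine this.trans ?_
    have h7 : Real.exp (-(B * ‖x / u‖ ^ p)) ≤ e := by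
      rw [G.exp_neg_eq_decay hu (by rw [hux]; exact G.hr₁.le.trans hx1), he, decay,
        Real.exp_le_exp, neg_le_neg_iff]
      exact le_max_left _ _
    have h8 : ∑ i, ‖dbar (fun v => G.ψ i (x / v)) u‖ ≤ Fintype.card ι * (G.Cψ / ‖u‖) := by
      refine (Finset.sum_le_card_nsmul _ _ _ fun i _ => hdψ i).trans ?_
      rw [Finset.card_univ, nsmul_eq_mul]
    have h9 : 0 ≤ ∑ i, ‖dbar (fun v => G.ψ i (x / v)) u‖ :=
      Finset.sum_nonneg fun i _ => norm_nonneg _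
    gcongr
    exact mul_nonneg hQ0 (h9.trans h8)
  rw [(G.contDiffAt_slowGlued hu hx2).2]
  refine (norm_add_le _ _).trans ?_
  rw [norm_mul, norm_mul]
  calc _ ≤ (G.C₁ * (G.η₁ * Real.exp (a / G.η₂ ^ p)) * (‖u‖⁻¹ * e)) *
        (Fintype.card κ * (G.K * (Fintype.card ι * 2))) +
        1 * (Fintype.card κ * (G.Cχ / ‖u‖ * (G.C * (Fintype.card ι * 2) * e)) +
          Fintype.card κ * (Q * (Fintype.card ι * (G.Cψ / ‖u‖)) * e)) := by
        refine add_le_add (mul_le_mul e1' e1 (norm_nonneg _) (by positivity))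
          (mul_le_mul (G.k₁_norm u) ((norm_add_le _ _).trans (add_le_add e2 e3))
            (norm_nonneg _) zero_le_one)
    _ = _ := by ring

theorem continuous_slowDbar {u : ℂ} (hu : u ≠ 0) : Continuous fun x => G.slowDbar x u := by
  unfold slowDbar slowGlued
  rcases le_or_gt G.η₁ ‖u‖ with h | h
  · simp only [G.k₁_zero u h, zero_mul, mul_zero]; exact continuous_const
  have h1 : (fun x => dbar G.k₂ x * (G.k₁ u * ∑ l, G.χ l u * ∑ i, G.ψ i (x / u) * G.y i l x u)) =
      fun x => ∑ l, ∑ i, G.k₁ u * G.χ l u *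
        ((dbar G.k₂ (u * (x / u)) * G.ψ i (x / u)) * G.y i l (u * (x / u)) u) := by
    ext x
    have hux : u * (x / u) = x := by field_simp
    simp only [Finset.mul_sum, hux]
    refine Finset.sum_congr rfl fun l _ => Finset.sum_congr rfl fun i _ => by ring
  rw [h1]
  refine continuous_finsetSum _ fun l _ => continuous_finsetSum _ fun i _ => ?_
  by_cases hl : G.χ l u = 0
  · simp only [hl, mul_zero, zero_mul]; exact continuous_const
  refine continuous_const.mul ((G.continuous_mul_y (i := i)
    (ζ := fun U => dbar G.k₂ (u * U) * G.ψ i U) ?_ (G.mem_S_of_χ_ne_zero hu hl)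
    (h.trans G.hη₀) fun U hU => ?_).comp (continuous_id.div_const u))
  · exact ((continuous_dbar G.k₂_contDiff).comp (continuous_const.mul continuous_id)).mul
      (G.ψ_contDiff i).continuous
  · rcases hU with hU | hU
    · filter_upwards [(G.ψ_subordinate i U).resolve_left hU] with V hV
      rw [hV, mul_zero]
    · have h2 : ContinuousAt (fun V : ℂ => ‖u * V‖) U := by fun_prop
      filter_upwards [h2.eventually (lt_mem_nhds (G.hr'.trans_le hU))] with V hV
      rw [dbar_eq_zero_of_fderiv_eq_zero (G.k₂_fderiv_zero' _ hV), zero_mul]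

/-- On the support of `slowDbar` the variable `x` is bounded, so that any decay in `x` may be added
to the majorant. -/
theorem exists_isFlatFamily_slowDbar :
    ∃ c, 0 ≤ c ∧ IsFlatFamily p (min A (B * r₀ ^ p)) B c G.η₁ G.slowDbar := by
  obtain ⟨c, hc, hle⟩ := G.exists_norm_dbar_slowGlued_le
  have hC₂ := G.C₂_nonneg
  have hr₂ := G.r₂_pos
  have hB := G.hB
  have hmin := G.min_pos
  have hK := G.hK
  refine ⟨(G.C₂ * c * Real.exp (B * G.r₂ ^ p)) * (1 + G.r₂), by positivity,
    fun x u hu => ?_, fun x => ?_, fun x u hu => G.slowDbar_eq_zero (Or.inl hu.le),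
    fun x u hu => ?_, fun u hu => (G.continuous_slowDbar hu).measurable⟩
  · rcases le_or_gt ‖x‖ G.r₂ with h | h
    · exact contDiffAt_const.mul (G.contDiffAt_slowGlued hu h).1
    · have : G.slowDbar x = fun _ => 0 := by
        ext u; exact G.slowDbar_eq_zero (Or.inr (Or.inr h))
      rw [this]; exact contDiffAt_const
  · refine ⟨max (G.C₂ * (Fintype.card κ * (G.K * (Fintype.card ι * 2)))) ‖G.slowDbar x 0‖,
      fun u => ?_⟩
    rcases eq_or_ne u 0 with rfl | hu
    · exact le_max_right _ _
    refine le_trans ?_ (le_max_left _ _)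
    by_cases h : G.η₁ ≤ ‖u‖ ∨ ‖x‖ < G.r₁ ∨ G.r₂ < ‖x‖
    · rw [G.slowDbar_eq_zero h, norm_zero]; positivity
    · push Not at h
      have hux : u * (x / u) = x := by field_simp
      have e1 : ‖∑ l, G.χ l u * ∑ i, G.ψ i (x / u) * G.y i l x u‖ ≤
          Fintype.card κ * (G.K * (Fintype.card ι * 2)) := by
        refine G.norm_sum_χ_mul_le hu fun l hl => ?_
        have := G.norm_sum_mul_y_le (w := fun i => G.ψ i (x / u)) (U := x / u)
          (fun i => G.mem_W_of_ψ_ne_zero) hl (h.1.trans G.hη₀)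
          (by rw [hux]; exact h.2.2.trans_lt G.hr')
        rw [hux] at this
        refine this.trans (mul_le_mul_of_nonneg_left ?_ hK)
        refine (Finset.sum_le_card_nsmul _ _ _ fun i _ => G.ψ_norm i (x / u)).trans ?_
        rw [Finset.card_univ, nsmul_eq_mul]
      rw [slowDbar, slowGlued, norm_mul, norm_mul]
      calc _ ≤ G.C₂ * (1 * (Fintype.card κ * (G.K * (Fintype.card ι * 2)))) := by
            gcongr
            · exact (norm_dbar_le _ _).trans (G.k₂_fderiv x)
            · exact G.k₁_norm u
        _ = _ := by ring
  · by_cases h : G.η₁ < ‖u‖ ∨ ‖x‖ < G.r₁ ∨ G.r₂ < ‖x‖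
    · have h0 : dbar (G.slowDbar x) u = 0 := by
        rcases h with h | h
        · exact dbar_eq_zero_of_norm (fun v hv => G.slowDbar_eq_zero (Or.inl hv.le)) h
        · have : G.slowDbar x = fun _ => 0 := by
            ext u; exact G.slowDbar_eq_zero (Or.inr h)
          rw [this, dbar_const]
      rw [h0, norm_zero]; positivity
    · push Not at h
      have h1 : dbar (G.slowDbar x) u = dbar G.k₂ x * dbar (G.slowGlued x) u := by
        change dbar (fun v => dbar G.k₂ x * G.slowGlued x v) u = _
        rw [dbar_mul (differentiableAt_const _)
          ((G.contDiffAt_slowGlued hu h.2.2).1.differentiableAt one_ne_zero), dbar_const]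
        ring
      have h2 : Real.exp (-(min A (B * r₀ ^ p) / ‖u‖ ^ p)) ≤ Real.exp (B * G.r₂ ^ p) *
          Real.exp (-max (min A (B * r₀ ^ p) / ‖u‖ ^ p) (B * ‖x‖ ^ p)) := by
        rw [max_comm]
        have := h.2.2
        exact exp_neg_le_mul_exp_neg_max (by gcongr) (by positivity) (by positivity)
      have h3 : 1 ≤ (1 + G.r₂) / (1 + ‖x‖) := by
        rw [one_le_div (by positivity)]; linarith [h.2.2]
      rw [h1, norm_mul]
      calc _ ≤ G.C₂ * (c * (‖u‖⁻¹ * Real.exp (-(min A (B * r₀ ^ p) / ‖u‖ ^ p)))) := by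
            refine mul_le_mul ((norm_dbar_le _ _).trans (G.k₂_fderiv x))
              (hle x u hu h.1 h.2.1 h.2.2) (norm_nonneg _) hC₂
        _ ≤ G.C₂ * (c * (‖u‖⁻¹ * (Real.exp (B * G.r₂ ^ p) *
            Real.exp (-max (min A (B * r₀ ^ p) / ‖u‖ ^ p) (B * ‖x‖ ^ p))))) * 1 := by
            rw [mul_one]; gcongr
        _ ≤ G.C₂ * (c * (‖u‖⁻¹ * (Real.exp (B * G.r₂ ^ p) *
            Real.exp (-max (min A (B * r₀ ^ p) / ‖u‖ ^ p) (B * ‖x‖ ^ p))))) *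
              ((1 + G.r₂) / (1 + ‖x‖)) := mul_le_mul_of_nonneg_left h3 (by positivity)
        _ = _ := by ring

/-- The Cauchy–Pompeiu formula for the glued function in the variable `X`, with parameter `η`. -/
theorem fibre_ψ_eq {X u : ℂ} (hu : u ≠ 0) : G.fibre (fun i => G.ψ i X) X u =
    cauchyTransform (fun U => G.fastDbar U u) X +
      cauchyTransform (fun x => G.slowDbar x u) (u * X) := by
  rcases le_or_gt G.η₁ ‖u‖ with h | h
  · rw [G.fibre_eq_zero _ _ (Or.inl h)]
    have h1 : (fun U => G.fastDbar U u) = fun _ => 0 := by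
      ext U; exact G.fibre_eq_zero _ _ (Or.inl h)
    have h2 : (fun x => G.slowDbar x u) = fun _ => 0 := by
      ext U; exact G.slowDbar_eq_zero (Or.inl h)
    rw [h1, h2]
    simp [cauchyTransform]
  have hu' : 0 < ‖u‖ := norm_pos_iff.2 hu
  set F : ℂ → ℂ := fun X => G.fibre (fun i => G.ψ i X) X u with hF
  have h1 : F = fun X => ∑ l, ∑ i, (G.k₁ u * G.χ l u * (G.k₂ (u * X) * G.ψ i X)) *
      G.y i l (u * X) u := by
    ext X
    simp only [hF, fibre, Finset.mul_sum]
    refine Finset.sum_congr rfl fun l _ => Finset.sum_congr rfl fun i _ => by ring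
  have hkd : ContDiff ℝ 1 fun X => G.k₂ (u * X) :=
    G.k₂_contDiff.comp (contDiff_const.mul contDiff_id)
  have hζ : ∀ l i, ContDiff ℝ 1 fun X => G.k₁ u * G.χ l u * (G.k₂ (u * X) * G.ψ i X) :=
    fun l i => contDiff_const.mul (hkd.mul (G.ψ_contDiff i))
  have h2 : ∀ X l i, ContDiffAt ℝ 1 (fun X => (G.k₁ u * G.χ l u * (G.k₂ (u * X) * G.ψ i X)) *
      G.y i l (u * X) u) X ∧
      dbar (fun X => (G.k₁ u * G.χ l u * (G.k₂ (u * X) * G.ψ i X)) * G.y i l (u * X) u) X =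
        dbar (fun X => G.k₁ u * G.χ l u * (G.k₂ (u * X) * G.ψ i X)) X * G.y i l (u * X) u := by
    intro X l i
    refine contDiffAt_mul_of_holomorphic (hζ l i).contDiffAt ?_
    by_cases hl : G.χ l u = 0
    · left; simp only [hl, mul_zero, zero_mul]; rfl
    have hmul : ContinuousAt (fun v : ℂ => u * v) X := by fun_prop
    rcases lt_or_ge G.r₂ ‖u * X‖ with h4 | h4
    · left
      filter_upwards [hmul.eventually (G.k₂_eventually_zero h4)] with v hv
      rw [hv]; ring
    rcases G.ψ_subordinate i X with hW | hW
    swap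
    · left
      filter_upwards [hW] with v hv
      rw [hv]; ring
    right
    have hS := G.mem_S_of_χ_ne_zero hu hl
    filter_upwards [(G.overlap.isOpen_W i).mem_nhds hW, (isOpen_lt (f := fun v : ℂ => ‖u * v‖)
      (by fun_prop) continuous_const).mem_nhds (h4.trans_lt G.hr')] with v h5 h6
    have := G.differentiableAt_y_left (i := i) (l := l) (x := u * v) hS (h.trans G.hη₀)
      (by rwa [mul_div_cancel_left₀ _ hu]) h6
    exact this.comp (f := fun v : ℂ => u * v) v (by fun_prop)
  have hFc : ContDiff ℝ 1 F := by
    rw [contDiff_iff_contDiffAt, h1]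
    intro X
    exact ContDiffAt.sum fun l _ => ContDiffAt.sum fun i _ => (h2 X l i).1
  have hsupp : ∀ X, G.r₂ / ‖u‖ < ‖X‖ → G.r₂ < ‖u * X‖ := fun X hX => by
    rwa [div_lt_iff₀ hu', mul_comm, ← norm_mul] at hX
  have hFs : ∀ X, G.r₂ / ‖u‖ < ‖X‖ → F X = 0 := fun X hX =>
    G.fibre_eq_zero _ _ (Or.inr (hsupp X hX).le)
  have hFd : ∀ U, dbar F U = G.fastDbar U u + (starRingEnd ℂ) u * G.slowDbar (u * U) u := by
    intro U
    have h3 : ∀ l i, dbar (fun X => G.k₁ u * G.χ l u * (G.k₂ (u * X) * G.ψ i X)) U =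
        G.k₁ u * G.χ l u * ((starRingEnd ℂ) u * dbar G.k₂ (u * U) * G.ψ i U +
          G.k₂ (u * U) * dbar (G.ψ i) U) := by
      intro l i
      have hk := hkd.contDiffAt.differentiableAt (x := U) one_ne_zero
      have hψ := (G.ψ_contDiff i).contDiffAt.differentiableAt (x := U) one_ne_zero
      rw [dbar_mul (f := fun _ => G.k₁ u * G.χ l u) (g := fun X => G.k₂ (u * X) * G.ψ i X)
          (differentiableAt_const _) (hk.mul hψ),
        dbar_const, dbar_mul hk hψ,
        dbar_comp_const_mul (G.k₂_contDiff.differentiable one_ne_zero _)]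
      ring
    rw [h1, dbar_sum Finset.univ fun l _ => ((ContDiffAt.sum fun i _ =>
      (h2 U l i).1).differentiableAt one_ne_zero), fastDbar, slowDbar, slowGlued, fibre]
    simp only [Finset.mul_sum]
    rw [← Finset.sum_add_distrib]
    refine Finset.sum_congr rfl fun l _ => ?_
    rw [dbar_sum Finset.univ fun i _ => ((h2 U l i).1.differentiableAt one_ne_zero),
      ← Finset.sum_add_distrib]
    refine Finset.sum_congr rfl fun i _ => ?_
    rw [(h2 U l i).2, h3, mul_div_cancel_left₀ _ hu]
    ring
  have h5 := cauchyPompeiu hFc (hasCompactSupport_of_norm hFs) X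
  have i1 : Integrable fun U => G.fastDbar U u / (U - X) :=
    integrable_div_sub (G.continuous_fastDbar hu)
      (fun U hU => G.fibre_eq_zero _ _ (Or.inr (hsupp U hU).le)) X
  have i2 : Integrable fun U => (starRingEnd ℂ) u * G.slowDbar (u * U) u / (U - X) :=
    integrable_div_sub (h := fun U => (starRingEnd ℂ) u * G.slowDbar (u * U) u)
      (continuous_const.mul ((G.continuous_slowDbar hu).comp
        (continuous_const.mul continuous_id)))
      (R := G.r₂ / ‖u‖) (fun U hU => by
        rw [G.slowDbar_eq_zero (Or.inr (Or.inr (hsupp U hU))), mul_zero]) X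
  have h6 : ∫ U : ℂ, (starRingEnd ℂ) u * G.slowDbar (u * U) u / (U - X) =
      ∫ x : ℂ, G.slowDbar x u / (x - u * X) := by
    have h7 : (fun U : ℂ => (starRingEnd ℂ) u * G.slowDbar (u * U) u / (U - X)) =
        fun U => ((‖u‖ ^ 2 : ℝ) : ℂ) * (G.slowDbar (u * U) u / (u * U - u * X)) := by
      ext U
      have h8 : ((‖u‖ ^ 2 : ℝ) : ℂ) = (starRingEnd ℂ) u * u := by
        rw [mul_comm, Complex.mul_conj, Complex.normSq_eq_norm_sq]
      rw [h8, ← mul_sub]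
      field_simp
    rw [h7, integral_const_mul,
      integral_comp_const_mul hu (fun x => G.slowDbar x u / (x - u * X)), ← mul_assoc,
      ← Complex.ofReal_mul, mul_inv_cancel₀ (by positivity), Complex.ofReal_one, one_mul]
  calc F X = _ := h5
    _ = -(Real.pi : ℂ)⁻¹ * ((∫ U, G.fastDbar U u / (U - X)) +
        ∫ U, (starRingEnd ℂ) u * G.slowDbar (u * U) u / (U - X)) := by
        rw [← integral_add i1 i2]
        congr 2
        ext U
        rw [hFd, add_div]
    _ = _ := by rw [h6, mul_add]; rfl

end GluingData

/-! ### Exponentially small terms and parameters away from the origin -/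

/-- Exponentially small functions have the null series as Gevrey expansion of the same type. -/
theorem exp_neg_div_pow_le {A t : ℝ} {p : ℕ} (hA : 0 < A) (hp : 0 < p) (ht : 0 < t) (N : ℕ) :
    Real.exp (-(A / t ^ p)) ≤ A ^ (-(N : ℝ) / p) * Real.Gamma ((N : ℝ) / p + 1) * t ^ N := by
  have h := rpow_mul_exp_neg_le_Gamma (s := (N : ℝ) / p) (t := A / t ^ p) (by positivity)
    (by positivity)
  rw [rpow_div_eq_inv_pow hA hp ht] at h
  have h1 : A ^ (-(N : ℝ) / p) * A ^ ((N : ℝ) / p) = 1 := by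
    rw [← Real.rpow_add hA, neg_div, neg_add_cancel, Real.rpow_zero]
  have h2 : 0 < A ^ (-(N : ℝ) / p) := Real.rpow_pos_of_pos hA _
  have h3 : 0 < t ^ N := pow_pos ht N
  calc Real.exp (-(A / t ^ p)) =
        A ^ (-(N : ℝ) / p) * (A ^ ((N : ℝ) / p) * (t ^ N)⁻¹ * Real.exp (-(A / t ^ p))) * t ^ N := by
        have : A ^ (-(N : ℝ) / p) * (A ^ ((N : ℝ) / p) * (t ^ N)⁻¹ * Real.exp (-(A / t ^ p))) *
          t ^ N = (A ^ (-(N : ℝ) / p) * A ^ ((N : ℝ) / p)) * Real.exp (-(A / t ^ p)) *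
            ((t ^ N)⁻¹ * t ^ N) := by ring
        rw [this, h1, inv_mul_cancel₀ h3.ne']; ring
    _ ≤ _ := by gcongr

theorem sum_range_pow_le {x : ℝ} (hx : 0 ≤ x) (N : ℕ) :
    ∑ n ∈ Finset.range N, x ^ n ≤ x ^ N + 2 ^ N := by
  have h0 : ∀ z : ℝ, 2 ≤ z → ∑ n ∈ Finset.range N, z ^ n ≤ z ^ N := by
    intro z hz
    induction N with
    | zero => simp
    | succ N ih =>
      rw [Finset.sum_range_succ, pow_succ]
      have : 0 ≤ z ^ N := by positivity
      nlinarith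
  rcases le_total 2 x with h | h
  · exact (h0 x h).trans (le_add_of_nonneg_right (by positivity))
  · calc _ ≤ ∑ n ∈ Finset.range N, (2 : ℝ) ^ n :=
          Finset.sum_le_sum fun n _ => pow_le_pow_left₀ hx h n
      _ ≤ 2 ^ N := h0 2 le_rfl
      _ ≤ _ := le_add_of_nonneg_left (by positivity)

theorem two_pow_le_mul_Gamma {p : ℕ} (hp : 0 < p) {t₀ t : ℝ} (ht₀ : 0 < t₀) (ht : t₀ ≤ t)
    (N : ℕ) : (2 : ℝ) ^ N ≤ Real.exp ((2 / t₀) ^ p) * (t ^ N * Real.Gamma ((N : ℝ) / p + 1)) := by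
  have h := rpow_mul_exp_neg_le_Gamma (s := (N : ℝ) / p) (t := 1 * (2 / t₀) ^ p) (by positivity)
    (by positivity)
  rw [mul_rpow_div_eq_pow one_pos hp (by positivity), Real.one_rpow, one_mul, one_mul, div_pow] at h
  have hG : 0 < Real.Gamma ((N : ℝ) / p + 1) := Real.Gamma_pos_of_pos (by positivity)
  rw [div_mul_eq_mul_div, div_le_iff₀ (by positivity), Real.exp_neg, ← div_eq_mul_inv,
    div_le_iff₀ (Real.exp_pos _)] at h
  calc _ ≤ _ := h
    _ = Real.exp ((2 / t₀) ^ p) * (t₀ ^ N * Real.Gamma ((N : ℝ) / p + 1)) := by ring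
    _ ≤ _ := by gcongr

/-- For `t` bounded below, the partial sums of the divergent series `∑ t^n Γ(n/p + 1)` are
dominated by the first omitted term. -/
theorem sum_pow_mul_Gamma_le {p : ℕ} (hp : 0 < p) {t₀ t : ℝ} (ht₀ : 0 < t₀) (ht : t₀ ≤ t)
    (N : ℕ) : ∑ n ∈ Finset.range N, t ^ n * Real.Gamma ((n : ℝ) / p + 1) ≤
      (1 + Real.exp ((2 / t₀) ^ p)) * (t ^ N * Real.Gamma ((N : ℝ) / p + 1)) := by
  have ht' : 0 < t := ht₀.trans_le ht
  have hint : ∀ n : ℕ, IntegrableOn (fun x : ℝ => Real.exp (-x) * x ^ ((n : ℝ) / p + 1 - 1))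
      (Ioi 0) := fun n => Real.GammaIntegral_convergent (by positivity)
  have hG : ∀ n : ℕ, t ^ n * Real.Gamma ((n : ℝ) / p + 1) =
      ∫ x in Ioi (0 : ℝ), t ^ n * (Real.exp (-x) * x ^ ((n : ℝ) / p + 1 - 1)) := fun n => by
    rw [Real.Gamma_eq_integral (by positivity), integral_const_mul]
  have hexp : ∫ x in Ioi (0 : ℝ), Real.exp (-x) = 1 := by
    rw [integral_Ioi_exp_neg, neg_zero, Real.exp_zero]
  have hexpi : IntegrableOn (fun x : ℝ => Real.exp (-x)) (Ioi 0) := by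
    have := hint 0
    simpa using this
  have h1 : ∑ n ∈ Finset.range N, t ^ n * Real.Gamma ((n : ℝ) / p + 1) ≤
      t ^ N * Real.Gamma ((N : ℝ) / p + 1) + 2 ^ N := by
    calc _ = ∫ x in Ioi (0 : ℝ), ∑ n ∈ Finset.range N,
          t ^ n * (Real.exp (-x) * x ^ ((n : ℝ) / p + 1 - 1)) := by
          rw [integral_finsetSum _ fun n _ => (hint n).const_mul _]
          exact Finset.sum_congr rfl fun n _ => hG n
      _ ≤ ∫ x in Ioi (0 : ℝ), (t ^ N * (Real.exp (-x) * x ^ ((N : ℝ) / p + 1 - 1)) +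
          2 ^ N * Real.exp (-x)) := by
          refine setIntegral_mono_on (integrable_finsetSum _ fun n _ => (hint n).const_mul _)
            (((hint N).const_mul _).add (hexpi.const_mul _)) measurableSet_Ioi fun x hx => ?_
          have hx' : (0 : ℝ) ≤ x := le_of_lt hx
          have h2 : ∀ n : ℕ, t ^ n * (Real.exp (-x) * x ^ ((n : ℝ) / p + 1 - 1)) =
              Real.exp (-x) * (t * x ^ (1 / p : ℝ)) ^ n := fun n => by
            rw [add_sub_cancel_right, mul_pow, ← Real.rpow_natCast (x ^ (1 / p : ℝ)),
              ← Real.rpow_mul hx', one_div_mul_eq_div]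
            ring
          simp only [h2]
          rw [← Finset.mul_sum]
          have h3 := sum_range_pow_le (x := t * x ^ (1 / p : ℝ)) (by positivity) N
          nlinarith [Real.exp_pos (-x)]
      _ = _ := by
          rw [integral_add ((hint N).const_mul _) (hexpi.const_mul _), ← hG, integral_const_mul,
            hexp, mul_one]
  have h4 := two_pow_le_mul_Gamma hp ht₀ ht N
  linarith

/-- A bounded function satisfies a Gevrey remainder estimate, with respect to any series with
Gevrey bounds, as long as `|η|` is bounded below. -/
theorem exists_norm_sub_sum_le_of_le {p : ℕ} (hp : 0 < p) {A K t₀ : ℝ} (hA : 0 < A)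
    (ht₀ : 0 < t₀) (hK : 0 ≤ K) : ∃ C, 0 ≤ C ∧ ∀ (v η : ℂ) (c : ℕ → ℂ), ‖v‖ ≤ K → t₀ ≤ ‖η‖ →
      (∀ n : ℕ, ‖c n‖ ≤ K * (A ^ (-(n : ℝ) / p) * Real.Gamma ((n : ℝ) / p + 1))) → ∀ N : ℕ,
      ‖v - ∑ n ∈ Finset.range N, c n * η ^ n‖ ≤
        C * (A ^ (-(N : ℝ) / p) * Real.Gamma ((N : ℝ) / p + 1) * ‖η‖ ^ N) := by
  set q := A ^ (-(1 : ℝ) / p) with hq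
  have hq0 : 0 < q := Real.rpow_pos_of_pos hA _
  have hqn : ∀ n : ℕ, A ^ (-(n : ℝ) / p) = q ^ n := fun n => by
    rw [hq, ← Real.rpow_natCast, ← Real.rpow_mul hA.le]
    congr 1; ring
  set E := Real.exp ((2 / (q * t₀)) ^ p) with hE
  refine ⟨K * (1 + 2 * E), by positivity, fun v η c hv hη hc N => ?_⟩
  have ht : q * t₀ ≤ q * ‖η‖ := by gcongr
  have h1 := sum_pow_mul_Gamma_le hp (mul_pos hq0 ht₀) ht N
  have h2 := two_pow_le_mul_Gamma hp (mul_pos hq0 ht₀) ht N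
  have h3 : (1 : ℝ) ≤ 2 ^ N := one_le_pow₀ one_le_two
  have h4 : ‖∑ n ∈ Finset.range N, c n * η ^ n‖ ≤
      K * ∑ n ∈ Finset.range N, (q * ‖η‖) ^ n * Real.Gamma ((n : ℝ) / p + 1) := by
    rw [Finset.mul_sum]
    refine (norm_sum_le _ _).trans (Finset.sum_le_sum fun n _ => ?_)
    rw [norm_mul, norm_pow]
    calc _ ≤ K * (A ^ (-(n : ℝ) / p) * Real.Gamma ((n : ℝ) / p + 1)) * ‖η‖ ^ n := by
          gcongr; exact hc n
      _ = _ := by rw [hqn, mul_pow]; ring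
  rw [hqn]
  calc _ ≤ K * (E * ((q * ‖η‖) ^ N * Real.Gamma ((N : ℝ) / p + 1))) +
        K * ((1 + E) * ((q * ‖η‖) ^ N * Real.Gamma ((N : ℝ) / p + 1))) := by
        refine (norm_sub_le _ _).trans (add_le_add (hv.trans ?_) (h4.trans ?_))
        · exact le_mul_of_one_le_right hK (h3.trans h2)
        · gcongr
    _ = _ := by rw [mul_pow]; ring

/-! ### Holomorphy of Cauchy transforms -/

/-- By differentiation under the integral sign, away from the support of `h`. -/
theorem differentiableOn_cauchyTransform {h : ℂ → ℂ} (hm : Measurable h) {K r R : ℝ}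
    (hb : ∀ u, ‖h u‖ ≤ K) (hr : ∀ u, ‖u‖ < r → h u = 0) (hR : ∀ u, R < ‖u‖ → h u = 0) :
    DifferentiableOn ℂ (cauchyTransform h) (Metric.ball 0 r) := by
  intro x₀ hx₀
  rw [mem_ball_zero_iff] at hx₀
  set ε := (r - ‖x₀‖) / 2 with hε
  have hε0 : 0 < ε := by rw [hε]; linarith
  have hK : 0 ≤ K := (norm_nonneg _).trans (hb 0)
  have hdist : ∀ u, h u ≠ 0 → ∀ x ∈ Metric.ball x₀ ε, ε ≤ ‖u - x‖ := by
    intro u hu x hx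
    have h1 : r ≤ ‖u‖ := by
      by_contra hlt
      exact hu (hr u (not_le.1 hlt))
    have h2 : ‖x - x₀‖ < ε := by rwa [← dist_eq_norm]
    have h3 : ‖u‖ ≤ ‖u - x‖ + ‖x - x₀‖ + ‖x₀‖ := by
      calc ‖u‖ = ‖(u - x) + (x - x₀) + x₀‖ := by congr 1; ring
        _ ≤ _ := norm_add₃_le
    linarith
  set bound : ℂ → ℝ := (Metric.closedBall (0 : ℂ) R).indicator fun _ => K / ε ^ 2 with hbound
  have hmeas : ∀ x, AEStronglyMeasurable (fun u => h u / (u - x)) :=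
    fun x => (hm.div (measurable_id.sub_const x)).aestronglyMeasurable
  have hint : Integrable fun u => h u / (u - x₀) := by
    refine Integrable.mono' (g := (Metric.closedBall (0 : ℂ) R).indicator fun _ => K / ε) ?_
      (hmeas x₀) (ae_of_all _ fun u => ?_)
    · exact (integrable_indicator_iff measurableSet_closedBall).2
        (integrableOn_const (isCompact_closedBall _ _).measure_lt_top.ne)
    · by_cases hu : u ∈ Metric.closedBall (0 : ℂ) R
      · rw [indicator_of_mem hu, norm_div]
        by_cases h0 : h u = 0
        · rw [h0, norm_zero, zero_div]; positivity
        · have := hdist u h0 x₀ (Metric.mem_ball_self hε0)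
          gcongr
          exact hb u
      · rw [indicator_of_notMem hu, hR u (by simpa using hu), zero_div, norm_zero]
  have key := hasDerivAt_integral_of_dominated_loc_of_deriv_le (μ := volume)
    (F := fun x u => h u / (u - x)) (F' := fun x u => h u / (u - x) ^ 2) (bound := bound)
    (x₀ := x₀) (Metric.ball_mem_nhds x₀ hε0) (Eventually.of_forall hmeas) hint
    (hm.div ((measurable_id.sub_const x₀).pow_const 2)).aestronglyMeasurable
    (ae_of_all _ fun u x hx => ?_) ?_ (ae_of_all _ fun u x hx => ?_)
  · exact (key.2.const_mul _).differentiableAt.differentiableWithinAt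
  · rw [hbound]
    by_cases hu : u ∈ Metric.closedBall (0 : ℂ) R
    · rw [indicator_of_mem hu, norm_div, norm_pow]
      by_cases h0 : h u = 0
      · rw [h0, norm_zero, zero_div]; positivity
      · have := hdist u h0 x hx
        gcongr
        exact hb u
    · rw [indicator_of_notMem hu, hR u (by simpa using hu), zero_div, norm_zero]
  · exact (integrable_indicator_iff measurableSet_closedBall).2
      (integrableOn_const (isCompact_closedBall _ _).measure_lt_top.ne)
  · by_cases h0 : h u = 0
    · simp only [h0, zero_div]
      exact hasDerivAt_const x 0
    · have hne : u - x ≠ 0 := norm_pos_iff.1 (hε0.trans_le (hdist u h0 x hx))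
      have h1 : HasDerivAt (fun x => u - x) (-1) x := by
        simpa using (hasDerivAt_id x).const_sub u
      have h2 := (h1.inv hne).const_mul (h u)
      simp only [neg_neg] at h2
      simpa [div_eq_mul_inv] using h2

namespace GluingData

variable {ι κ : Type*} [Fintype ι] [Fintype κ] {p : ℕ} {A B r₀ : ℝ}

/-! ### The coefficients of the combined expansion -/

/-- The coefficient `a n` of the slow part of the combined expansion. -/
noncomputable def slowCoeff (G : GluingData ι κ p A B r₀) (n : ℕ) (x : ℂ) : ℂ :=
  cauchyTransform (fun u => gevreyCoeff (G.slowDbar u) n) x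

/-- The coefficient `g n` of the fast part of the combined expansion of the functions with
index `j`. -/
noncomputable def fastCoeff [DecidableEq ι] (G : GluingData ι κ p A B r₀) (j : ι) (n : ℕ)
    (X : ℂ) : ℂ :=
  cauchyTransform (fun U => gevreyCoeff (G.fastDbar U) n) X + gevreyCoeff (G.fastDiff j X) n

/-- The coefficients of the asymptotic expansion of `fastCoeff j n` at infinity; they do not
depend on `j`. -/
noncomputable def fastMoment (G : GluingData ι κ p A B r₀) (n m : ℕ) : ℂ :=
  cauchyMoment (fun U => gevreyCoeff (G.fastDbar U) n) m

variable (G : GluingData ι κ p A B r₀)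

theorem fastConst_nonneg : 0 ≤ G.fibreConst * (Fintype.card ι * G.Cψ) := by
  have h := (Finset.sum_nonneg fun i _ => norm_nonneg _).trans (G.sum_norm_dbar_ψ_le 0)
  rw [norm_zero, add_zero, div_one] at h
  exact mul_nonneg G.fibreConst_nonneg h

theorem exists_norm_slowCoeff_le : ∃ C, 0 ≤ C ∧ ∀ n x, ‖G.slowCoeff n x‖ ≤
    C * (min A (B * r₀ ^ p) ^ (-(n : ℝ) / p) * Real.Gamma ((n : ℝ) / p + 1)) := by
  obtain ⟨c, hc, hE⟩ := G.exists_isFlatFamily_slowDbar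
  obtain ⟨C, hC, h, -⟩ := hE.exists_cauchyTransform_le G.min_pos G.hB G.hp hc G.η₁_pos
  exact ⟨C, hC, h⟩

theorem differentiableOn_slowCoeff (n : ℕ) :
    DifferentiableOn ℂ (G.slowCoeff n) (Metric.ball 0 G.r₁) := by
  obtain ⟨c, hc, hE⟩ := G.exists_isFlatFamily_slowDbar
  have hmin := G.min_pos
  have hη := G.η₁_pos
  have hG : 0 < Real.Gamma ((n : ℝ) / p + 1) := Real.Gamma_pos_of_pos (by positivity)
  have hzero : ∀ x, ‖x‖ < G.r₁ ∨ G.r₂ < ‖x‖ → gevreyCoeff (G.slowDbar x) n = 0 := by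
    intro x hx
    have h1 : G.slowDbar x = fun _ => 0 := by
      ext u; exact G.slowDbar_eq_zero (Or.inr hx)
    rw [h1, gevreyCoeff]
    simp [dbar_const]
  refine differentiableOn_cauchyTransform
    (hE.measurable_gevreyCoeff hmin G.hB G.hp hc hη n)
    (K := c * (min A (B * r₀ ^ p) / G.η₁ ^ p) ^ (-(1 / 4) : ℝ) *
      (100 * min A (B * r₀ ^ p) ^ (-(n : ℝ) / p) * Real.Gamma ((n : ℝ) / p + 1))) (R := G.r₂)
    (fun x => ?_) (fun x hx => hzero x (Or.inl hx)) (fun x hx => hzero x (Or.inr hx))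
  have hB := G.hB
  refine (norm_gevreyCoeff_le hmin G.hp (by positivity) (by positivity)
    (hE.isFlatGlued hmin hc hη x) n).trans ?_
  gcongr
  exact div_le_self hc (by linarith [norm_nonneg x])

theorem fastDiffConst_nonneg : 0 ≤ G.fibreConst * (1 + Fintype.card ι * 2) *
    (min A (B * r₀ ^ p) / G.η₁ ^ p) ^ (-(1 / 4) : ℝ) := by
  have h1 := G.fibreConst_nonneg
  have h2 := G.min_pos
  have h3 := G.η₁_pos
  positivity

variable [DecidableEq ι]

/-- The asymptotic expansion of the fast coefficients at infinity, with compatible Gevrey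
bounds. -/
theorem exists_fastCoeff_expansion : ∃ C, 0 ≤ C ∧ ∀ j n M X, X ∈ G.W j → X ∈ G.Ω →
    ‖X‖ ^ M * ‖G.fastCoeff j n X - ∑ m ∈ Finset.Ico 1 M, G.fastMoment n m * (X ^ m)⁻¹‖ ≤
      C * (min A (B * r₀ ^ p) ^ (-(n : ℝ) / p) * B ^ (-(M : ℝ) / p) *
        Real.Gamma (((M : ℝ) + n) / p + 1)) := by
  have hmin := G.min_pos
  have hB := G.hB
  obtain ⟨C₁, hC₁, h1, -⟩ := G.isFlatFamily_fastDbar.exists_cauchyTransform_le hmin hB G.hp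
    G.fastConst_nonneg G.η₁_pos
  obtain ⟨C₂, hC₂, h2⟩ := G.isFlatFamily_fastDbar.exists_cauchyMoment_le hmin hB G.hp
    G.fastConst_nonneg G.η₁_pos
  set a := min A (B * r₀ ^ p) with ha
  set c₃ := G.fibreConst * (1 + Fintype.card ι * 2) * (a / G.η₁ ^ p) ^ (-(1 / 4) : ℝ) with hc₃
  have hc₃0 : 0 ≤ c₃ := G.fastDiffConst_nonneg
  refine ⟨C₁ + C₂ + c₃ * 100, by positivity, fun j n M X hX hΩ => ?_⟩
  have hG : 0 < Real.Gamma (((M : ℝ) + n) / p + 1) := Real.Gamma_pos_of_pos (by positivity)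
  have hBM : B ^ (-(M : ℝ) / p) * B ^ ((M : ℝ) / p) = 1 := by
    rw [← Real.rpow_add hB, neg_div, neg_add_cancel, Real.rpow_zero]
  have hBM0 : 0 < B ^ (-(M : ℝ) / p) := Real.rpow_pos_of_pos hB _
  have e1 : ‖X‖ ^ M * ‖cauchyTransform (fun U => gevreyCoeff (G.fastDbar U) n) X -
      ∑ m ∈ Finset.Ico 1 M, G.fastMoment n m * (X ^ m)⁻¹‖ ≤
      (C₁ + C₂) * (a ^ (-(n : ℝ) / p) * B ^ (-(M : ℝ) / p) *
        Real.Gamma (((M : ℝ) + n) / p + 1)) := by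
    have hnn : 0 ≤ a ^ (-(n : ℝ) / p) * B ^ (-(M : ℝ) / p) *
        Real.Gamma (((M : ℝ) + n) / p + 1) := by positivity
    rw [add_mul]
    -- For `M = 0` the expansion at infinity says that the function is bounded.
    rcases Nat.eq_zero_or_pos M with rfl | hM
    · refine le_trans ?_ (le_add_of_nonneg_right (mul_nonneg hC₂ hnn))
      simpa using h1 n X
    · exact (h2 n M hM X).trans (le_add_of_nonneg_left (mul_nonneg hC₁ hnn))
  have e2 : ‖X‖ ^ M * ‖gevreyCoeff (G.fastDiff j X) n‖ ≤
      c₃ * 100 * (a ^ (-(n : ℝ) / p) * B ^ (-(M : ℝ) / p) *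
        Real.Gamma (((M : ℝ) + n) / p + 1)) := by
    have h3 := rpow_mul_norm_gevreyCoeff_le hmin G.hp (by positivity) hc₃0
      (G.isFlatGlued_fastDiff hX hΩ) n M
    -- This is an equality for `X ≠ 0`; for `X = 0` and `M = 0` both sides contain `0 ^ 0 = 1`.
    have h4 : ‖X‖ ^ M ≤ B ^ (-(M : ℝ) / p) * (B * ‖X‖ ^ p) ^ ((M : ℝ) / p) := by
      rcases eq_or_ne X 0 with rfl | hX0
      · rcases Nat.eq_zero_or_pos M with rfl | hM
        · simp
        · rw [norm_zero, zero_pow hM.ne']; positivity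
      · rw [mul_rpow_div_eq_pow hB G.hp (norm_pos_iff.2 hX0), ← mul_assoc, hBM, one_mul]
    calc _ ≤ B ^ (-(M : ℝ) / p) * (B * ‖X‖ ^ p) ^ ((M : ℝ) / p) *
          ‖gevreyCoeff (G.fastDiff j X) n‖ := by gcongr
      _ = B ^ (-(M : ℝ) / p) * ((B * ‖X‖ ^ p) ^ ((M : ℝ) / p) *
          ‖gevreyCoeff (G.fastDiff j X) n‖) := mul_assoc _ _ _
      _ ≤ B ^ (-(M : ℝ) / p) * (c₃ * (100 * a ^ (-(n : ℝ) / p) *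
          Real.Gamma (((M : ℝ) + n) / p + 1))) := by gcongr
      _ = _ := by ring
  calc _ ≤ ‖X‖ ^ M * (‖cauchyTransform (fun U => gevreyCoeff (G.fastDbar U) n) X -
      ∑ m ∈ Finset.Ico 1 M, G.fastMoment n m * (X ^ m)⁻¹‖ +
        ‖gevreyCoeff (G.fastDiff j X) n‖) := by
        gcongr
        rw [fastCoeff, add_sub_right_comm]
        exact norm_add_le _ _
    _ ≤ _ := by rw [mul_add, add_mul _ (c₃ * 100)]; exact add_le_add e1 e2

/-- Each function of the family is, up to an exponentially small error, the sum of a function of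
`X = x / η`, of a function of `x`, and of the correction `fastDiff`. -/
theorem norm_y_sub_le {j : ι} {l : κ} {X u : ℂ} (hu : u ∈ G.S l) (hη : ‖u‖ ≤ G.η₂)
    (hX : X ∈ G.W j) (hr : ‖u * X‖ ≤ G.r₁) :
    ‖G.y j l (u * X) u - (cauchyTransform (fun U => G.fastDbar U u) X +
      cauchyTransform (fun x => G.slowDbar x u) (u * X) + G.fastDiff j X u)‖ ≤
      Fintype.card κ * (G.C * Real.exp (-(A / ‖u‖ ^ p))) := by
  have hu0 := G.overlap.ne_zero l u hu
  have h1 : G.fibre (fun i => G.ψ i X) X u + G.fastDiff j X u =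
      ∑ m, G.χ m u * G.y j m (u * X) u := by
    rw [fastDiff, fibre, fibre, G.k₁_one u hη, G.k₂_one _ hr, one_mul, one_mul, one_mul,
      ← Finset.sum_add_distrib]
    refine Finset.sum_congr rfl fun m _ => ?_
    rw [← mul_add, ← Finset.sum_add_distrib]
    congr 1
    rw [Finset.sum_congr rfl fun i _ => show G.ψ i X * G.y i m (u * X) u +
      ((if i = j then 1 else 0) - G.ψ i X) * G.y i m (u * X) u =
        if i = j then G.y i m (u * X) u else 0 by split_ifs <;> ring]
    simp
  have h2 : G.y j l (u * X) u = ∑ m, G.χ m u * G.y j l (u * X) u := by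
    rw [← Finset.sum_mul, G.χ_sum u hu0, one_mul]
  rw [← G.fibre_ψ_eq hu0, h1, h2, ← Finset.sum_sub_distrib]
  simp_rw [← mul_sub]
  exact G.norm_sum_χ_mul_le hu0 fun m hm => G.overlap.slow j l m _ _ hu hm
    (hη.trans_lt (G.hη₁.trans G.hη₀)) (by rwa [mul_div_cancel_left₀ _ hu0])
    (hr.trans_lt (G.hr₂.trans G.hr'))

/-- The expansions of the two Cauchy transforms and of `fastDiff j` add up to the combined expansion
of `y j l`, for small `η`. -/
theorem exists_norm_y_sub_sum_le : ∃ C, 0 ≤ C ∧ ∀ j l X u, u ∈ G.S l → ‖u‖ ≤ G.η₂ →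
    X ∈ G.W j → X ∈ G.Ω → ‖u * X‖ ≤ G.r₁ → ∀ N : ℕ,
    ‖G.y j l (u * X) u -
        ∑ n ∈ Finset.range N, (G.slowCoeff n (u * X) + G.fastCoeff j n X) * u ^ n‖ ≤
      C * (min A (B * r₀ ^ p) ^ (-(N : ℝ) / p) * Real.Gamma ((N : ℝ) / p + 1) * ‖u‖ ^ N) := by
  have hmin := G.min_pos
  have hB := G.hB
  obtain ⟨C₁, hC₁, -, h1⟩ := G.isFlatFamily_fastDbar.exists_cauchyTransform_le hmin hB G.hp
    G.fastConst_nonneg G.η₁_pos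
  obtain ⟨c, hc, hE⟩ := G.exists_isFlatFamily_slowDbar
  obtain ⟨C₂, hC₂, -, h2⟩ := hE.exists_cauchyTransform_le hmin hB G.hp hc G.η₁_pos
  set a := min A (B * r₀ ^ p) with ha
  set c₃ := G.fibreConst * (1 + Fintype.card ι * 2) * (a / G.η₁ ^ p) ^ (-(1 / 4) : ℝ) with hc₃
  have hc₃0 : 0 ≤ c₃ := G.fastDiffConst_nonneg
  have hC := G.hC
  refine ⟨Fintype.card κ * G.C + C₁ + C₂ + c₃ * 400, by positivity,
    fun j l X u hu hη hX hΩ hr N => ?_⟩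
  have hu0 := G.overlap.ne_zero l u hu
  have e0 := G.norm_y_sub_le hu hη hX hr
  have e0' : Real.exp (-(A / ‖u‖ ^ p)) ≤
      a ^ (-(N : ℝ) / p) * Real.Gamma ((N : ℝ) / p + 1) * ‖u‖ ^ N := by
    refine le_trans ?_ (exp_neg_div_pow_le hmin G.hp (norm_pos_iff.2 hu0) N)
    rw [Real.exp_le_exp, neg_le_neg_iff]
    gcongr
    exact min_le_left _ _
  have e1 := h1 N X u hu0
  have e2 := h2 N (u * X) u hu0
  have e3 := norm_sub_sum_gevreyCoeff_le hmin G.hp (by positivity) hc₃0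
    (G.isFlatGlued_fastDiff hX hΩ) N hu0
  set T := a ^ (-(N : ℝ) / p) * Real.Gamma ((N : ℝ) / p + 1) * ‖u‖ ^ N with hT
  have e0'' : Fintype.card κ * (G.C * Real.exp (-(A / ‖u‖ ^ p))) ≤ Fintype.card κ * G.C * T := by
    rw [mul_assoc]; gcongr
  have hsplit : G.y j l (u * X) u -
      ∑ n ∈ Finset.range N, (G.slowCoeff n (u * X) + G.fastCoeff j n X) * u ^ n =
      (G.y j l (u * X) u - (cauchyTransform (fun U => G.fastDbar U u) X +
        cauchyTransform (fun x => G.slowDbar x u) (u * X) + G.fastDiff j X u)) +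
      (cauchyTransform (fun U => G.fastDbar U u) X - ∑ n ∈ Finset.range N,
        cauchyTransform (fun U => gevreyCoeff (G.fastDbar U) n) X * u ^ n) +
      (cauchyTransform (fun x => G.slowDbar x u) (u * X) - ∑ n ∈ Finset.range N,
        cauchyTransform (fun x => gevreyCoeff (G.slowDbar x) n) (u * X) * u ^ n) +
      (G.fastDiff j X u - ∑ n ∈ Finset.range N, gevreyCoeff (G.fastDiff j X) n * u ^ n) := by
    have : ∑ n ∈ Finset.range N, (G.slowCoeff n (u * X) + G.fastCoeff j n X) * u ^ n =
        (∑ n ∈ Finset.range N,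
          cauchyTransform (fun U => gevreyCoeff (G.fastDbar U) n) X * u ^ n) +
        (∑ n ∈ Finset.range N,
          cauchyTransform (fun x => gevreyCoeff (G.slowDbar x) n) (u * X) * u ^ n) +
        ∑ n ∈ Finset.range N, gevreyCoeff (G.fastDiff j X) n * u ^ n := by
      rw [← Finset.sum_add_distrib, ← Finset.sum_add_distrib]
      refine Finset.sum_congr rfl fun n _ => ?_
      rw [slowCoeff, fastCoeff]; ring
    rw [this]; ring
  rw [hsplit]
  refine (norm_add_le _ _).trans ((add_le_add_left ((norm_add_le _ _).trans
    (add_le_add_left (norm_add_le _ _) _)) _).trans ?_)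
  have e3' : c₃ * ‖u‖ ^ N * (400 * a ^ (-(N : ℝ) / p) * Real.Gamma ((N : ℝ) / p + 1)) =
      c₃ * 400 * T := by rw [hT]; ring
  rw [e3'] at e3
  linarith

/-- The fast coefficients are holomorphic, being locally uniform limits, as `η → 0`, of quotients
formed with the functions `y j l (ηX, η)` and with the preceding coefficients. -/
theorem differentiableOn_fastCoeff {j : ι} {V : Set ℂ} (hV : IsOpen V) (hW : V ⊆ G.W j)
    (hΩ : V ⊆ G.Ω) (n : ℕ) : DifferentiableOn ℂ (G.fastCoeff j n) V := by
  obtain ⟨C, hC, hle⟩ := G.exists_norm_y_sub_sum_le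
  induction n using Nat.strong_induction_on with
  | _ n ih =>
    intro X₀ hX₀
    set R := ‖X₀‖ + 1 with hR
    have hR0 : 0 < R := by positivity
    set D := V ∩ Metric.ball (0 : ℂ) R with hD
    have hDo : IsOpen D := hV.inter Metric.isOpen_ball
    have hX₀D : X₀ ∈ D := ⟨hX₀, by rw [mem_ball_zero_iff, hR]; linarith⟩
    suffices h : DifferentiableOn ℂ (G.fastCoeff j n) D from
      ((h.differentiableAt (hDo.mem_nhds hX₀D))).differentiableWithinAt
    set e : ℕ → ℂ := fun k => 1 / ((k : ℂ) + 1) with he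
    have he0 : ∀ k, e k ≠ 0 := fun k => by
      simp only [he]; exact one_div_ne_zero (Nat.cast_add_one_ne_zero k)
    have het : Tendsto e atTop (𝓝 0) := tendsto_one_div_add_atTop_nhds_zero_nat
    have hen : Tendsto (fun k => ‖e k‖) atTop (𝓝 0) := by simpa using het.norm
    choose l hl using fun k => G.exists_mem_S (he0 k)
    have ev1 : ∀ᶠ k in atTop, ‖e k‖ < G.η₂ := hen.eventually (gt_mem_nhds G.hη₂)
    have ev2 : ∀ᶠ k in atTop, ‖e k‖ < G.r₁ / R :=
      hen.eventually (gt_mem_nhds (div_pos G.r₁_pos hR0))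
    have hsmall : ∀ k, ‖e k‖ < G.r₁ / R → ∀ X ∈ D, ‖e k * X‖ < G.r₁ := by
      intro k hk X hX
      have h1 : ‖X‖ < R := by simpa using hX.2
      rw [lt_div_iff₀ hR0] at hk
      rw [norm_mul]
      exact (mul_le_mul_of_nonneg_left h1.le (norm_nonneg _)).trans_lt hk
    -- The remainder of order `n + 1` shows that `F k` is `fastCoeff j n` up to `O(|e k|)`.
    set F : ℕ → ℂ → ℂ := fun k X => (G.y j (l k) (e k * X) (e k) -
      ∑ m ∈ Finset.range n, (G.slowCoeff m (e k * X) + G.fastCoeff j m X) * e k ^ m -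
      G.slowCoeff n (e k * X) * e k ^ n) / e k ^ n with hF
    have hlim : TendstoLocallyUniformlyOn F (G.fastCoeff j n) atTop D := by
      apply TendstoUniformlyOn.tendstoLocallyUniformlyOn
      rw [Metric.tendstoUniformlyOn_iff]
      intro ε hε
      set K := C * (min A (B * r₀ ^ p) ^ (-((n + 1 : ℕ) : ℝ) / p) *
        Real.Gamma (((n + 1 : ℕ) : ℝ) / p + 1)) with hK
      have ev3 : ∀ᶠ k in atTop, K * ‖e k‖ < ε := by
        have : Tendsto (fun k => K * ‖e k‖) atTop (𝓝 0) := by simpa using hen.const_mul K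
        exact this.eventually (gt_mem_nhds hε)
      filter_upwards [ev1, ev2, ev3] with k h1 h2 h3 X hX
      have h4 := hle j (l k) X (e k) (hl k) h1.le (hW hX.1) (hΩ hX.1) (hsmall k h2 X hX).le (n + 1)
      have hek : e k ^ n ≠ 0 := pow_ne_zero n (he0 k)
      have h5 : F k X - G.fastCoeff j n X = (G.y j (l k) (e k * X) (e k) -
          ∑ m ∈ Finset.range (n + 1), (G.slowCoeff m (e k * X) + G.fastCoeff j m X) * e k ^ m) /
            e k ^ n := by
        rw [Finset.sum_range_succ]
        simp only [hF]
        field_simp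
        ring
      rw [dist_comm, dist_eq_norm, h5, norm_div, norm_pow, div_lt_iff₀ (pow_pos
        (norm_pos_iff.2 (he0 k)) n)]
      refine h4.trans_lt ?_
      calc _ = K * ‖e k‖ * ‖e k‖ ^ n := by rw [hK]; ring
        _ < _ := mul_lt_mul_of_pos_right h3 (pow_pos (norm_pos_iff.2 (he0 k)) n)
    refine hlim.differentiableOn ?_ hDo
    filter_upwards [ev1, ev2] with k h1 h2
    have hs : ∀ m, DifferentiableOn ℂ (fun X => G.slowCoeff m (e k * X)) D := fun m =>
      (G.differentiableOn_slowCoeff m).comp (f := fun X : ℂ => e k * X) (by fun_prop)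
        fun X hX => by rw [mem_ball_zero_iff]; exact hsmall k h2 X hX
    have hy : DifferentiableOn ℂ (fun X => G.y j (l k) (e k * X) (e k)) D := by
      intro X hX
      have := G.differentiableAt_y_left (i := j) (x := e k * X) (hl k)
        (h1.trans (G.hη₁.trans G.hη₀)) (by rw [mul_div_cancel_left₀ _ (he0 k)]; exact hW hX.1)
        ((hsmall k h2 X hX).trans (G.hr₂.trans G.hr'))
      exact (this.comp (f := fun v : ℂ => e k * v) X (by fun_prop)).differentiableWithinAt
    refine ((hy.sub (DifferentiableOn.fun_sum fun m hm => ?_)).sub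
      ((hs n).mul_const _)).div_const _
    exact ((hs m).add ((ih m (Finset.mem_range.1 hm)).mono inter_subset_left)).mul_const _

end GluingData

/-! ### The combined asymptotic expansion -/

section

variable {J L : ℕ} [NeZero J] [NeZero L] {αV βV : Fin J → ℝ} {αS βS : Fin L → ℝ} {μ η₀ δ : ℝ}

/-- The gluing data of a coherent good covering. -/
theorem IsCoherentGoodCover.exists_gluingData (h : IsCoherentGoodCover αV βV αS βS μ η₀ δ)
    {p : ℕ} {r₀ r' μ' A B C K : ℝ} (hp : 0 < p) (hη₀ : 0 < η₀) (hr₀ : 0 < r₀) (hr' : r₀ < r')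
    (hμ' : μ < μ') (hA : 0 < A) (hB : 0 < B) (hC : 0 ≤ C) (hK : 0 ≤ K)
    {y : Fin J → Fin L → ℂ → ℂ → ℂ}
    (hy : ∀ R₀, μ' ≤ R₀ → IsOverlapFamily p A B C K η₀ r' R₀
      (fun j => quasiSector (αV j) (βV j) ⊤ μ') (fun l => {η | HasArgIn (αS l) (βS l) η}) y) :
    ∃ G : GluingData (Fin J) (Fin L) p A B r₀, G.y = y ∧
      G.W = (fun j => quasiSector (αV j) (βV j) ⊤ μ') ∧
      G.S = (fun l => {η | HasArgIn (αS l) (βS l) η}) ∧ G.Ω = outerAnnulus (-μ) ∧ μ ≤ G.R₀ := by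
  -- For `|X| > R₀` the condition `|X| > -μ` holds, and `|X| < μ'` fails.
  set R₀ := |μ'| + |μ| + 1 with hR₀
  have hR₀pos : 0 < R₀ := by positivity
  have hμR : μ ≤ R₀ := by linarith [le_abs_self μ, abs_nonneg μ']
  have hμR' : -μ ≤ R₀ := by linarith [neg_abs_le μ, abs_nonneg μ']
  set r₁ := (2 * r₀ + r') / 3 with hr₁
  set r₂ := (r₀ + 2 * r') / 3 with hr₂
  -- The second term ensures `R₀ * η₁ < r₁`.
  set η₁ := min (η₀ / 2) (r₁ / (2 * R₀)) with hη₁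
  have hr₁0 : 0 < r₁ := by linarith
  have hη₁0 : 0 < η₁ := lt_min (by linarith) (by positivity)
  have hη₁R : R₀ * η₁ < r₁ := by
    have h1 : R₀ * η₁ ≤ R₀ * (r₁ / (2 * R₀)) :=
      mul_le_mul_of_nonneg_left (min_le_right _ _) hR₀pos.le
    have h2 : R₀ * (r₁ / (2 * R₀)) = r₁ / 2 := by field_simp
    linarith
  obtain ⟨k₁, k₁c, k₁1, k₁0, k₁n, -, k₁d, -, C₁, -, k₁b⟩ :=
    exists_cutoff (r₁ := η₁ / 2) (r₂ := η₁) (by linarith) (by linarith)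
  obtain ⟨k₂, k₂c, k₂1, k₂0, k₂n, -, k₂d, k₂d', C₂, -, k₂b⟩ :=
    exists_cutoff (r₁ := r₁) (r₂ := r₂) hr₁0 (by linarith)
  obtain ⟨χ, χc, χn, χs, χsupp, Cχ, -, χd⟩ := exists_angular_partition αS βS
    fun u hu => h.goodS.exists_hasArgIn hη₀ hu
  obtain ⟨ψ, ψc, ψn, ψs, ψsupp, Cψ, -, ψd⟩ := exists_quasiSector_partition (0 : Fin J) αV βV hμ'
    fun u hu => h.goodV.exists_hasArgIn hu
  exact ⟨{
    W := fun j => quasiSector (αV j) (βV j) ⊤ μ'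
    S := fun l => {η | HasArgIn (αS l) (βS l) η}
    y := y
    Ω := outerAnnulus (-μ)
    C := C
    K := K
    η₀ := η₀
    r' := r'
    R₀ := R₀
    r₁ := r₁
    r₂ := r₂
    η₁ := η₁
    η₂ := η₁ / 2
    C₁ := C₁
    C₂ := C₂
    Cχ := Cχ
    Cψ := Cψ
    k₁ := k₁
    k₂ := k₂
    χ := χ
    ψ := ψ
    hp := hp
    hA := hA
    hB := hB
    hC := hC
    hK := hK
    hr₀ := hr₀
    hr₁ := by linarith
    hr₂ := by linarith
    hr' := by linarith
    hη₂ := by linarith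
    hη₁ := by linarith
    hη₀ := (min_le_left _ _).trans_lt (by linarith)
    hR₀ := hR₀pos
    hRη := hη₁R
    overlap := hy R₀ (by linarith [le_abs_self μ', abs_nonneg μ])
    k₁_contDiff := k₁c
    k₁_one := k₁1
    k₁_zero := k₁0
    k₁_norm := k₁n
    k₁_fderiv_zero := k₁d
    k₁_fderiv := k₁b
    k₂_contDiff := k₂c
    k₂_one := k₂1
    k₂_zero := k₂0
    k₂_norm := k₂n
    k₂_fderiv_zero := k₂d
    k₂_fderiv_zero' := k₂d'
    k₂_fderiv := k₂b
    χ_contDiffAt := χc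
    χ_norm := χn
    χ_sum := χs
    χ_subordinate := χsupp
    χ_fderiv := χd
    ψ_contDiff := ψc
    ψ_norm := ψn
    isOpen_Ω := isOpen_lt continuous_const continuous_norm
    mem_Ω := fun U hU => hμR'.trans_lt hU
    ψ_sum := ψs
    ψ_subordinate := ψsupp
    ψ_fderiv := ψd }, rfl, rfl, rfl, rfl, hμR⟩

theorem quasiSector_mono_right {α β : ℝ} {r : EReal} {μ μ' : ℝ} (h : μ ≤ μ') :
    quasiSector α β r μ ⊆ quasiSector α β r μ' := by
  rintro x (⟨h1, h2⟩ | h1)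
  · exact Or.inl ⟨by linarith, h2⟩
  · exact Or.inr (h1.trans_le h)

end

end DAC

theorem mainTheorem1 (p J L : ℕ) (hp : 0 < p) [NeZero J] [NeZero L]
    (αV βV : Fin J → ℝ) (αS βS : Fin L → ℝ) (μ η₀ r₀ δ : ℝ) (hη₀ : 0 < η₀) (hr₀ : 0 < r₀)
    (hcover : DAC.IsCoherentGoodCover αV βV αS βS μ η₀ δ)
    (r' μ' : ℝ) (hr' : r₀ < r') (hμ' : μ < μ')
    (y : Fin J → Fin L → ℂ → ℂ → ℂ)
    (hol : ∀ j l, DifferentiableOn ℂ (fun z : ℂ × ℂ => y j l z.1 z.2)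
      {z | z.2 ∈ DAC.sector (αS l) (βS l) η₀ ∧
        z.1 ∈ DAC.bigCoverV αV βV αS βS δ r' μ' j l z.2})
    (bdd : ∀ j l, ∃ K : ℝ, ∀ η ∈ DAC.sector (αS l) (βS l) η₀,
      ∀ x ∈ DAC.bigCoverV αV βV αS βS δ r' μ' j l η, ‖y j l x η‖ ≤ K)
    (A B C : ℝ) (hA : 0 < A) (hB : 0 < B) (hC : 0 < C)
    (hl : ∀ j l, ∀ η ∈ DAC.sector (αS l) (βS l) η₀ ∩ DAC.sector (αS (l + 1)) (βS (l + 1)) η₀,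
      ∀ x ∈ DAC.bigCoverV αV βV αS βS δ r' μ' j l η ∩
          DAC.bigCoverV αV βV αS βS δ r' μ' j (l + 1) η,
        ‖y j (l + 1) x η - y j l x η‖ ≤ C * Real.exp (-(A / ‖η‖ ^ p)))
    (hj : ∀ j l, ∀ η ∈ DAC.sector (αS l) (βS l) η₀,
      ∀ x ∈ DAC.bigCoverV αV βV αS βS δ r' μ' j l η ∩
          DAC.bigCoverV αV βV αS βS δ r' μ' (j + 1) l η,
        ‖y (j + 1) l x η - y j l x η‖ ≤ C * Real.exp (-(B * ‖x / η‖ ^ p))) :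
    ∃ (a : ℕ → ℂ → ℂ) (g : Fin J → ℕ → ℂ → ℂ) (c : ℕ → ℕ → ℂ) (C' : ℝ),
      (∀ n, DAC.MemH r₀ (a n)) ∧
      (∀ j n, DAC.MemG (DAC.quasiSector (αV j) (βV j) ⊤ μ) (g j n)) ∧
      (∀ j l, DAC.HasGevreyCombinedExpansion p
        ((min A (B * r₀ ^ p)) ^ (-(1 : ℝ) / p)) (B ^ (-(1 : ℝ) / p))
        (αV j) (βV j) μ (αS l) (βS l) η₀
        (DAC.lowAngle αV αS βS δ j l) (DAC.highAngle βV αS βS δ j l) r₀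
        (y j l) a (g j)) ∧
      (∀ j l, ∀ η ∈ DAC.sector (αS l) (βS l) η₀,
        ∀ x ∈ DAC.coverV αV βV αS βS δ r₀ μ j l η, ∀ N : ℕ, 0 < N →
          ‖y j l x η - ∑ n ∈ Finset.range N, (a n x + g j n (x / η)) * η ^ n‖
            ≤ C' * (min A (B * r₀ ^ p)) ^ (-(N : ℝ) / p) * Real.Gamma ((N : ℝ) / p + 1)
                * ‖η‖ ^ N) ∧
      (∀ j n, DAC.HasExpansionAtInfinity (DAC.quasiSector (αV j) (βV j) ⊤ μ) (g j n) (c n)) ∧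
      (∀ j, ∀ n M : ℕ, ∀ X ∈ DAC.quasiSector (αV j) (βV j) ⊤ μ,
        ‖X‖ ^ M * ‖g j n X - ∑ m ∈ Finset.Ico 1 M, c n m * (X ^ m)⁻¹‖
          ≤ C' * (min A (B * r₀ ^ p)) ^ (-(n : ℝ) / p) * B ^ (-(M : ℝ) / p)
              * Real.Gamma (((M : ℝ) + n) / p + 1)) := by
  choose K₀ hK₀ using bdd
  set K := ∑ j, ∑ l, |K₀ j l| with hKdef
  have hK : 0 ≤ K := Finset.sum_nonneg fun j _ => Finset.sum_nonneg fun l _ => abs_nonneg _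
  have hbdd : ∀ j l, ∀ η ∈ DAC.sector (αS l) (βS l) η₀,
      ∀ x ∈ DAC.bigCoverV αV βV αS βS δ r' μ' j l η, ‖y j l x η‖ ≤ K := by
    intro j l η hη x hx
    refine (hK₀ j l η hη x hx).trans ((le_abs_self _).trans ?_)
    exact (Finset.single_le_sum (f := fun l => |K₀ j l|) (fun _ _ => abs_nonneg _)
      (Finset.mem_univ l)).trans (Finset.single_le_sum (f := fun j => ∑ l, |K₀ j l|)
        (fun _ _ => Finset.sum_nonneg fun _ _ => abs_nonneg _) (Finset.mem_univ j))
  obtain ⟨G, hGy, hGW, hGS, hGΩ, hGR⟩ := hcover.exists_gluingData hp hη₀ hr₀ hr' hμ' hA hB hC.le hK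
    fun R₀ hR₀ => hcover.isOverlapFamily hC.le hol hbdd hl hj hR₀
  set a' := min A (B * r₀ ^ p) with ha'
  have ha'0 : 0 < a' := G.min_pos
  -- The quasi-sectors `V^j` are contained in the domains of the gluing data.
  have hVW : ∀ j, DAC.quasiSector (αV j) (βV j) ⊤ μ ⊆ G.W j := fun j => by
    rw [hGW]; exact DAC.quasiSector_mono_right hμ'.le
  have hVΩ : ∀ j, DAC.quasiSector (αV j) (βV j) ⊤ μ ⊆ G.Ω := fun j => by
    rw [hGΩ, ← hcover.goodV.iUnion_eq]
    exact Set.subset_iUnion (fun j => DAC.quasiSector (αV j) (βV j) ⊤ μ) j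
  obtain ⟨C₁, hC₁, hslow⟩ := G.exists_norm_slowCoeff_le
  obtain ⟨C₂, hC₂, hfast⟩ := G.exists_fastCoeff_expansion
  obtain ⟨C₃, hC₃, hnear⟩ := G.exists_norm_y_sub_sum_le
  have hfast0 : ∀ j n, ∀ X ∈ DAC.quasiSector (αV j) (βV j) ⊤ μ, ‖G.fastCoeff j n X‖ ≤
      C₂ * (a' ^ (-(n : ℝ) / p) * Real.Gamma ((n : ℝ) / p + 1)) := by
    intro j n X hX
    have := hfast j n 0 X (hVW j hX) (hVΩ j hX)
    simpa using this
  -- For `|η| ≥ η₂` the boundedness of the functions is enough.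
  obtain ⟨C₄, hC₄, hfar⟩ := DAC.exists_norm_sub_sum_le_of_le hp (K := K + (C₁ + C₂)) ha'0 G.hη₂
    (by positivity)
  have hrem : ∀ j l, ∀ η ∈ DAC.sector (αS l) (βS l) η₀,
      ∀ x ∈ DAC.coverV αV βV αS βS δ r₀ μ j l η, ∀ N : ℕ,
      ‖y j l x η - ∑ n ∈ Finset.range N, (G.slowCoeff n x + G.fastCoeff j n (x / η)) * η ^ n‖ ≤
        (C₃ + C₄) * (a' ^ (-(N : ℝ) / p) * Real.Gamma ((N : ℝ) / p + 1) * ‖η‖ ^ N) := by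
    intro j l η hη x hx N
    have hGN : 0 < Real.Gamma ((N : ℝ) / p + 1) := Real.Gamma_pos_of_pos (by positivity)
    have hT : 0 ≤ a' ^ (-(N : ℝ) / p) * Real.Gamma ((N : ℝ) / p + 1) * ‖η‖ ^ N := by positivity
    have hX := hcover.div_mem hη.2 hx
    have hη0 : η ≠ 0 := hη.2.1
    have hηx : η * (x / η) = x := by field_simp
    rw [add_mul]
    rcases le_total ‖η‖ G.η₂ with h | h
    · -- For small `η`, points of `V_l^j(η)` satisfy `|x| ≤ r₁`, also those with `|x| < μ |η|`.
      have hxr : ‖η * (x / η)‖ ≤ G.r₁ := by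
        rw [hηx]
        rcases hx with ⟨-, h1, -⟩ | h1
        · exact (EReal.coe_lt_coe_iff.1 h1).le.trans G.hr₁.le
        · refine h1.le.trans (le_trans ?_ G.hRη.le)
          exact mul_le_mul hGR (h.trans G.hη₁.le) (norm_nonneg _) G.hR₀.le
      have := hnear j l (x / η) η (by rw [hGS]; exact hη.2) h (hVW j hX) (hVΩ j hX) hxr N
      rw [hηx, hGy] at this
      exact this.trans (le_add_of_nonneg_right (mul_nonneg hC₄ hT))
    · refine (hfar (y j l x η) η _ ?_ h (fun n => ?_) N).trans
        (le_add_of_nonneg_left (mul_nonneg hC₃ hT))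
      · exact (hbdd j l η hη x (hcover.coverV_subset hr' hμ' hx)).trans
          (le_add_of_nonneg_right (by positivity))
      · have hGn : 0 < Real.Gamma ((n : ℝ) / p + 1) := Real.Gamma_pos_of_pos (by positivity)
        refine (norm_add_le _ _).trans ((add_le_add (hslow n x) (hfast0 j n _ hX)).trans ?_)
        rw [← add_mul]
        exact mul_le_mul_of_nonneg_right (le_add_of_nonneg_left hK) (by positivity)
  have hMemH : ∀ n, DAC.MemH r₀ (G.slowCoeff n) := fun n =>
    ⟨(G.differentiableOn_slowCoeff n).mono (Metric.ball_subset_ball G.hr₁.le), _,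
      fun x _ => hslow n x⟩
  have hExp : ∀ j n, DAC.HasExpansionAtInfinity (DAC.quasiSector (αV j) (βV j) ⊤ μ)
      (G.fastCoeff j n) (G.fastMoment n) := fun j n M =>
    ⟨_, fun X hX => hfast j n M X (hVW j hX) (hVΩ j hX)⟩
  have hMemG : ∀ j n, DAC.MemG (DAC.quasiSector (αV j) (βV j) ⊤ μ) (G.fastCoeff j n) :=
    fun j n => ⟨G.differentiableOn_fastCoeff (DAC.isOpen_quasiSector _ _ _) (hVW j) (hVΩ j) n,
      ⟨_, hfast0 j n⟩, _, hExp j n⟩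
  have hpow : ∀ {b : ℝ}, 0 < b → ∀ n : ℕ, b ^ (-(n : ℝ) / p) = (b ^ (-(1 : ℝ) / p)) ^ n := by
    intro b hb n
    rw [← Real.rpow_natCast, ← Real.rpow_mul hb.le]
    congr 1; ring
  have hGamma : ∀ s : ℝ, 0 ≤ s → 0 ≤ Real.Gamma (s + 1) := fun s hs =>
    (Real.Gamma_pos_of_pos (by linarith)).le
  refine ⟨G.slowCoeff, G.fastCoeff, G.fastMoment, (C₃ + C₄) + C₂, hMemH, hMemG, fun j l => ?_,
    fun j l η hη x hx N _ => ?_, hExp, fun j n M X hX => ?_⟩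
  · refine ⟨hcover.low_le j l, hcover.lowAngle_lt j l, hcover.high_le j l, ⟨hMemH, hMemG j,
      G.fastMoment, C₁ + C₂, hExp j, fun n x _ => ?_, fun n M X hX => ?_⟩, ?_, C₃ + C₄,
      fun N η hη x hx => ?_⟩
    · rw [← hpow ha'0, mul_assoc]
      refine (hslow n x).trans (mul_le_mul_of_nonneg_right (by linarith) ?_)
      exact mul_nonneg (Real.rpow_nonneg ha'0.le _) (hGamma _ (by positivity))
    · rw [← hpow ha'0, ← hpow hB, mul_assoc, mul_assoc, ← mul_assoc (a' ^ _)]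
      refine (hfast j n M X (hVW j hX) (hVΩ j hX)).trans
        (mul_le_mul_of_nonneg_right (by linarith) ?_)
      exact mul_nonneg (mul_nonneg (Real.rpow_nonneg ha'0.le _) (Real.rpow_nonneg hB.le _))
        (hGamma _ (by positivity))
    · exact (hol j l).mono fun z hz => ⟨hz.1, hcover.coverV_subset hr' hμ' hz.2⟩
    · rw [← hpow ha'0, mul_assoc, mul_assoc, ← mul_assoc (a' ^ _)]
      exact hrem j l η hη x hx N
  · have hnn : 0 ≤ a' ^ (-(N : ℝ) / p) * Real.Gamma ((N : ℝ) / p + 1) * ‖η‖ ^ N :=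
      mul_nonneg (mul_nonneg (Real.rpow_nonneg ha'0.le _) (hGamma _ (by positivity)))
        (by positivity)
    calc _ ≤ _ := hrem j l η hη x hx N
      _ ≤ (C₃ + C₄ + C₂) * (a' ^ (-(N : ℝ) / p) * Real.Gamma ((N : ℝ) / p + 1) * ‖η‖ ^ N) :=
        mul_le_mul_of_nonneg_right (le_add_of_nonneg_right hC₂) hnn
      _ = _ := by ring
  · rw [mul_assoc _ (a' ^ _), mul_assoc]
    refine (hfast j n M X (hVW j hX) (hVΩ j hX)).trans
      (mul_le_mul_of_nonneg_right (by linarith) ?_)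
    exact mul_nonneg (mul_nonneg (Real.rpow_nonneg ha'0.le _) (Real.rpow_nonneg hB.le _))
      (hGamma _ (by positivity))
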